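/- Let $p,q\ge 1$ and $\ell>1$ be integers with $\ell\mid p$ and $\ell\mid q$, let $\eta$ be a primitive $\ell$-th root of unity, and let $\mathbf w=x^p+y^q$. Let $L$ be the abelian group generated by $\vec x,\vec y$ with the single relation $\frac p\ell\vec x=\frac q\ell\vec y$, let $\vec c=p\vec x=q\vec y$, grade $S=\mathbb C[x,y]$ by $L$ with $|x|=\vec x$, $|y|=\vec y$, and put $R=S/(\mathbf w)$. (Thus $L$ is the character group of the admissible subgroup of index $\ell$ of the maximal symmetry group of $\mathbf w$.) For $r=1,\dots,\ell$ let $w_r=x^{p/\ell}-e^{\pi\sqrt{-1}/\ell}\eta^r y^{q/\ell}$, so that $\mathbf w=w_1\cdots w_\ell$, and let $K_{w_r}$ be the $L$-graded matrix factorisation $\cdots\to S(-\vec c)\xrightarrow{\mathbf w/w_r}S(-\frac p\ell\vec x)\xrightarrow{w_r}S\to\cdots$, with $S$ in cohomological degree $0$. For $1\le j\le q-1$ put $k=\lfloor (j-1)\ell/q\rfloor$. Let $K_0^{i,j}$ be the matrix factorisation that stabilises the graded $R$-module $$R(i\vec x+j\vec y)/\big(x^{i-(\ell-k-1)\frac p\ell},\,x^{i-(\ell-k)\frac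 p\ell}y^{j-k\frac q\ell},\dots,x^{i-(\ell-1)\frac p\ell}y^{j-\frac q\ell},\,y^j\big)$$ for $(\ell-1)\frac p\ell+1\le i\le p-1$, $1\le j\le q-1$, and the graded $R$-module $$R(i\vec x+j\vec y)/\big(x^{k\frac p\ell},\,x^{(k-1)\frac p\ell}y^{j-k\frac q\ell},\dots,x^{\frac p\ell}y^{j-2\frac q\ell},\,y^{j-\frac q\ell}\big)$$ for $i=(\ell-1)\frac p\ell$, $\frac q\ell+1\le j\le q-1$. Let $\mathcal B$ be the full subcategory of the dg-category of $L$-graded matrix factorisations of $\mathbf w$ with objects all these $K_0^{i,j}$ and $K_{w_1}[3],\dots,K_{w_\ell}[3]$. Let $Q$ be the quiver whose vertices are the objects of $\mathcal B$, with the following arrows: * an arrow $y:K_0^{i,j}\to K_0^{i,j+1}$ whenever both are vertices; * an arrow $x:K_0^{i,j}\to K_0^{i+1,j}$ whenever both are vertices, and an arrow $x:K_0^{p-1,j}\to K_0^{(\ell-1)\frac p\ell,\,j+\frac q\ell}$ whenever both are vertices; * for $r=1,\dots,\ell$ an arrow $c_r:K_0^{p-1,q-1}\to K_{w_r}[3]$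 (if $K_0^{p-1,q-1}$ is a vertex, i.e. unless $p=q=\ell=2$). Then the cohomology of every morphism complex between objects of $\mathcal B$ is concentrated in degree $0$, and the total endomorphism algebra $H^0\big(\operatorname{End}(\bigoplus_{K\in\mathcal B}K)\big)$ is isomorphic to the path algebra $\mathbb CQ$ modulo the relations $xy=yx$ and $c_r\big(x^{p/\ell}-e^{\pi\sqrt{-1}/\ell}\eta^r y^{q/\ell}\big)=0$ for $r=1,\dots,\ell$, by an isomorphism that takes the idempotent of each vertex to the identity of the corresponding object. In particular $\mathcal B$ is intrinsically formal: every $\mathbb Z$-graded $A_\infty$-category over $\mathbb C$ with the same objects whose cohomology category is isomorphic to that of $\mathcal B$ (by an isomorphism that is the identity on objects) is quasi-isomorphic to $\mathcal B$, i.e. connected to $\mathcal B$ by a zigzag of $A_\infty$-quasi-isomorphisms that are the identity on objects. -/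

import Mathlib

noncomputable section

open MvPolynomial

/-- A `ℤ`-graded `ℂ`-linear `A_∞`-category with set of objects `V`, in the sign conventions of
Seidel's book.  The graded pieces `hom u v n = hom^n(u, v)` are realised as linearly independent
subspaces of one vector space `carrier`, so that the operations on hom-spaces are exactly the
restrictions of multilinear operations on `carrier`; only their values on the hom-spaces matter.
For composable `a₁ : X₀ → X₁, …, a_d : X_{d-1} → X_d` the element `μ d ![a₁, …, a_d]` is
`μ^d(a_d, …, a₁)`; it has degree `|a₁| + … + |a_d| + 2 - d` (`d ≥ 1`; `μ 0` is not used).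
The field `rel` is the `A_∞`-relation
`∑_{r, s} (-1)^{|a₁| + … + |a_r| - r}
  μ^{d+1-s}(a_d, …, a_{r+s+1}, μ^s(a_{r+s}, …, a_{r+1}), a_r, …, a₁) = 0`. -/
structure AInfCat (V : Type) where
  carrier : Type
  [addCommGroup : AddCommGroup carrier]
  [moduleInst : Module ℂ carrier]
  hom : V → V → ℤ → Submodule ℂ carrier
  indep : iSupIndep fun t : V × V × ℤ => hom t.1 t.2.1 t.2.2
  μ : (d : ℕ) → MultilinearMap ℂ (fun _ : Fin d => carrier) carrier
  μ_mem : ∀ (d : ℕ) (X : ℕ → V) (n : ℕ → ℤ) (a : ℕ → carrier), 1 ≤ d →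
    (∀ i < d, a i ∈ hom (X i) (X (i + 1)) (n i)) →
      μ d (fun i => a i) ∈ hom (X 0) (X d) (∑ i ∈ Finset.range d, n i + 2 - d)
  rel : ∀ (d : ℕ) (X : ℕ → V) (n : ℕ → ℤ) (a : ℕ → carrier),
    (∀ i < d, a i ∈ hom (X i) (X (i + 1)) (n i)) →
      ∑ s ∈ Finset.Icc 1 d, ∑ r ∈ Finset.range (d + 1 - s),
        (∑ i ∈ Finset.range r, (n i - 1)).negOnePow •
          μ (d + 1 - s) (fun i => if (i : ℕ) < r then a i
            else if (i : ℕ) = r then μ s (fun k => a (r + k)) else a (i + s - 1)) = 0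

namespace AInfCat

attribute [instance] AInfCat.addCommGroup AInfCat.moduleInst

variable {V : Type}

theorem update_fin_one {M : Type} (x y : M) :
    Function.update (fun _ : Fin 1 => x) 0 y = fun _ => y := by
  funext i
  rw [Subsingleton.elim i 0, Function.update_self]

/-- The differential `μ¹`. -/
def μ₁ (A : AInfCat V) : A.carrier →ₗ[ℂ] A.carrier where
  toFun a := A.μ 1 (fun _ => a)
  map_add' a b := by
    have h := (A.μ 1).map_update_add (fun _ => 0) 0 a b
    rwa [update_fin_one, update_fin_one, update_fin_one] at h
  map_smul' t a := by
    have h := (A.μ 1).map_update_smul (fun _ => 0) 0 t a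
    rwa [update_fin_one, update_fin_one] at h

/-- Degree `n` cocycles in `hom(u, v)`. -/
def cocycles (A : AInfCat V) (u v : V) (n : ℤ) : Submodule ℂ A.carrier :=
  A.hom u v n ⊓ LinearMap.ker A.μ₁

/-- Degree `n` coboundaries in `hom(u, v)`. -/
def coboundaries (A : AInfCat V) (u v : V) (n : ℤ) : Submodule ℂ A.carrier :=
  (A.hom u v (n - 1)).map A.μ₁

/-- The cohomology `H^n(hom(u, v))`. -/
abbrev H (A : AInfCat V) (u v : V) (n : ℤ) : Type :=
  A.cocycles u v n ⧸ (A.coboundaries u v n).submoduleOf (A.cocycles u v n)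

theorem μ₂_mem_cocycles (A : AInfCat V) {u v w : V} {m n : ℤ} {a b : A.carrier}
    (ha : a ∈ A.cocycles u v n) (hb : b ∈ A.cocycles v w m) :
    A.μ 2 ![a, b] ∈ A.cocycles u w (n + m) := by
  have e1 : ∀ i < 2, (fun i => if i = 0 then a else b : ℕ → A.carrier) i ∈
      A.hom ((fun i => if i = 0 then u else if i = 1 then v else w : ℕ → V) i)
        ((fun i => if i = 0 then u else if i = 1 then v else w : ℕ → V) (i + 1))
        ((fun i => if i = 0 then n else m : ℕ → ℤ) i) := by
    intro i hi
    interval_cases i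
    · simpa using ha.1
    · simpa using hb.1
  have e2 : (fun i : Fin 2 => (fun i => if i = 0 then a else b : ℕ → A.carrier) i) = ![a, b] := by
    funext i; fin_cases i <;> simp
  have ha' : A.μ 1 (fun _ => a) = 0 := ha.2
  have hb' : A.μ 1 (fun _ => b) = 0 := hb.2
  refine ⟨?_, ?_⟩
  · have h := A.μ_mem 2 _ _ _ (by norm_num) e1
    rw [e2] at h
    simpa [Finset.sum_range_succ] using h
  · have h := A.rel 2 _ _ _ e1
    rw [show Finset.Icc 1 2 = {1, 2} by rfl, Finset.sum_pair (by norm_num)] at h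
    norm_num [Finset.sum_range_succ] at h
    have key : ∀ (x y z : A.carrier) (e : ℤˣ), x + e • y + z = 0 → x = 0 → y = 0 → z = 0 := by
      intro x y z e h hx hy
      simpa [hx, hy] using h
    have hz := key _ _ _ _ h ((A.μ 2).map_coord_zero (0 : Fin 2) (by simpa using ha'))
      ((A.μ 2).map_coord_zero (1 : Fin 2) (by simpa using hb'))
    refine Eq.trans (congrArg (A.μ 1) ?_) hz
    funext i
    refine congrArg (A.μ 2) ?_
    funext k
    fin_cases k <;> simp

/-- The cohomology categories of `A` and `B` are isomorphic, by an isomorphism that is the identity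
on objects.  The composition in the cohomology category is `[b] ∘ [a] = (-1)^{|a|} [μ²(b, a)]`; the
sign is the same on both sides and is cancelled. -/
def HIso (A B : AInfCat V) : Prop :=
  ∃ e : ∀ (u v : V) (n : ℤ), A.H u v n ≃ₗ[ℂ] B.H u v n,
    ∀ (u v w : V) (n m : ℤ) (a : A.cocycles u v n) (b : A.cocycles v w m)
      (a' : B.cocycles u v n) (b' : B.cocycles v w m),
      e u v n (Submodule.Quotient.mk a) = Submodule.Quotient.mk a' →
      e v w m (Submodule.Quotient.mk b) = Submodule.Quotient.mk b' →
      e u w (n + m) (Submodule.Quotient.mk ⟨A.μ 2 ![a, b], A.μ₂_mem_cocycles a.2 b.2⟩) =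
        Submodule.Quotient.mk ⟨B.μ 2 ![a', b'], B.μ₂_mem_cocycles a'.2 b'.2⟩

end AInfCat

/-- An `A_∞`-functor that is the identity on objects.  `F d ![a₁, …, a_d]` is `F^d(a_d, …, a₁)`, of
degree `|a₁| + … + |a_d| + 1 - d` (`d ≥ 1`; `F 0` is not used).  In `rel` the left-hand side is the
sum of `μ_B(F(a_d, …), …, F(…, a₁))` over all ways of cutting `a_d, …, a₁` into consecutive
non-empty blocks. -/
structure AInfFunctor {V : Type} (A B : AInfCat V) where
  F : (d : ℕ) → MultilinearMap ℂ (fun _ : Fin d => A.carrier) B.carrier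
  F_mem : ∀ (d : ℕ) (X : ℕ → V) (n : ℕ → ℤ) (a : ℕ → A.carrier), 1 ≤ d →
    (∀ i < d, a i ∈ A.hom (X i) (X (i + 1)) (n i)) →
      F d (fun i => a i) ∈ B.hom (X 0) (X d) (∑ i ∈ Finset.range d, n i + 1 - d)
  rel : ∀ (d : ℕ) (X : ℕ → V) (n : ℕ → ℤ) (a : ℕ → A.carrier), 1 ≤ d →
    (∀ i < d, a i ∈ A.hom (X i) (X (i + 1)) (n i)) →
      ∑ c : Composition d,
          B.μ c.length (fun j => F (c.blocksFun j) (fun k => a (c.embedding j k))) =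
        ∑ s ∈ Finset.Icc 1 d, ∑ r ∈ Finset.range (d + 1 - s),
          (∑ i ∈ Finset.range r, (n i - 1)).negOnePow •
            F (d + 1 - s) (fun i => if (i : ℕ) < r then a i
              else if (i : ℕ) = r then A.μ s (fun k => a (r + k)) else a (i + s - 1))

namespace AInfFunctor

variable {V : Type} {A B : AInfCat V}

/-- `F¹` induces isomorphisms on the cohomology of all hom-spaces. -/
def IsQuasiIso (f : AInfFunctor A B) : Prop :=
  ∀ (u v : V) (n : ℤ),
    (∀ a ∈ A.cocycles u v n, f.F 1 (fun _ => a) ∈ B.coboundaries u v n →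
      a ∈ A.coboundaries u v n) ∧
    ∀ b ∈ B.cocycles u v n, ∃ a ∈ A.cocycles u v n,
      b - f.F 1 (fun _ => a) ∈ B.coboundaries u v n

end AInfFunctor

namespace AInfCat

variable {V : Type}

/-- Two `A_∞`-categories are quasi-isomorphic if they are connected by a zigzag of `A_∞`-functors
that are quasi-isomorphisms. -/
def QuasiIsomorphic (A B : AInfCat V) : Prop :=
  Relation.EqvGen (fun A B : AInfCat V => ∃ f : AInfFunctor A B, f.IsQuasiIso) A B

/-- `B` is intrinsically formal if every `A_∞`-category with the same cohomology category is
quasi-isomorphic to `B` (so `B`, and every such `A_∞`-category, is quasi-isomorphic to its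
cohomology category with trivial differential and trivial higher products). -/
def IntrinsicallyFormal (B : AInfCat V) : Prop :=
  ∀ A : AInfCat V, HIso A B → QuasiIsomorphic A B

end AInfCat

/-- The polynomial ring `S = ℂ[x, y]`, with `x = X 0` and `y = X 1`. -/
abbrev PolyS : Type := MvPolynomial (Fin 2) ℂ

section Degrees

variable {L : Type} [AddCommGroup L]

/-- For a grading of `S` by `L` with `|x| = δ 0`, `|y| = δ 1` and a degree `c`, a generator of
weight `α` in cohomological degree `k` stands for the `2`-periodic object that is `S(α + m c)` in
cohomological degree `k + 2 m` for every `m : ℤ`.  `shiftHom δ c α k β l n` is the space of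
`2`-periodic graded `S`-linear maps of cohomological degree `n` from the generator `(α, k)` to the
generator `(β, l)`: if `l + 2 m = k + n`, such a map is a map `S(α) → S(β + m c)` of `L`-degree `0`,
i.e. a homogeneous polynomial of degree `β + m c - α`; if there is no such `m`, it is zero.  Here
`S(α)_λ = S_{α + λ}`. -/
def shiftHom (δ : Fin 2 → L) (c : L) (α : L) (k : ℤ) (β : L) (l : ℤ) (n : ℤ) :
    Submodule ℂ PolyS where
  carrier := {f | (∀ m : ℤ, l + 2 * m = k + n → IsWeightedHomogeneous δ f (β + m • c - α)) ∧
    (¬ Even (k + n - l) → f = 0)}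
  add_mem' := by
    rintro f g ⟨h1, h2⟩ ⟨h3, h4⟩
    exact ⟨fun m hm => (h1 m hm).add (h3 m hm), fun h => by rw [h2 h, h4 h, add_zero]⟩
  zero_mem' := ⟨fun m _ => isWeightedHomogeneous_zero ℂ δ _, fun _ => rfl⟩
  smul_mem' := by
    rintro t f ⟨h1, h2⟩
    exact ⟨fun m hm => (weightedHomogeneousSubmodule ℂ δ _).smul_mem t (h1 m hm),
      fun h => by rw [h2 h, smul_zero]⟩

theorem mul_mem_shiftHom {δ : Fin 2 → L} {c α β γ : L} {k l j n m : ℤ} {f g : PolyS}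
    (hf : f ∈ shiftHom δ c α k β l n) (hg : g ∈ shiftHom δ c β l γ j m) :
    g * f ∈ shiftHom δ c α k γ j (n + m) := by
  by_cases h : Even (k + n - l)
  · obtain ⟨i, hi⟩ := h
    refine ⟨fun m₀ hm => ?_, fun h => ?_⟩
    · have := (hg.1 (m₀ - i) (by omega)).mul (hf.1 i (by omega))
      convert this using 1
      rw [sub_smul]; abel
    · rw [hg.2 (fun h' => h ?_), zero_mul]
      rw [Int.even_iff] at *; omega
  · rw [hf.2 h, mul_zero]; exact Submodule.zero_mem _

end Degrees

/-- An `L`-graded matrix factorisation of `W` over `S`, where `W` has degree `c`: a sequence of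
finite free graded modules `K^n` with `K^{n+2} = K^n(c)` and maps `K^n → K^{n+1}` of `L`-degree `0`,
compatible with this periodicity, whose consecutive composites are multiplication by `W`.  It is
given by a finite set `ι` of homogeneous generators, with weights `wt` and cohomological degrees
`deg`; `K^n` is the direct sum of the `S(wt s + m c)` over all `s, m` with `deg s + 2 m = n`, and
all the maps `K^n → K^{n+1}` are encoded in the matrix `d` (row = target, column = source). -/
structure MatFac {L : Type} [AddCommGroup L] (δ : Fin 2 → L) (c : L) (W : PolyS) where
  ι : Type
  [fintype : Fintype ι]
  [decEq : DecidableEq ι]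
  wt : ι → L
  deg : ι → ℤ
  d : Matrix ι ι PolyS
  d_mem : ∀ t s, d t s ∈ shiftHom δ c (wt s) (deg s) (wt t) (deg t) 1
  d_sq : d * d = W • 1

namespace MatFac

attribute [instance] MatFac.fintype MatFac.decEq

variable {L : Type} [AddCommGroup L] {δ : Fin 2 → L} {c : L} {W : PolyS}

/-- The shift `K[k]`, with `K[k]^n = K^{n+k}` and differential multiplied by `(-1)^k`. -/
def shift (K : MatFac δ c W) (k : ℤ) : MatFac δ c W where
  ι := K.ι
  wt := K.wt
  deg s := K.deg s - k
  d := k.negOnePow • K.d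
  d_mem t s := by
    rw [Matrix.smul_apply]
    have h : K.d t s ∈ shiftHom δ c (K.wt s) (K.deg s - k) (K.wt t) (K.deg t - k) 1 :=
      ⟨fun m hm => (K.d_mem t s).1 m (by omega), fun h => (K.d_mem t s).2 (by
        convert h using 2; ring)⟩
    rcases Int.even_or_odd k with hk | hk
    · rwa [Int.negOnePow_even k hk, one_smul]
    · rw [Int.negOnePow_odd k hk, Units.neg_smul, one_smul]
      exact neg_mem h
  d_sq := by
    rcases Int.even_or_odd k with hk | hk
    · rw [Int.negOnePow_even k hk, one_smul, K.d_sq]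
    · rw [Int.negOnePow_odd k hk, Units.neg_smul, one_smul, neg_mul_neg, K.d_sq]

/-- `Hom^n(K, M)` in the dg-category of `L`-graded matrix factorisations.  Composition is matrix
multiplication and the differential is `f ↦ d f - (-1)^n f d`. -/
def hom (K M : MatFac δ c W) (n : ℤ) : Submodule ℂ (Matrix M.ι K.ι PolyS) where
  carrier := {f | ∀ t s, f t s ∈ shiftHom δ c (K.wt s) (K.deg s) (M.wt t) (M.deg t) n}
  add_mem' hf hg t s := Submodule.add_mem _ (hf t s) (hg t s)
  zero_mem' _ _ := Submodule.zero_mem _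
  smul_mem' r _ hf t s := Submodule.smul_mem _ r (hf t s)

theorem mul_mem_hom {K M N : MatFac δ c W} {n m : ℤ} {f : Matrix M.ι K.ι PolyS}
    {g : Matrix N.ι M.ι PolyS} (hf : f ∈ hom K M n) (hg : g ∈ hom M N m) :
    g * f ∈ hom K N (n + m) := by
  intro t s
  rw [Matrix.mul_apply]
  exact Submodule.sum_mem _ fun i _ => mul_mem_shiftHom (hf i s) (hg t i)

theorem one_mem_hom (K : MatFac δ c W) : (1 : Matrix K.ι K.ι PolyS) ∈ hom K K 0 := by
  intro t s
  by_cases h : t = s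
  · subst h
    rw [Matrix.one_apply_eq]
    refine ⟨fun m hm => ?_, fun h => absurd ?_ h⟩
    · have : m = 0 := by omega
      subst this
      simpa using isWeightedHomogeneous_one ℂ δ
    · simp
  · rw [Matrix.one_apply_ne h]; exact Submodule.zero_mem _

/-- The direct sum of a finite family of matrix factorisations. -/
def sum {V : Type} [Fintype V] [DecidableEq V] (K : V → MatFac δ c W) : MatFac δ c W where
  ι := Σ v, (K v).ι
  wt s := (K s.1).wt s.2
  deg s := (K s.1).deg s.2
  d := Matrix.blockDiagonal' fun v => (K v).d
  d_mem := by
    rintro ⟨v, t⟩ ⟨u, s⟩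
    by_cases h : v = u
    · subst h
      rw [Matrix.blockDiagonal'_apply_eq]
      exact (K v).d_mem t s
    · rw [Matrix.blockDiagonal'_apply_ne _ _ _ h]; exact Submodule.zero_mem _
  d_sq := by
    rw [← Matrix.blockDiagonal'_mul, ← Matrix.blockDiagonal'_one, ← Matrix.blockDiagonal'_smul]
    congr 1
    funext v
    exact (K v).d_sq

/-- The algebra of closed endomorphisms of degree `0`. -/
def endCocycles (K : MatFac δ c W) : Subalgebra ℂ (Matrix K.ι K.ι PolyS) where
  carrier := {f | f ∈ hom K K 0 ∧ K.d * f = f * K.d}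
  mul_mem' := by
    rintro f g ⟨hf, hf'⟩ ⟨hg, hg'⟩
    refine ⟨by simpa using mul_mem_hom hg hf, ?_⟩
    rw [← mul_assoc, hf', mul_assoc, hg', mul_assoc]
  add_mem' := by
    rintro f g ⟨hf, hf'⟩ ⟨hg, hg'⟩
    exact ⟨Submodule.add_mem _ hf hg, by rw [mul_add, add_mul, hf', hg']⟩
  algebraMap_mem' r := by
    rw [Algebra.algebraMap_eq_smul_one]
    exact ⟨Submodule.smul_mem _ r K.one_mem_hom, by simp⟩

/-- The two-sided ideal of null-homotopic endomorphisms of degree `0`. -/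
def endCoboundaries (K : MatFac δ c W) : Ideal K.endCocycles where
  carrier := {f | ∃ h ∈ hom K K (-1), K.d * h + h * K.d = f}
  add_mem' := by
    rintro f g ⟨h, hh, e⟩ ⟨h', hh', e'⟩
    refine ⟨h + h', Submodule.add_mem _ hh hh', ?_⟩
    rw [Subalgebra.coe_add, ← e, ← e', mul_add, add_mul]; abel
  zero_mem' := ⟨0, Submodule.zero_mem _, by simp⟩
  smul_mem' := by
    rintro g f ⟨h, hh, e⟩
    refine ⟨g * h, by simpa using mul_mem_hom hh g.2.1, ?_⟩
    rw [smul_eq_mul, Subalgebra.coe_mul, ← e, ← mul_assoc, g.2.2, mul_add, mul_assoc, mul_assoc]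

instance (K : MatFac δ c W) : K.endCoboundaries.IsTwoSided where
  mul_mem_of_left := by
    rintro f g ⟨h, hh, e⟩
    refine ⟨h * g, by simpa using mul_mem_hom g.2.1 hh, ?_⟩
    rw [Subalgebra.coe_mul, ← e, mul_assoc h, ← g.2.2, add_mul, mul_assoc, mul_assoc]

/-- The degree `0` part `H^0(End(K))` of the cohomology of the endomorphism dg-algebra. -/
abbrev H0End (K : MatFac δ c W) : Type := K.endCocycles ⧸ K.endCoboundaries

/-- The parity operator: `sgn * f * sgn = (-1)^n f` for `f` of degree `n`. -/
def sgn (K : MatFac δ c W) : Matrix K.ι K.ι PolyS :=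
  Matrix.diagonal fun s => (((K.deg s).negOnePow : ℤ) : PolyS)

theorem sgn_sq (K : MatFac δ c W) : K.sgn * K.sgn = 1 := by
  rw [sgn, Matrix.diagonal_mul_diagonal, ← Matrix.diagonal_one]
  congr 1
  funext s
  rw [← Int.cast_mul, ← Units.val_mul, Int.units_mul_self, Units.val_one, Int.cast_one]

theorem sgn_mul_mul_sgn (K : MatFac δ c W) {n : ℤ} {f : Matrix K.ι K.ι PolyS}
    (hf : f ∈ hom K K n) : K.sgn * f * K.sgn = n.negOnePow • f := by
  ext1 t s
  rw [sgn, Matrix.mul_diagonal, Matrix.diagonal_mul, Matrix.smul_apply]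
  by_cases h : Even (K.deg s + n - K.deg t)
  · have : n.negOnePow = (K.deg t).negOnePow * (K.deg s).negOnePow := by
      rw [← Int.negOnePow_add, Int.negOnePow_eq_iff]
      rw [Int.even_iff] at *; omega
    rw [this, Units.smul_def, Units.val_mul, zsmul_eq_mul, Int.cast_mul]
    ring
  · rw [(hf t s).2 h]; simp

theorem d_mul_sgn (K : MatFac δ c W) : K.d * K.sgn = - (K.sgn * K.d) := by
  have h := K.sgn_mul_mul_sgn (n := 1) K.d_mem
  have := congrArg (fun x => K.sgn * x) h
  simp only [← mul_assoc, K.sgn_sq, one_mul] at this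
  simpa [Int.negOnePow_one] using this

end MatFac

namespace MatFac

variable {L : Type} [AddCommGroup L] {δ : Fin 2 → L} {c : L} {W : PolyS}

/-- `f ↦ (-1)^n (d f - (-1)^n f d)` for `f` of degree `n`. -/
def dgμ₁ (K : MatFac δ c W) : Matrix K.ι K.ι PolyS →ₗ[ℂ] Matrix K.ι K.ι PolyS where
  toFun f := K.d * (K.sgn * f * K.sgn) - f * K.d
  map_add' f g := by simp only [mul_add, add_mul]; abel
  map_smul' r f := by simp [smul_sub]

/-- The `A_∞`-operations of the dg-category: `μ¹(f) = (-1)^{|f|} D f`,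
`μ²(g, f) = (-1)^{|f|} g f`, and `μ^d = 0` for `d ≥ 3`. -/
def dgμ (K : MatFac δ c W) :
    (n : ℕ) → MultilinearMap ℂ (fun _ : Fin n => Matrix K.ι K.ι PolyS) (Matrix K.ι K.ι PolyS)
  | 1 => 
    { toFun := fun a => K.dgμ₁ (a 0)
      map_update_add' := by
        intro _ a i x y
        obtain rfl : i = 0 := Subsingleton.elim _ _
        simp
      map_update_smul' := by
        intro _ a i r x
        obtain rfl : i = 0 := Subsingleton.elim _ _
        simp }
  | 2 =>
    { toFun := fun a => a 1 * (K.sgn * a 0 * K.sgn)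
      map_update_add' := by
        intro _ a i x y
        fin_cases i <;> simp [mul_add, add_mul]
      map_update_smul' := by
        intro _ a i r x
        fin_cases i <;> simp }
  | _ => 0

theorem dgμ_one (K : MatFac δ c W) (a : Fin 1 → Matrix K.ι K.ι PolyS) :
    K.dgμ 1 a = K.d * (K.sgn * a 0 * K.sgn) - a 0 * K.d := rfl

theorem dgμ_two (K : MatFac δ c W) (a : Fin 2 → Matrix K.ι K.ι PolyS) :
    K.dgμ 2 a = a 1 * (K.sgn * a 0 * K.sgn) := rfl

theorem dgμ_eq_zero (K : MatFac δ c W) (n : ℕ) (hn : 3 ≤ n) : K.dgμ n = 0 := by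
  obtain ⟨n, rfl⟩ := Nat.exists_eq_add_of_le' hn
  rfl

variable {V : Type} [Fintype V] [DecidableEq V]

/-- The summand to which a generator of the direct sum belongs. -/
def vtx (K : V → MatFac δ c W) (s : (sum K).ι) : V := Sigma.fst s

theorem sum_d_apply_ne (K : V → MatFac δ c W) {t s : (sum K).ι} (h : vtx K t ≠ vtx K s) :
    (sum K).d t s = 0 := by
  rcases t with ⟨v, t⟩
  rcases s with ⟨u, s⟩
  exact Matrix.blockDiagonal'_apply_ne (fun v => (K v).d) t s h

/-- `Hom^n(K u, K v)`, as the subspace of the degree `n` endomorphisms of the direct sum of the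
family `K` that map the summand `K u` to the summand `K v` and kill all other summands. -/
def blockHom (K : V → MatFac δ c W) (u v : V) (n : ℤ) :
    Submodule ℂ (Matrix (sum K).ι (sum K).ι PolyS) where
  carrier := {f | f ∈ hom (sum K) (sum K) n ∧
    ∀ t s, f t s ≠ 0 → vtx K t = v ∧ vtx K s = u}
  add_mem' := by
    rintro f g ⟨hf, hf'⟩ ⟨hg, hg'⟩
    refine ⟨Submodule.add_mem _ hf hg, fun t s h => ?_⟩
    by_cases h1 : f t s = 0
    · by_cases h2 : g t s = 0
      · exact absurd (by rw [Matrix.add_apply, h1, h2, add_zero]) h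
      · exact hg' t s h2
    · exact hf' t s h1
  zero_mem' := ⟨Submodule.zero_mem _, fun t s h => absurd rfl h⟩
  smul_mem' := by
    rintro r f ⟨hf, hf'⟩
    refine ⟨Submodule.smul_mem _ r hf, fun t s h => hf' t s fun h1 => h ?_⟩
    rw [Matrix.smul_apply, h1, smul_zero]

theorem mul_mem_blockHom (K : V → MatFac δ c W) {u v w : V} {n m : ℤ}
    {f g : Matrix (sum K).ι (sum K).ι PolyS} (hf : f ∈ blockHom K u v n)
    (hg : g ∈ blockHom K v w m) : g * f ∈ blockHom K u w (n + m) := by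
  refine ⟨mul_mem_hom hf.1 hg.1, fun t s h => ?_⟩
  rw [Matrix.mul_apply] at h
  obtain ⟨i, -, hi⟩ := Finset.exists_ne_zero_of_sum_ne_zero h
  exact ⟨(hg.2 t i (left_ne_zero_of_mul hi)).1, (hf.2 i s (right_ne_zero_of_mul hi)).2⟩

theorem d_mul_mem_blockHom (K : V → MatFac δ c W) {u v : V} {n : ℤ}
    {f : Matrix (sum K).ι (sum K).ι PolyS} (hf : f ∈ blockHom K u v n) :
    (sum K).d * f ∈ blockHom K u v (n + 1) := by
  refine ⟨mul_mem_hom hf.1 (sum K).d_mem, fun t s h => ?_⟩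
  rw [Matrix.mul_apply] at h
  obtain ⟨i, -, hi⟩ := Finset.exists_ne_zero_of_sum_ne_zero h
  have h1 := hf.2 i s (right_ne_zero_of_mul hi)
  refine ⟨?_, h1.2⟩
  by_contra h2
  refine left_ne_zero_of_mul hi ?_
  exact sum_d_apply_ne K (fun h3 => h2 (h3.trans h1.1))

theorem mul_d_mem_blockHom (K : V → MatFac δ c W) {u v : V} {n : ℤ}
    {f : Matrix (sum K).ι (sum K).ι PolyS} (hf : f ∈ blockHom K u v n) :
    f * (sum K).d ∈ blockHom K u v (n + 1) := by
  refine ⟨by simpa [add_comm] using mul_mem_hom (sum K).d_mem hf.1, fun t s h => ?_⟩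
  rw [Matrix.mul_apply] at h
  obtain ⟨i, -, hi⟩ := Finset.exists_ne_zero_of_sum_ne_zero h
  have h1 := hf.2 t i (left_ne_zero_of_mul hi)
  refine ⟨h1.1, ?_⟩
  by_contra h2
  refine right_ne_zero_of_mul hi ?_
  exact sum_d_apply_ne K (fun h3 => h2 (h3.symm.trans h1.2))

theorem shiftHom_disjoint {α β : L} {k l n n' : ℤ} (hc : ∀ m : ℤ, m • c = 0 → m = 0)
    (hn : n ≠ n') {f : PolyS} {m : ℤ} (hm : l + 2 * m = k + n)
    (hf : f ∈ shiftHom δ c α k β l n') :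
    weightedHomogeneousComponent δ (β + m • c - α) f = 0 := by
  by_cases h : Even (k + n' - l)
  · obtain ⟨i, hi⟩ := h
    refine (hf.1 i (by omega)).weightedHomogeneousComponent_ne _ fun h => ?_
    have : (i - m) • c = 0 := by
      rw [sub_smul, sub_eq_zero]
      exact (add_left_cancel (sub_left_injective (b := α) h)).symm
    have := hc _ this
    omega
  · rw [hf.2 h, map_zero]

theorem blockHom_indep (K : V → MatFac δ c W) (hc : ∀ m : ℤ, m • c = 0 → m = 0) :
    iSupIndep fun t : V × V × ℤ => blockHom K t.1 t.2.1 t.2.2 := by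
  rintro ⟨u, v, n⟩
  rw [Submodule.disjoint_def]
  intro f hf hf'
  ext1 t s
  by_contra hne
  obtain ⟨rfl, rfl⟩ := hf.2 t s hne
  by_cases hp : Even ((sum K).deg s + n - (sum K).deg t)
  swap
  · exact hne ((hf.1 t s).2 hp)
  obtain ⟨m, hm⟩ := hp
  have hm' : (sum K).deg t + 2 * m = (sum K).deg s + n := by omega
  let lam := (sum K).wt t + m • c - (sum K).wt s
  let P : Submodule ℂ (Matrix (sum K).ι (sum K).ι PolyS) := 
    LinearMap.ker ((weightedHomogeneousComponent δ lam).comp (Matrix.entryLinearMap ℂ PolyS t s))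
  have hle : (⨆ j, ⨆ (_ : j ≠ ((vtx K s, vtx K t, n) : V × V × ℤ)), blockHom K j.1 j.2.1 j.2.2) ≤ P := by
    refine iSup₂_le fun j hj g hg => ?_
    change weightedHomogeneousComponent δ lam (g t s) = 0
    by_cases h0 : g t s = 0
    · rw [h0, map_zero]
    · obtain ⟨h1, h2⟩ := hg.2 t s h0
      refine shiftHom_disjoint hc (n := n) (n' := j.2.2) (fun h => hj ?_) hm' (hg.1 t s)
      rw [h, h1, h2]
  have h1 : weightedHomogeneousComponent δ lam (f t s) = 0 := hle hf'
  rw [((hf.1 t s).1 m hm').weightedHomogeneousComponent_same] at h1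
  exact hne h1

theorem dgμ_rel (K : MatFac δ c W) (n : ℕ → ℤ) (a : ℕ → Matrix K.ι K.ι PolyS) (d : ℕ)
    (ha : ∀ i < d, a i ∈ hom K K (n i)) :
      ∑ s ∈ Finset.Icc 1 d, ∑ r ∈ Finset.range (d + 1 - s),
        (∑ i ∈ Finset.range r, (n i - 1)).negOnePow •
          K.dgμ (d + 1 - s) (fun i => if (i : ℕ) < r then a i
            else if (i : ℕ) = r then K.dgμ s (fun k => a (r + k)) else a (i + s - 1)) = 0 := by
  have hε := K.sgn_sq
  have hd := K.d_mul_sgn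
  by_cases h4 : 4 ≤ d
  · refine Finset.sum_eq_zero fun s hs => Finset.sum_eq_zero fun r hr => ?_
    rw [Finset.mem_Icc] at hs
    rw [Finset.mem_range] at hr
    by_cases h : 3 ≤ d + 1 - s
    · rw [dgμ_eq_zero _ _ h]; simp
    · rw [MultilinearMap.map_coord_zero _ (⟨r, hr⟩ : Fin (d + 1 - s)), smul_zero]
      simp [dgμ_eq_zero K s (by omega)]
  have hdd : ∀ X : Matrix K.ι K.ι PolyS, K.d * (K.d * X) = W • X := by
    intro X; rw [← mul_assoc, K.d_sq]; simp
  have hεε : ∀ X : Matrix K.ι K.ι PolyS, K.sgn * (K.sgn * X) = X := by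
    intro X; rw [← mul_assoc, hε, one_mul]
  have hdε : ∀ X : Matrix K.ι K.ι PolyS, K.d * (K.sgn * X) = - (K.sgn * (K.d * X)) := by
    intro X; rw [← mul_assoc, hd, neg_mul, mul_assoc]
  interval_cases d
  · simp
  · simp [dgμ_one, mul_sub, sub_mul, mul_add, mul_neg, mul_assoc, hdd, hεε, hdε, K.d_sq, hd, hε]
    abel
  · have h0 := K.sgn_mul_mul_sgn (ha 0 (by norm_num))
    have h1 : (n 0 - 1).negOnePow = - (n 0).negOnePow := by
      rw [Int.negOnePow_sub, Int.negOnePow_one]; simp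
    rw [show Finset.Icc 1 2 = {1, 2} by rfl, Finset.sum_pair (by norm_num)]
    norm_num [Finset.sum_range_succ]
    change a 1 * (K.sgn * (K.d * (K.sgn * a 0 * K.sgn) - a 0 * K.d) * K.sgn) +
      (n 0 - 1).negOnePow • ((K.d * (K.sgn * a 1 * K.sgn) - a 1 * K.d) *
        (K.sgn * a 0 * K.sgn)) +
      (K.d * (K.sgn * (a 1 * (K.sgn * a 0 * K.sgn)) * K.sgn) -
        (a 1 * (K.sgn * a 0 * K.sgn)) * K.d) = 0
    rw [h1, h0]
    rcases Int.units_eq_one_or (n 0).negOnePow with h2 | h2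
    · rw [h2, one_smul] at h0
      have h3 : a 0 * K.sgn = K.sgn * a 0 := by
        nth_rw 2 [← h0]; rw [mul_assoc, hεε]
      have h3' : ∀ X, a 0 * (K.sgn * X) = K.sgn * (a 0 * X) := fun X => by
        rw [← mul_assoc, h3, mul_assoc]
      simp [h2, mul_sub, sub_mul, mul_add, mul_assoc, hεε, hdε, hd, h3, h3']
      abel
    · rw [h2, Units.neg_smul, one_smul] at h0
      have h3 : a 0 * K.sgn = - (K.sgn * a 0) := by
        rw [← mul_neg, ← h0, mul_assoc, hεε]
      have h3' : ∀ X, a 0 * (K.sgn * X) = - (K.sgn * (a 0 * X)) := fun X => by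
        rw [← mul_assoc, h3, neg_mul, mul_assoc]
      simp [h2, mul_sub, sub_mul, mul_assoc, hεε, hdε, hd, h3, h3']
      abel
  · have h0 := K.sgn_mul_mul_sgn (ha 0 (by norm_num))
    have h1 : (n 0 - 1).negOnePow = - (n 0).negOnePow := by
      rw [Int.negOnePow_sub, Int.negOnePow_one]; simp
    rw [show Finset.Icc 1 3 = {1, 2, 3} by rfl, Finset.sum_insert (by simp),
      Finset.sum_pair (by norm_num)]
    norm_num [Finset.sum_range_succ, dgμ_eq_zero]
    have hz : (K.dgμ (3 + 1 - 3)) (fun _ => (0 : Matrix K.ι K.ι PolyS)) = 0 :=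
      (K.dgμ 1).map_coord_zero 0 rfl
    rw [hz, add_zero]
    change a 2 * (K.sgn * (a 1 * (K.sgn * a 0 * K.sgn)) * K.sgn) +
      (n 0 - 1).negOnePow • ((a 2 * (K.sgn * a 1 * K.sgn)) * (K.sgn * a 0 * K.sgn)) = 0
    rw [h1]
    rcases Int.units_eq_one_or (n 0).negOnePow with h2 | h2
    · rw [h2, one_smul] at h0
      have h3 : a 0 * K.sgn = K.sgn * a 0 := by
        nth_rw 2 [← h0]; rw [mul_assoc, hεε]
      simp [h2, mul_assoc, hεε, h3]
    · rw [h2, Units.neg_smul, one_smul] at h0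
      have h3 : a 0 * K.sgn = - (K.sgn * a 0) := by
        rw [← mul_neg, ← h0, mul_assoc, hεε]
      simp [h2, mul_assoc, hεε, h3]

/-- The full dg-subcategory of matrix factorisations on the objects `K v`, as an `A_∞`-category. -/
def dgCat (K : V → MatFac δ c W) (hc : ∀ m : ℤ, m • c = 0 → m = 0) : AInfCat V where
  carrier := Matrix (sum K).ι (sum K).ι PolyS
  hom := blockHom K
  indep := blockHom_indep K hc
  μ := (sum K).dgμ
  μ_mem d X n a hd ha := by
    have hs : ∀ i < d, (sum K).sgn * a i * (sum K).sgn ∈ blockHom K (X i) (X (i + 1)) (n i) := by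
      intro i hi
      rw [(sum K).sgn_mul_mul_sgn (ha i hi).1]
      rcases Int.units_eq_one_or (n i).negOnePow with h | h
      · rw [h, one_smul]; exact ha i hi
      · rw [h, Units.neg_smul, one_smul]; exact neg_mem (ha i hi)
    by_cases h3 : 3 ≤ d
    · rw [dgμ_eq_zero _ _ h3]; exact Submodule.zero_mem _
    · interval_cases d
      · have h := Submodule.sub_mem _ (d_mul_mem_blockHom K (hs 0 (by norm_num)))
          (mul_d_mem_blockHom K (ha 0 (by norm_num)))
        rw [show ∑ i ∈ Finset.range 1, n i + 2 - ((1 : ℕ) : ℤ) = n 0 + 1 by simp; ring]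
        exact h
      · have h := mul_mem_blockHom K (hs 0 (by norm_num)) (ha 1 (by norm_num))
        rw [show ∑ i ∈ Finset.range 2, n i + 2 - ((2 : ℕ) : ℤ) = n 0 + n 1 by
          simp [Finset.sum_range_succ]]
        exact h
  rel d X n a ha := (sum K).dgμ_rel n a d fun i hi => (ha i hi).1

/-- The identity of `K v`, as a closed endomorphism of the direct sum. -/
def idem (K : V → MatFac δ c W) (v : V) : (sum K).endCocycles :=
  ⟨Matrix.diagonal fun s => if vtx K s = v then 1 else 0, by
    refine ⟨fun t s => ?_, ?_⟩
    · by_cases h : t = s ∧ vtx K s = v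
      · obtain ⟨rfl, h⟩ := h
        have h1 := (sum K).one_mem_hom t t
        rw [Matrix.one_apply_eq] at h1
        rwa [Matrix.diagonal_apply_eq, if_pos h]
      · have h1 : (Matrix.diagonal fun s => if vtx K s = v then (1 : PolyS) else 0) t s = 0 := by
          rw [Matrix.diagonal_apply]
          split_ifs with h2 h3
          · exact absurd ⟨h2, h2 ▸ h3⟩ h
          · rfl
          · rfl
        rw [h1]; exact Submodule.zero_mem _
    · ext1 t s
      rw [Matrix.mul_diagonal, Matrix.diagonal_mul]
      by_cases h : vtx K t = vtx K s
      · rw [h, mul_comm]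
      · rw [sum_d_apply_ne K h]; simp⟩

end MatFac

section PathAlgebra

variable {V E : Type} [Fintype V]

/-- The defining relations of the path algebra of a quiver with vertices `V` and arrows `E`.
Products are written like compositions of maps: `b * a` is first `a`, then `b`. -/
inductive PathRel (src tgt : E → V) : FreeAlgebra ℂ (V ⊕ E) → FreeAlgebra ℂ (V ⊕ E) → Prop
  | idem (v : V) : PathRel src tgt
      (FreeAlgebra.ι ℂ (Sum.inl v) * FreeAlgebra.ι ℂ (Sum.inl v)) (FreeAlgebra.ι ℂ (Sum.inl v))
  | orth (u v : V) (h : u ≠ v) : PathRel src tgt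
      (FreeAlgebra.ι ℂ (Sum.inl u) * FreeAlgebra.ι ℂ (Sum.inl v)) 0
  | one : PathRel src tgt (∑ v, FreeAlgebra.ι ℂ (Sum.inl v)) 1
  | tgt (a : E) : PathRel src tgt
      (FreeAlgebra.ι ℂ (Sum.inl (tgt a)) * FreeAlgebra.ι ℂ (Sum.inr a)) (FreeAlgebra.ι ℂ (Sum.inr a))
  | src (a : E) : PathRel src tgt
      (FreeAlgebra.ι ℂ (Sum.inr a) * FreeAlgebra.ι ℂ (Sum.inl (src a))) (FreeAlgebra.ι ℂ (Sum.inr a))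

/-- The path algebra over `ℂ` of a quiver with finite vertex set, presented by its vertices
(orthogonal idempotents with sum `1`) and its arrows. -/
abbrev PathAlgebra (src tgt : E → V) : Type := RingQuot (PathRel src tgt)

def PathAlgebra.vertex (src tgt : E → V) (v : V) : PathAlgebra src tgt :=
  RingQuot.mkAlgHom ℂ (PathRel src tgt) (FreeAlgebra.ι ℂ (Sum.inl v))

def PathAlgebra.arrow (src tgt : E → V) (a : E) : PathAlgebra src tgt :=
  RingQuot.mkAlgHom ℂ (PathRel src tgt) (FreeAlgebra.ι ℂ (Sum.inr a))

end PathAlgebra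

section Homogeneous

variable {L : Type} [AddCommGroup L] {δ : Fin 2 → L}

theorem det_isWeightedHomogeneous {n : Type} [Fintype n] [DecidableEq n] {A : Matrix n n PolyS}
    {α β : n → L} (h : ∀ s t, IsWeightedHomogeneous δ (A s t) (β s - α t)) :
    IsWeightedHomogeneous δ A.det (∑ s, β s - ∑ t, α t) := by
  rw [Matrix.det_apply]
  refine IsWeightedHomogeneous.sum _ _ _ fun σ _ => ?_
  have h1 : IsWeightedHomogeneous δ (∏ i, A (σ i) i) (∑ s, β s - ∑ t, α t) := by
    have h2 := IsWeightedHomogeneous.prod Finset.univ (fun i => A (σ i) i)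
      (fun i => β (σ i) - α i) (fun i _ => h (σ i) i)
    rwa [Finset.sum_sub_distrib, Equiv.sum_comp σ β] at h2
  rcases Int.units_eq_one_or (Equiv.Perm.sign σ) with h2 | h2
  · rwa [h2, one_smul]
  · rw [h2, Units.neg_smul, one_smul]; exact h1.neg

theorem adjugate_isWeightedHomogeneous {n : Type} [Fintype n] [DecidableEq n]
    {A : Matrix n n PolyS} {α β : n → L}
    (h : ∀ s t, IsWeightedHomogeneous δ (A s t) (β s - α t)) (t s : n) :
    IsWeightedHomogeneous δ (A.adjugate t s) (α t + (∑ s, β s - ∑ t, α t) - β s) := by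
  rw [Matrix.adjugate_apply]
  have h1 := det_isWeightedHomogeneous (δ := δ) (A := A.updateRow s (Pi.single t 1)) (α := α)
    (β := Function.update β s (α t)) (by
      intro s' t'
      by_cases hs : s' = s
      · subst hs
        rw [Matrix.updateRow_self, Function.update_self]
        by_cases ht : t' = t
        · subst ht
          simpa using isWeightedHomogeneous_one ℂ δ
        · rw [Pi.single_eq_of_ne ht]; exact isWeightedHomogeneous_zero ℂ δ _
      · rw [Matrix.updateRow_ne hs, Function.update_of_ne hs]
        exact h s' t')
  convert h1 using 1
  rw [Finset.sum_update_of_mem (Finset.mem_univ s), ← Finset.add_sum_erase _ β (Finset.mem_univ s),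
    Finset.sdiff_singleton_eq_erase]
  abel

theorem X_pow_isWeightedHomogeneous (i : Fin 2) (n : ℕ) :
    IsWeightedHomogeneous δ ((X i : PolyS) ^ n) (n • δ i) :=
  (isWeightedHomogeneous_X ℂ δ i).pow n

end Homogeneous

/-- A monomial ideal `(x^{e 0} y^{f 0}, …, x^{e m} y^{f m})` of `S`, with `e` decreasing to `e m = 0`
and `f` increasing from `f 0 = 0`, that contains `x^p` and `y^q`.  Only the values of `e` and `f` at
`0, …, m` matter. -/
structure Staircase (p q : ℕ) where
  m : ℕ
  e : ℕ → ℕ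
  f : ℕ → ℕ
  e_succ_le : ∀ s < m, e (s + 1) ≤ e s
  f_le_succ : ∀ s < m, f s ≤ f (s + 1)
  e_last : e m = 0
  f_zero : f 0 = 0
  e_zero_le : e 0 ≤ p
  f_last_le : f m ≤ q

namespace Staircase

variable {p q : ℕ}

/-- The presentation matrix of the ideal of a staircase, viewed as a module over
`R = S / (x^p + y^q)`.  The columns are the syzygies of the generators
`g_s = x^{e s} y^{f s}` over `R`: the column `t < m` is the syzygy
`y^{f (t+1) - f t} g_t - x^{e t - e (t+1)} g_{t+1} = 0`, and the last column is
`x^{p - e 0} g_0 + y^{q - f m} g_m = x^p + y^q = 0`. -/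
def d₀ (σ : Staircase p q) : Matrix (Fin (σ.m + 1)) (Fin (σ.m + 1)) PolyS :=
  Matrix.of fun s t =>
    if (t : ℕ) = σ.m then
      (if (s : ℕ) = 0 then X 0 ^ (p - σ.e 0) else 0) +
        (if (s : ℕ) = σ.m then X 1 ^ (q - σ.f σ.m) else 0)
    else if (s : ℕ) = t then X 1 ^ (σ.f (t + 1) - σ.f t)
    else if (s : ℕ) = t + 1 then -X 0 ^ (σ.e t - σ.e (t + 1))
    else 0

theorem e_prod (σ : Staircase p q) (k : ℕ) (hk : k ≤ σ.m) :
    ∏ t ∈ Finset.range k, (X 0 : PolyS) ^ (σ.e t - σ.e (t + 1)) = X 0 ^ (σ.e 0 - σ.e k) ∧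
      σ.e k ≤ σ.e 0 := by
  induction k with
  | zero => simp
  | succ k ih =>
    obtain ⟨h1, h2⟩ := ih (by omega)
    have h3 := σ.e_succ_le k (by omega)
    refine ⟨?_, by omega⟩
    rw [Finset.prod_range_succ, h1, ← pow_add]
    congr 1; omega

theorem f_prod (σ : Staircase p q) (k : ℕ) (hk : k ≤ σ.m) :
    ∏ t ∈ Finset.range k, (X 1 : PolyS) ^ (σ.f (t + 1) - σ.f t) = X 1 ^ (σ.f k) := by
  induction k with
  | zero => simp [σ.f_zero]
  | succ k ih =>
    have h3 := σ.f_le_succ k (by omega)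
    rw [Finset.prod_range_succ, ih (by omega), ← pow_add]
    congr 1; omega

theorem det_d₀ (σ : Staircase p q) : σ.d₀.det = X 0 ^ p + X 1 ^ q := by
  have hlast : ∀ i : Fin (σ.m + 1), σ.d₀ i (Fin.last σ.m) =
      (if i = 0 then X 0 ^ (p - σ.e 0) else 0) +
        (if i = Fin.last σ.m then X 1 ^ (q - σ.f σ.m) else 0) := by
    intro i
    have e1 : (i : ℕ) = 0 ↔ i = 0 := Fin.val_eq_zero_iff
    have e2 : (i : ℕ) = σ.m ↔ i = Fin.last σ.m := by rw [Fin.ext_iff, Fin.val_last]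
    simp only [d₀, Matrix.of_apply, Fin.val_last, if_true, e1, e2]
  have hA : (σ.d₀.submatrix (Fin.succAbove 0) (Fin.succAbove (Fin.last σ.m))).det =
      (-1) ^ σ.m * X 0 ^ σ.e 0 := by
    have hij : ∀ i j : Fin σ.m,
        σ.d₀.submatrix (Fin.succAbove 0) (Fin.succAbove (Fin.last σ.m)) i j =
          if (i : ℕ) + 1 = j then X 1 ^ (σ.f (j + 1) - σ.f j)
          else if (i : ℕ) = j then -X 0 ^ (σ.e j - σ.e (j + 1)) else 0 := by
      intro i j
      simp [d₀, j.2.ne]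
    rw [Matrix.det_of_isUpperTriangular]
    · have h1 := (σ.e_prod σ.m le_rfl).1
      rw [σ.e_last, Nat.sub_zero, ← Fin.prod_univ_eq_prod_range
        (fun t => (X 0 : PolyS) ^ (σ.e t - σ.e (t + 1)))] at h1
      rw [← h1]
      have h2 : ∀ i : Fin σ.m, σ.d₀.submatrix (Fin.succAbove 0) (Fin.succAbove (Fin.last σ.m)) i i =
          (-1) * X 0 ^ (σ.e i - σ.e (i + 1)) := by
        intro i; rw [hij]; simp
      rw [Finset.prod_congr rfl fun i _ => h2 i, Finset.prod_mul_distrib]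
      simp
    · intro i j h
      have h' : (j : ℕ) < i := h
      rw [hij, if_neg (by omega), if_neg (by omega)]
  have hB : (σ.d₀.submatrix (Fin.succAbove (Fin.last σ.m)) (Fin.succAbove (Fin.last σ.m))).det =
      X 1 ^ σ.f σ.m := by
    have hij : ∀ i j : Fin σ.m,
        σ.d₀.submatrix (Fin.succAbove (Fin.last σ.m)) (Fin.succAbove (Fin.last σ.m)) i j =
          if (i : ℕ) = j then X 1 ^ (σ.f (j + 1) - σ.f j)
          else if (i : ℕ) = j + 1 then -X 0 ^ (σ.e j - σ.e (j + 1)) else 0 := by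
      intro i j
      simp [d₀, j.2.ne]
    rw [Matrix.det_of_isLowerTriangular]
    · have h1 := σ.f_prod σ.m le_rfl
      rw [← Fin.prod_univ_eq_prod_range
        (fun t => (X 1 : PolyS) ^ (σ.f (t + 1) - σ.f t))] at h1
      rw [← h1]
      exact Finset.prod_congr rfl fun i _ => by rw [hij, if_pos rfl]
    · intro i j h
      have h' : (i : ℕ) < j := h
      rw [hij, if_neg (by omega), if_neg (by omega)]
  rw [Matrix.det_succ_column σ.d₀ (Fin.last σ.m)]
  simp only [hlast, mul_add, add_mul, Finset.sum_add_distrib, mul_ite, ite_mul, mul_zero, zero_mul,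
    Finset.sum_ite_eq', Finset.mem_univ, if_true]
  rw [hA, hB]
  have h1 : (X 0 : PolyS) ^ p = X 0 ^ (p - σ.e 0) * X 0 ^ σ.e 0 := by
    rw [← pow_add, Nat.sub_add_cancel σ.e_zero_le]
  have h2 : (X 1 : PolyS) ^ q = X 1 ^ (q - σ.f σ.m) * X 1 ^ σ.f σ.m := by
    rw [← pow_add, Nat.sub_add_cancel σ.f_last_le]
  have h3 : ((-1 : PolyS)) ^ σ.m * (-1) ^ σ.m = 1 := by
    rw [← mul_pow]; simp
  rw [h1, h2]
  simp only [Fin.val_zero, Fin.val_last, zero_add, pow_add, h3, one_mul]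
  linear_combination (X 0 ^ (p - σ.e 0) * X 0 ^ σ.e 0) * h3

variable {L : Type} [AddCommGroup L]

/-- Weights of the generators `g_s`, if the generator `1` of `S` has weight `a`. -/
def wt₁ (σ : Staircase p q) (δ : Fin 2 → L) (a : L) (s : Fin (σ.m + 1)) : L :=
  a - (σ.e s • δ 0 + σ.f s • δ 1)

/-- Weights of the syzygies. -/
def wt₂ (σ : Staircase p q) (δ : Fin 2 → L) (c a : L) (t : Fin (σ.m + 1)) : L :=
  if (t : ℕ) = σ.m then a - c else a - (σ.e t • δ 0 + σ.f (t + 1) • δ 1)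

theorem d₀_homogeneous (σ : Staircase p q) {δ : Fin 2 → L} {c : L} (hx : p • δ 0 = c)
    (hy : q • δ 1 = c) (a : L) (s t : Fin (σ.m + 1)) :
    IsWeightedHomogeneous δ (σ.d₀ s t) (σ.wt₁ δ a s - σ.wt₂ δ c a t) := by
  have key : ∀ (i : Fin 2) (k n : ℕ), k ≤ n → (n - k) • δ i + k • δ i = n • δ i := by
    intro i k n h
    rw [← add_smul, Nat.sub_add_cancel h]
  have hs := s.2
  have ht := t.2
  rw [d₀, Matrix.of_apply, wt₂, wt₁]
  by_cases h1 : (t : ℕ) = σ.m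
  · rw [if_pos h1, if_pos h1]
    refine IsWeightedHomogeneous.add ?_ ?_
    · split_ifs with h2
      · convert X_pow_isWeightedHomogeneous (δ := δ) 0 (p - σ.e 0) using 1
        have := key 0 (σ.e 0) p σ.e_zero_le
        rw [h2, σ.f_zero, zero_smul, ← hx, ← this]; abel
      · exact isWeightedHomogeneous_zero ℂ δ _
    · split_ifs with h2
      · convert X_pow_isWeightedHomogeneous (δ := δ) 1 (q - σ.f σ.m) using 1
        have := key 1 (σ.f σ.m) q σ.f_last_le
        rw [h2, σ.e_last, zero_smul, ← hy, ← this]; abel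
      · exact isWeightedHomogeneous_zero ℂ δ _
  · rw [if_neg h1, if_neg h1]
    split_ifs with h2 h3
    · convert X_pow_isWeightedHomogeneous (δ := δ) 1 (σ.f (t + 1) - σ.f t) using 1
      have := key 1 (σ.f t) (σ.f (t + 1)) (σ.f_le_succ t (by omega))
      rw [h2, ← this]; abel
    · have h4 : a - (σ.e s • δ 0 + σ.f s • δ 1) - (a - (σ.e t • δ 0 + σ.f (t + 1) • δ 1)) =
          (σ.e t - σ.e (t + 1)) • δ 0 := by
        have := key 0 (σ.e (t + 1)) (σ.e t) (σ.e_succ_le t (by omega))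
        rw [h3, ← this]; abel
      rw [h4]
      exact (X_pow_isWeightedHomogeneous (δ := δ) 0 (σ.e t - σ.e (t + 1))).neg
    · exact isWeightedHomogeneous_zero ℂ δ _

theorem sum_wt (σ : Staircase p q) (δ : Fin 2 → L) (c a : L) :
    ∑ s, σ.wt₁ δ a s - ∑ t, σ.wt₂ δ c a t = c := by
  have h1 : ∀ t : Fin σ.m, σ.wt₂ δ c a t.castSucc =
      a - (σ.e t • δ 0 + σ.f (t + 1) • δ 1) := by
    intro t
    simp [wt₂, t.2.ne]
  have h2 : σ.wt₂ δ c a (Fin.last σ.m) = a - c := by simp [wt₂]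
  have h3 : ∑ s : Fin (σ.m + 1), σ.wt₁ δ a s =
      ∑ s : Fin (σ.m + 1), (a - σ.e s • δ 0) - ∑ s : Fin (σ.m + 1), σ.f s • δ 1 := by
    rw [← Finset.sum_sub_distrib]
    exact Finset.sum_congr rfl fun s _ => by rw [wt₁]; abel
  have h4 : ∑ t : Fin σ.m, σ.wt₂ δ c a t.castSucc =
      ∑ t : Fin σ.m, (a - σ.e t • δ 0) - ∑ t : Fin σ.m, σ.f (t + 1) • δ 1 := by
    rw [← Finset.sum_sub_distrib]
    exact Finset.sum_congr rfl fun t _ => by rw [h1]; abel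
  rw [Fin.sum_univ_castSucc (fun t => σ.wt₂ δ c a t), h2, h3, h4,
    Fin.sum_univ_castSucc (fun s : Fin (σ.m + 1) => a - σ.e s • δ 0),
    Fin.sum_univ_succ (fun s : Fin (σ.m + 1) => σ.f s • δ 1)]
  simp [σ.e_last, σ.f_zero]
  abel

/-- The stabilisation of the graded module `R(a) / I`, where `I` is the ideal of a staircase and
`R = S / (x^p + y^q)`.  The `R`-free resolution of `R(a) / I` is `… → F₂ → F₁ → F₀ = R(a)`, where
`F₁` has the generators of `I` as a basis, `F₂ → F₁` is `d₀` and, from `F₁` on, the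
resolution is `2`-periodic with maps `d₀` and `Adj(d₀)`.  So the matrix factorisation is
`K^{-2} --d₀--> K^{-1} --Adj(d₀)--> K^0 = K^{-2}(c)`. -/
def matFac (σ : Staircase p q) {δ : Fin 2 → L} {c : L} (hx : p • δ 0 = c) (hy : q • δ 1 = c)
    (a : L) : MatFac δ c (X 0 ^ p + X 1 ^ q) where
  ι := Fin (σ.m + 1) ⊕ Fin (σ.m + 1)
  wt := Sum.elim (σ.wt₁ δ a) (σ.wt₂ δ c a)
  deg := Sum.elim (fun _ => -1) (fun _ => -2)
  d := Matrix.fromBlocks 0 σ.d₀ σ.d₀.adjugate 0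
  d_mem := by
    rintro (s | s) (t | t)
    · exact Submodule.zero_mem _
    · refine ⟨fun m hm => ?_, fun h => absurd ?_ h⟩
      · obtain rfl : m = 0 := by simp at hm; omega
        simpa using σ.d₀_homogeneous hx hy a s t
      · simp
    · refine ⟨fun m hm => ?_, fun h => absurd ?_ h⟩
      · obtain rfl : m = 1 := by simp at hm; omega
        have h := adjugate_isWeightedHomogeneous (σ.d₀_homogeneous hx hy a) s t
        rw [σ.sum_wt] at h
        simpa using h
      · simp
    · exact Submodule.zero_mem _
  d_sq := by
    rw [Matrix.fromBlocks_multiply]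
    simp [Matrix.mul_adjugate, Matrix.adjugate_mul, σ.det_d₀, ← Matrix.fromBlocks_one,
      Matrix.fromBlocks_smul]

end Staircase

/-- The data of the Brieskorn-Pham polynomial `x^p + y^q` with a grading group of index `ℓ > 1`, and
a primitive `ℓ`-th root of unity `η`. -/
structure BPData where
  p : ℕ
  q : ℕ
  ℓ : ℕ
  η : ℂ
  p_pos : 0 < p
  q_pos : 0 < q
  one_lt_ℓ : 1 < ℓ
  ℓ_dvd_p : ℓ ∣ p
  ℓ_dvd_q : ℓ ∣ q
  η_primitive : IsPrimitiveRoot η ℓ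

namespace BPData

variable (D : BPData)

/-- `p / ℓ` -/
def P : ℕ := D.p / D.ℓ

/-- `q / ℓ` -/
def Q : ℕ := D.q / D.ℓ

theorem p_eq : D.p = D.ℓ * D.P := (Nat.mul_div_cancel' D.ℓ_dvd_p).symm

theorem q_eq : D.q = D.ℓ * D.Q := (Nat.mul_div_cancel' D.ℓ_dvd_q).symm

/-- The grading group, generated by `|x|`, `|y|` with the relation `(p/ℓ) |x| = (q/ℓ) |y|`. -/
abbrev L : Type := (ℤ × ℤ) ⧸ AddSubgroup.zmultiples ((D.P : ℤ), -(D.Q : ℤ))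

/-- The degrees of `x` and `y`. -/
def deg : Fin 2 → D.L := ![QuotientAddGroup.mk (1, 0), QuotientAddGroup.mk (0, 1)]

/-- The degree `p |x| = q |y|` of `x^p + y^q`. -/
def c : D.L := D.p • D.deg 0

theorem P_smul : D.P • D.deg 0 = D.Q • D.deg 1 := by
  change ((D.P • ((1, 0) : ℤ × ℤ) : ℤ × ℤ) : D.L) = ((D.Q • ((0, 1) : ℤ × ℤ) : ℤ × ℤ) : D.L)
  rw [QuotientAddGroup.eq, AddSubgroup.mem_zmultiples_iff]
  exact ⟨-1, by ext <;> simp⟩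

theorem c_eq : D.q • D.deg 1 = D.c := by
  rw [c, p_eq, q_eq, mul_smul, mul_smul, P_smul]

theorem zsmul_c_eq_zero (m : ℤ) (h : m • D.c = 0) : m = 0 := by
  have h1 : ((m • D.p • ((1, 0) : ℤ × ℤ) : ℤ × ℤ) : D.L) = 0 := h
  rw [QuotientAddGroup.eq_zero_iff, AddSubgroup.mem_zmultiples_iff] at h1
  obtain ⟨k, hk⟩ := h1
  have h2 := congrArg Prod.fst hk
  have h3 := congrArg Prod.snd hk
  have hp := D.p_pos
  have hQ : 0 < D.Q := Nat.pos_of_ne_zero fun h0 => by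
    have := D.q_pos; rw [q_eq, h0] at this; simp at this
  have hk0 : k = 0 := by
    rcases (by simpa using h3 : k = 0 ∨ D.Q = 0) with h | h
    · exact h
    · omega
  subst hk0
  rcases (by simpa [eq_comm] using h2 : m = 0 ∨ D.p = 0) with h | h
  · exact h
  · omega

def W : PolyS := X 0 ^ D.p + X 1 ^ D.q

/-- The coefficient `e^{πi/ℓ} η^r`; the index `r : Fin ℓ` stands for `r + 1 ∈ {1, …, ℓ}`. -/
def root (r : Fin D.ℓ) : ℂ :=
  Complex.exp (Real.pi * Complex.I / D.ℓ) * D.η ^ ((r : ℕ) + 1)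

/-- The factor `w_r = x^{p/ℓ} - e^{πi/ℓ} η^r y^{q/ℓ}`. -/
def w (r : Fin D.ℓ) : PolyS := X 0 ^ D.P - C (D.root r) * X 1 ^ D.Q

theorem prod_w : ∏ r, D.w r = D.W := by
  have hℓ : 0 < D.ℓ := lt_trans one_pos D.one_lt_ℓ
  have hζ : (Complex.exp (Real.pi * Complex.I / D.ℓ)) ^ D.ℓ = -1 := by
    rw [← Complex.exp_nat_mul, mul_div_cancel₀ _ (by exact_mod_cast hℓ.ne'), Complex.exp_pi_mul_I]
  set ζ := Complex.exp (Real.pi * Complex.I / D.ℓ) with hζdef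
  have hη : IsPrimitiveRoot (C D.η : PolyS) D.ℓ :=
    D.η_primitive.map_of_injective (C_injective (Fin 2) ℂ)
  have h1 := hη.pow_sub_pow_eq_prod_sub_mul (X 0 ^ D.P) (C ζ * X 1 ^ D.Q) hℓ
  have h2 : ∏ r, D.w r = ∏ z ∈ Polynomial.nthRootsFinset D.ℓ (1 : PolyS),
      (X 0 ^ D.P - z * (C ζ * X 1 ^ D.Q)) := by
    refine Finset.prod_bij (fun r _ => (C D.η : PolyS) ^ ((r : ℕ) + 1)) ?_ ?_ ?_ ?_
    · intro r _
      rw [Polynomial.mem_nthRootsFinset hℓ, ← pow_mul, mul_comm, pow_mul, hη.pow_eq_one, one_pow]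
    · intro r _ s _ h
      have hη0 : (C D.η : PolyS) ≠ 0 := hη.ne_zero hℓ.ne'
      simp only [pow_succ] at h
      exact Fin.ext (hη.pow_inj r.2 s.2 (mul_right_cancel₀ hη0 h))
    · intro z hz
      rw [Polynomial.mem_nthRootsFinset hℓ] at hz
      have hz' : (z * (C D.η : PolyS) ^ (D.ℓ - 1)) ^ D.ℓ = 1 := by
        rw [mul_pow, hz, ← pow_mul, mul_comm (D.ℓ - 1), pow_mul, hη.pow_eq_one, one_pow, one_mul]
      have : NeZero D.ℓ := ⟨hℓ.ne'⟩
      obtain ⟨i, hi, h⟩ := hη.eq_pow_of_pow_eq_one hz'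
      refine ⟨⟨i, hi⟩, Finset.mem_univ _, ?_⟩
      change (C D.η : PolyS) ^ (i + 1) = z
      rw [pow_succ, h, mul_assoc, ← pow_succ, Nat.sub_add_cancel hℓ, hη.pow_eq_one, mul_one]
    · intro r _
      rw [w, root, ← hζdef, map_mul, map_pow]; ring
  rw [h2, ← h1, mul_pow, ← map_pow, hζ, W, ← pow_mul, ← pow_mul, mul_comm D.P, mul_comm D.Q,
    ← p_eq, ← q_eq]
  simp

theorem w_homogeneous (r : Fin D.ℓ) : IsWeightedHomogeneous D.deg (D.w r) (D.P • D.deg 0) := by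
  refine IsWeightedHomogeneous.sub (X_pow_isWeightedHomogeneous 0 D.P) ?_
  have h := (isWeightedHomogeneous_C D.deg (D.root r)).mul
    (X_pow_isWeightedHomogeneous (δ := D.deg) 1 D.Q)
  rwa [zero_add, ← P_smul] at h

theorem prod_erase_w_homogeneous (r : Fin D.ℓ) :
    IsWeightedHomogeneous D.deg (∏ s ∈ Finset.univ.erase r, D.w s) (D.c - D.P • D.deg 0) := by
  have h := IsWeightedHomogeneous.prod (Finset.univ.erase r) D.w (fun _ => D.P • D.deg 0)
    (w := D.deg) fun s _ => D.w_homogeneous s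
  convert h using 1
  have hℓ : 0 < D.ℓ := lt_trans one_pos D.one_lt_ℓ
  rw [Finset.sum_const, Finset.card_erase_of_mem (Finset.mem_univ r), Finset.card_univ,
    Fintype.card_fin, c, p_eq, mul_smul, sub_eq_iff_eq_add, ← succ_nsmul, Nat.sub_add_cancel hℓ]

/-- The matrix factorisation
`K_{w_r} = (… → S(-c) --W/w_r--> S(-(p/ℓ)|x|) --w_r--> S → …)`, with `S` in degree `0`. -/
def Kw (r : Fin D.ℓ) : MatFac D.deg D.c D.W where
  ι := Fin 2
  wt := ![0, -(D.P • D.deg 0)]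
  deg := ![0, -1]
  d := !![0, D.w r; ∏ s ∈ Finset.univ.erase r, D.w s, 0]
  d_mem := by
    intro t s
    fin_cases t <;> fin_cases s
    · exact Submodule.zero_mem _
    · refine ⟨fun m hm => ?_, fun h => absurd ?_ h⟩
      · obtain rfl : m = 0 := by simp at hm; omega
        simpa using D.w_homogeneous r
      · simp
    · refine ⟨fun m hm => ?_, fun h => absurd ?_ h⟩
      · obtain rfl : m = 1 := by simp at hm; omega
        have h := D.prod_erase_w_homogeneous r
        rw [sub_eq_neg_add] at h
        simpa using h
      · simp
    · exact Submodule.zero_mem _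
  d_sq := by
    have h : D.w r * ∏ s ∈ Finset.univ.erase r, D.w s = D.W := by
      rw [Finset.mul_prod_erase _ _ (Finset.mem_univ r), prod_w]
    have h' := h
    rw [mul_comm] at h'
    ext1 i j
    fin_cases i <;> fin_cases j <;> simp [Matrix.mul_apply, Fin.sum_univ_two, h, h']

/-- The index set of the objects `K_0^{i,j}`: the pairs `(i, j)` with
`(ℓ-1) p/ℓ + 1 ≤ i ≤ p-1`, `1 ≤ j ≤ q-1`, and those with `i = (ℓ-1) p/ℓ`, `q/ℓ + 1 ≤ j ≤ q-1`. -/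
def V₀ : Finset (ℕ × ℕ) :=
  Finset.Icc ((D.ℓ - 1) * D.P + 1) (D.p - 1) ×ˢ Finset.Icc 1 (D.q - 1) ∪
    {(D.ℓ - 1) * D.P} ×ˢ Finset.Icc (D.Q + 1) (D.q - 1)

theorem le_of_mem_V₀ {v : ℕ × ℕ} (h : v ∈ D.V₀) :
    v.1 < D.ℓ * D.P ∧ 1 ≤ v.2 ∧ v.2 < D.q := by
  have hp := D.p_pos
  have hP := D.p_eq
  have hℓ := D.one_lt_ℓ
  have h1 : (D.ℓ - 1) * D.P + D.P = D.ℓ * D.P := by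
    rw [← Nat.succ_mul]; congr 1; omega
  have hP0 : 0 < D.P := Nat.pos_of_ne_zero fun h0 => by rw [hP, h0] at hp; simp at hp
  simp only [V₀, Finset.mem_union, Finset.mem_product, Finset.mem_Icc, Finset.mem_singleton] at h
  omega

/-- `k = ⌊(j-1) ℓ / q⌋` -/
def k (j : ℕ) : ℕ := (j - 1) * D.ℓ / D.q

/-- The ideal that defines `K_0^{i,j}`.  For `i > (ℓ-1) p/ℓ` it is
`(x^{i-(ℓ-k-1)p/ℓ}, x^{i-(ℓ-k)p/ℓ} y^{j-kq/ℓ}, …, x^{i-(ℓ-1)p/ℓ} y^{j-q/ℓ}, y^j)`, with `k + 2`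
generators; for `i = (ℓ-1) p/ℓ` it is
`(x^{kp/ℓ}, x^{(k-1)p/ℓ} y^{j-kq/ℓ}, …, x^{p/ℓ} y^{j-2q/ℓ}, y^{j-q/ℓ})`, with `k + 1` generators.
The first exponent `i - (ℓ-1-k+s) p/ℓ` is written `(i - (ℓ-1) p/ℓ) + (k-s) p/ℓ`. -/
def stair (v : D.V₀) : Staircase D.p D.q where
  m := if v.1.1 = (D.ℓ - 1) * D.P then D.k v.1.2 else D.k v.1.2 + 1
  e s := if s ≤ D.k v.1.2 then v.1.1 - (D.ℓ - 1) * D.P + (D.k v.1.2 - s) * D.P else 0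
  f s := if s = 0 then 0 else v.1.2 - (D.k v.1.2 + 1 - s) * D.Q
  e_succ_le s _ := by
    by_cases h : s + 1 ≤ D.k v.1.2
    · rw [if_pos h, if_pos (by omega)]
      gcongr; omega
    · rw [if_neg h]; exact Nat.zero_le _
  f_le_succ s _ := by
    by_cases h : s = 0
    · rw [if_pos h]; exact Nat.zero_le _
    · rw [if_neg h, if_neg (by omega)]
      gcongr; omega
  e_last := by
    by_cases h : v.1.1 = (D.ℓ - 1) * D.P
    · simp [h]
    · simp [h]
  f_zero := by simp
  e_zero_le := by
    obtain ⟨h1, h2, h3⟩ := D.le_of_mem_V₀ v.2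
    have hℓ := D.one_lt_ℓ
    have hk : D.k v.1.2 ≤ D.ℓ - 1 := by
      have : D.k v.1.2 < D.ℓ := by
        rw [k, Nat.div_lt_iff_lt_mul D.q_pos, mul_comm]
        exact Nat.mul_lt_mul_of_pos_left (by omega) (by omega)
      omega
    have h4 : D.k v.1.2 * D.P ≤ (D.ℓ - 1) * D.P := Nat.mul_le_mul_right _ hk
    have h5 : D.k v.1.2 * D.P ≤ D.p := h4.trans (by rw [p_eq]; gcongr; omega)
    have hP := D.p_eq
    simp only [Nat.zero_le, if_true, Nat.sub_zero]
    omega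
  f_last_le := by
    obtain ⟨h1, h2, h3⟩ := D.le_of_mem_V₀ v.2
    generalize (if v.1.1 = (D.ℓ - 1) * D.P then D.k v.1.2 else D.k v.1.2 + 1) = s
    split_ifs <;> omega

/-- `K_0^{i,j}`, the stabilisation of `R(i|x| + j|y|)` modulo the ideal above. -/
def K₀ (v : D.V₀) : MatFac D.deg D.c D.W :=
  (D.stair v).matFac rfl D.c_eq (v.1.1 • D.deg 0 + v.1.2 • D.deg 1)

/-- The objects of the category `B`. -/
abbrev Vertex : Type := D.V₀ ⊕ Fin D.ℓ

/-- The objects of `B`: the `K_0^{i,j}` and the `K_{w_r}[3]`. -/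
def obj : D.Vertex → MatFac D.deg D.c D.W
  | Sum.inl v => D.K₀ v
  | Sum.inr r => (D.Kw r).shift 3

/-- The full subcategory `B` of the dg-category of `L`-graded matrix factorisations. -/
def B : AInfCat D.Vertex := MatFac.dgCat D.obj D.zsmul_c_eq_zero

/-- The end of the arrow labelled `x` that starts at `(i, j)`: vertical arrows go from `(i, j)` to
`(i+1, j)` if `i < p-1`, diagonal arrows from `(p-1, j)` to `((ℓ-1) p/ℓ, j + q/ℓ)`. -/
def xNext (v : ℕ × ℕ) : ℕ × ℕ :=
  if v.1 = D.p - 1 then ((D.ℓ - 1) * D.P, v.2 + D.Q) else (v.1 + 1, v.2)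

/-- The end of the horizontal arrow labelled `y` that starts at `(i, j)`. -/
def yNext (v : ℕ × ℕ) : ℕ × ℕ := (v.1, v.2 + 1)

/-- The arrows of the quiver: arrows `x` and `y` start at every vertex `(i, j)` for which the end is
again a vertex, and for every `r` there is an arrow `c_r` from the vertex `(p-1, q-1)` to the vertex
`K_{w_r}[3]`. -/
inductive Arrow : Type
  | x (v : D.V₀) (h : D.xNext v ∈ D.V₀)
  | y (v : D.V₀) (h : yNext v ∈ D.V₀)
  | c (r : Fin D.ℓ) (h : (D.p - 1, D.q - 1) ∈ D.V₀)

def src : D.Arrow → D.Vertex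
  | .x v _ => Sum.inl v
  | .y v _ => Sum.inl v
  | .c _ h => Sum.inl ⟨_, h⟩

def tgt : D.Arrow → D.Vertex
  | .x _ h => Sum.inl ⟨_, h⟩
  | .y _ h => Sum.inl ⟨_, h⟩
  | .c r _ => Sum.inr r

/-- The sum of all arrows labelled `x`. -/
def xSum : PathAlgebra D.src D.tgt :=
  ∑ v : D.V₀, if h : D.xNext v ∈ D.V₀ then PathAlgebra.arrow D.src D.tgt (.x v h) else 0

/-- The sum of all arrows labelled `y`. -/
def ySum : PathAlgebra D.src D.tgt :=
  ∑ v : D.V₀, if h : yNext v ∈ D.V₀ then PathAlgebra.arrow D.src D.tgt (.y v h) else 0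

/-- The relations `x y = y x` and `c_r (x^{p/ℓ} - e^{πi/ℓ} η^r y^{q/ℓ}) = 0`, for all paths for which
they make sense.  Multiplying these two elements of the path algebra by the idempotents of the
vertices gives the relations between individual paths. -/
inductive QuiverRel : PathAlgebra D.src D.tgt → PathAlgebra D.src D.tgt → Prop
  | comm : QuiverRel (D.xSum * D.ySum) (D.ySum * D.xSum)
  | c (r : Fin D.ℓ) (h : (D.p - 1, D.q - 1) ∈ D.V₀) :
    QuiverRel (PathAlgebra.arrow D.src D.tgt (.c r h) *
      (D.xSum ^ D.P - D.root r • D.ySum ^ D.Q)) 0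

/-- The algebra of the quiver with relations. -/
abbrev QuiverAlgebra : Type := RingQuot D.QuiverRel

/-- The idempotent of a vertex. -/
def vertex (v : D.Vertex) : D.QuiverAlgebra :=
  RingQuot.mkAlgHom ℂ D.QuiverRel (PathAlgebra.vertex D.src D.tgt v)

end BPData

end

/-! The cohomology of all morphism complexes is computed by hand, and both remaining assertions
follow from that computation.

A closed map into $K_0^{i,j}$ is null-homotopic as soon as its row at the generator covering the
module lies in the monomial ideal, and a row lifts to a closed map as soon as it is compatible with
the differential modulo the ideal (`Staircase.exists_homotopy`, `Staircase.exists_lift`). Both facts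
rest on the classical resolution of a monomial ideal in two variables: the syzygies of its
generators are spanned by those between neighbours (`Staircase.exists_syzygy`). For $K_{w_r}$ the
corresponding obstruction is the first row modulo $w_r$ and modulo the source differential. All of
this is done with arbitrary polynomial matrices; homogeneity is restored by projecting to the right
degree, which commutes with the differentials (`MatFac.exists_homotopy_mem`).

The grading then decides everything. A class in $L$ has at most one representative whose
$x$-coordinate lies in a window of $P=p/\ell$ consecutive integers, and the vertices $(i,j)$ live in
this window. The generators of the ideals sit in `Boundary` degrees, just below the vertices, so the
ideal of $v$ contains every monomial leading to $v$ from a non-vertex degree and no nonzero element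
coming from a vertex (`mem_ideal_of_homogeneous`, `eq_zero_of_mem_ideal`). Hence maps $K_0^u\to
K_0^v$ are the homogeneous polynomials of degree `pos v - pos u`, in cohomological degree $0$ only,
and nothing maps from $K_{w_r}[3]$ to $K_0^v$. Modulo $w_r$ a graded piece of $S$ is at most
one-dimensional and is detected by evaluation at a point $(\rho,1)$ with $\rho^P$ the coefficient of
$w_r$ (`w_dvd_of_ev_eq_zero`). This leaves one dimension of maps $K_0^u\to K_{w_r}[3]$ and the
scalars on each $K_{w_r}[3]$, again in degree $0$ (`exists_homotopy_obj`).

The resulting invariant `inv` turns composition into multiplication of polynomials, followed by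
evaluation at the point when the target is $K_{w_r}[3]$ (`inv_mul_inl`, `inv_mul_inr`). Arrows $x$,
$y$, $c_r$ receive the labels $x$, $y$, $1$; the quiver relations hold because polynomials commute
and $\rho^P$ is the coefficient of $w_r$. Conversely, the relations bring every path into the form
$x^ay^b$ or $c_rx^ay^b$, and all paths from $u$ to $K_{w_r}[3]$ become multiples of one. Comparing
invariants component by component gives bijectivity (`quiverHom_injective`, `quiverHom_surjective`).

Formality needs only concentration in degree $0$: the truncation $\tau_{\le 0}A$ maps
quasi-isomorphically both to $A$ and to the cohomology category. No higher product survives there,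
since $\mu^d$ has degree $2-d$. -/

noncomputable section

/-! ### Strict functors between $A_\infty$-categories -/

namespace AInfFunctor

variable {V : Type} {A B : AInfCat V}

/-- The components of a strict functor with linear part `φ`. -/
def strictF (φ : A.carrier →ₗ[ℂ] B.carrier) :
    (d : ℕ) → MultilinearMap ℂ (fun _ : Fin d => A.carrier) B.carrier
  | 1 => MultilinearMap.ofSubsingleton ℂ A.carrier B.carrier (0 : Fin 1) φ
  | _ => 0

theorem strictF_one (φ : A.carrier →ₗ[ℂ] B.carrier) {d : ℕ} (hd : d = 1)
    (x : Fin d → A.carrier) : strictF φ d x = φ (x ⟨0, by omega⟩) := by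
  subst hd; rfl

theorem strictF_ne_one (φ : A.carrier →ₗ[ℂ] B.carrier) {d : ℕ} (hd : d ≠ 1) :
    strictF φ d = 0 := by
  match d with
  | 0 => rfl
  | 1 => exact absurd rfl hd
  | d + 2 => rfl

theorem μ_congr_length (B : AInfCat V) {k d : ℕ} (h : k = d) (x : ℕ → B.carrier) :
    B.μ k (fun i => x i) = B.μ d (fun i => x i) := by
  subst h; rfl

/-- A linear map that preserves the hom-spaces and commutes with all operations is a (strict)
functor. -/
def strict (φ : A.carrier →ₗ[ℂ] B.carrier)
    (hmem : ∀ u v n, ∀ a ∈ A.hom u v n, φ a ∈ B.hom u v n)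
    (hμ : ∀ (d : ℕ) (X : ℕ → V) (n : ℕ → ℤ) (a : ℕ → A.carrier), 1 ≤ d →
      (∀ i < d, a i ∈ A.hom (X i) (X (i + 1)) (n i)) →
        B.μ d (fun i => φ (a i)) = φ (A.μ d fun i => a i)) : AInfFunctor A B where
  F := strictF φ
  F_mem d X n a hd ha := by
    by_cases h : d = 1
    · subst h
      rw [strictF_one φ rfl]
      have h1 := hmem _ _ _ _ (ha 0 one_pos)
      simpa using h1
    · rw [strictF_ne_one φ h]; exact Submodule.zero_mem _
  rel d X n a hd ha := by
    -- Only the linear component is nonzero. So on the left just the composition into blocks of size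
    -- one survives, and on the right just the term in which all $d$ inputs are multiplied before
    -- the functor is applied.
    rw [Finset.sum_eq_single (Composition.ones d), Finset.sum_eq_single d]
    · have h1 : ∀ j : Fin (Composition.ones d).length,
          strictF φ ((Composition.ones d).blocksFun j)
            (fun k => a ((Composition.ones d).embedding j k)) = φ (a j) := by
        intro j
        rw [strictF_one φ (Composition.ones_blocksFun d j)]
        have h2 := Composition.ones_embedding j (by rw [Composition.ones_blocksFun]; exact one_pos)
        rw [h2]
      simp only [h1]
      rw [μ_congr_length B (Composition.ones_length d) (fun i => φ (a i)), hμ d X n a hd ha]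
      have h2 : d + 1 - d = 1 := by omega
      rw [h2, Finset.sum_range_one]
      simp only [Finset.range_zero, Finset.sum_empty, Int.negOnePow_zero, one_smul]
      rw [strictF_one φ rfl]
      simp
    · intro s hs hsd
      rw [Finset.mem_Icc] at hs
      refine Finset.sum_eq_zero fun r _ => ?_
      rw [strictF_ne_one φ (by omega)]
      simp
    · intro h
      exact absurd (Finset.mem_Icc.2 ⟨hd, le_rfl⟩) h
    · intro c _ hc
      obtain ⟨i, hi, h1⟩ := Composition.ne_ones_iff.1 hc
      obtain ⟨j, hj⟩ := List.mem_iff_get.1 hi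
      refine (B.μ c.length).map_coord_zero j ?_
      have : c.blocksFun j = i := hj
      rw [strictF_ne_one φ (by omega)]
      rfl
    · intro h
      exact absurd (Finset.mem_univ _) h

end AInfFunctor

/-! ### Low-order relations and truncation -/

namespace AInfCat

variable {V : Type}

theorem μ₁_apply (A : AInfCat V) (a : A.carrier) : A.μ₁ a = A.μ 1 (fun _ => a) := rfl

theorem μ₁_mem (A : AInfCat V) {u v : V} {n : ℤ} {a : A.carrier} (ha : a ∈ A.hom u v n) :
    A.μ₁ a ∈ A.hom u v (n + 1) := by
  have h := A.μ_mem 1 (fun i => if i = 0 then u else v) (fun _ => n) (fun _ => a) le_rfl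
    (by intro i hi; interval_cases i; simpa using ha)
  simp only [Finset.sum_range_one] at h
  simp only [if_true, one_ne_zero, if_false] at h
  rw [show n + 2 - ((1 : ℕ) : ℤ) = n + 1 by push_cast; ring] at h
  exact h

theorem μ₁_μ₁ (A : AInfCat V) {u v : V} {n : ℤ} {a : A.carrier} (ha : a ∈ A.hom u v n) :
    A.μ₁ (A.μ₁ a) = 0 := by
  have h := A.rel 1 (fun i => if i = 0 then u else v) (fun _ => n) (fun _ => a)
    (by intro i hi; interval_cases i; simpa using ha)
  simp only [μ₁_apply]
  simpa using h

theorem coboundaries_le_cocycles (A : AInfCat V) (u v : V) (n : ℤ) :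
    A.coboundaries u v n ≤ A.cocycles u v n := by
  rintro _ ⟨a, ha, rfl⟩
  refine ⟨?_, A.μ₁_μ₁ ha⟩
  have := A.μ₁_mem ha
  rwa [sub_add_cancel] at this

theorem μ₂_eq (A : AInfCat V) (a : ℕ → A.carrier) : A.μ 2 (fun i => a i) = A.μ 2 ![a 0, a 1] := by
  congr 1; funext i; fin_cases i <;> rfl

theorem rel_two (A : AInfCat V) {u v w : V} {n m : ℤ} {a b : A.carrier}
    (ha : a ∈ A.hom u v n) (hb : b ∈ A.hom v w m) :
    A.μ 2 ![A.μ₁ a, b] + (n - 1).negOnePow • A.μ 2 ![a, A.μ₁ b] + A.μ₁ (A.μ 2 ![a, b]) = 0 := by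
  have h := A.rel 2 (fun i => if i = 0 then u else if i = 1 then v else w)
    (fun i => if i = 0 then n else m) (fun i => if i = 0 then a else b)
    (by intro i hi; interval_cases i; exacts [by simpa using ha, by simpa using hb])
  rw [show Finset.Icc 1 2 = {1, 2} by rfl, Finset.sum_pair (by norm_num)] at h
  norm_num [Finset.sum_range_succ] at h
  convert h using 2
  · congr 2
    · funext i; fin_cases i <;> simp [μ₁_apply]
    · congr 1; funext i; fin_cases i <;> simp [μ₁_apply]
  · rw [μ₁_apply]; congr 1; funext i; congr 1; funext k; fin_cases k <;> simp

/-- On cocycles the three terms with an inner $\mu^1$ drop out of the relation of length three,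
which leaves associativity up to the coboundary of $\mu^3$. -/
theorem rel_three (A : AInfCat V) {u v w x : V} {n m k : ℤ} {a b c : A.carrier}
    (ha : a ∈ A.cocycles u v n) (hb : b ∈ A.cocycles v w m) (hc : c ∈ A.cocycles w x k) :
    A.μ 2 ![A.μ 2 ![a, b], c] + (n - 1).negOnePow • A.μ 2 ![a, A.μ 2 ![b, c]] +
      A.μ₁ (A.μ 3 ![a, b, c]) = 0 := by
  have h := A.rel 3 (fun i => if i = 0 then u else if i = 1 then v else if i = 2 then w else x)
    (fun i => if i = 0 then n else if i = 1 then m else k)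
    (fun i => if i = 0 then a else if i = 1 then b else c)
    (by intro i hi; interval_cases i;
        exacts [by simpa using ha.1, by simpa using hb.1, by simpa using hc.1])
  rw [show Finset.Icc 1 3 = {1, 2, 3} by rfl, Finset.sum_insert (by simp),
      Finset.sum_pair (by norm_num)] at h
  have ha' : A.μ 1 (fun _ => a) = 0 := ha.2
  have hb' : A.μ 1 (fun _ => b) = 0 := hb.2
  have hc' : A.μ 1 (fun _ => c) = 0 := hc.2
  norm_num [Finset.sum_range_succ] at h
  have e : ∀ (x y z s t r : A.carrier) (ε ε' : ℤˣ), (x + ε • y + ε' • z) + ((s + ε • t) + r) = 0 →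
      x = 0 → y = 0 → z = 0 → s + ε • t + r = 0 := by
    intro x y z s t r ε ε' h hx hy hz
    simpa [hx, hy, hz] using h
  have h2 := e _ _ _ _ _ _ _ _ h ((A.μ 3).map_coord_zero (0 : Fin 3) (by simpa using ha'))
      ((A.μ 3).map_coord_zero (1 : Fin 3) (by simpa using hb'))
      ((A.μ 3).map_coord_zero (2 : Fin 3) (by simpa using hc'))
  convert h2 using 2
  · congr 1
    · congr 1; funext i; fin_cases i
      · simp; congr 1; funext k; fin_cases k <;> simp
      · simp
    · congr 2; funext i; fin_cases i
      · simp
      · simp; congr 1; funext k; fin_cases k <;> simp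
  · rw [μ₁_apply]; congr 1; funext i; congr 1; funext k; fin_cases k <;> simp

/-- The cohomology of `A` is concentrated in degree `0`. -/
def ConcentratedInDegreeZero (A : AInfCat V) : Prop :=
  ∀ (u v : V) (n : ℤ), n ≠ 0 → Subsingleton (A.H u v n)

theorem ConcentratedInDegreeZero.mem_coboundaries {A : AInfCat V}
    (hA : A.ConcentratedInDegreeZero) {u v : V} {n : ℤ} (hn : n ≠ 0) {a : A.carrier}
    (ha : a ∈ A.cocycles u v n) : a ∈ A.coboundaries u v n := by
  have := hA u v n hn
  have h : (Submodule.Quotient.mk ⟨a, ha⟩ : A.H u v n) = 0 := Subsingleton.elim _ _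
  rwa [Submodule.Quotient.mk_eq_zero] at h

theorem ConcentratedInDegreeZero.of_hIso {A B : AInfCat V} (hB : B.ConcentratedInDegreeZero)
    (h : HIso A B) : A.ConcentratedInDegreeZero := by
  obtain ⟨e, -⟩ := h
  intro u v n hn
  have := hB u v n hn
  exact (e u v n).toEquiv.subsingleton

/-- The hom-spaces of the truncation `τ_{≤ 0} A`. -/
def truncHom (A : AInfCat V) (u v : V) (n : ℤ) : Submodule ℂ A.carrier :=
  if n < 0 then A.hom u v n else if n = 0 then A.cocycles u v 0 else ⊥

theorem truncHom_neg (A : AInfCat V) (u v : V) {n : ℤ} (h : n < 0) :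
    A.truncHom u v n = A.hom u v n := if_pos h

theorem truncHom_zero (A : AInfCat V) (u v : V) : A.truncHom u v 0 = A.cocycles u v 0 := by
  simp [truncHom]

theorem truncHom_pos (A : AInfCat V) (u v : V) {n : ℤ} (h : 0 < n) :
    A.truncHom u v n = ⊥ := by
  rw [truncHom, if_neg (by omega), if_neg (by omega)]

theorem truncHom_le (A : AInfCat V) (u v : V) (n : ℤ) : A.truncHom u v n ≤ A.hom u v n := by
  rw [truncHom]
  split_ifs with h1 h2
  · exact le_rfl
  · subst h2; exact inf_le_left
  · exact bot_le

/-- With inputs of degree at most $0$ the output has degree at most $2-d$, so only $d\le 2$ can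
reach degree $0$ or more. There the output is a coboundary, the differential of a cocycle, or a
product of two cocycles. -/
theorem μ_mem_truncHom (A : AInfCat V) (d : ℕ) (X : ℕ → V) (n : ℕ → ℤ) (a : ℕ → A.carrier)
    (hd : 1 ≤ d) (ha : ∀ i < d, a i ∈ A.truncHom (X i) (X (i + 1)) (n i)) :
    A.μ d (fun i => a i) ∈ A.truncHom (X 0) (X d) (∑ i ∈ Finset.range d, n i + 2 - d) := by
  by_cases hpos : ∃ i < d, 0 < n i
  · obtain ⟨i, hi, h⟩ := hpos
    have h1 := ha i hi
    rw [truncHom_pos _ _ _ h, Submodule.mem_bot] at h1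
    rw [(A.μ d).map_coord_zero (⟨i, hi⟩ : Fin d) h1]
    exact Submodule.zero_mem _
  push Not at hpos
  have hmem := A.μ_mem d X n a hd fun i hi => A.truncHom_le _ _ _ (ha i hi)
  by_cases hneg : ∑ i ∈ Finset.range d, n i + 2 - (d : ℤ) < 0
  · rwa [truncHom_neg _ _ _ hneg]
  have hs : ∑ i ∈ Finset.range d, n i ≤ 0 := Finset.sum_nonpos fun i hi =>
    hpos i (Finset.mem_range.1 hi)
  have hd2 : d ≤ 2 := by omega
  interval_cases d
  · have h0 := hpos 0 one_pos
    have ha0 := ha 0 one_pos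
    simp only [Finset.sum_range_one] at hneg hmem ⊢
    rcases h0.lt_or_eq with h | h
    · have h1 : n 0 = -1 := by push_cast at hneg; omega
      rw [h1, show (-1 : ℤ) + 2 - ((1 : ℕ) : ℤ) = 0 by norm_num] at hmem ⊢
      rw [truncHom_zero]
      refine ⟨hmem, ?_⟩
      have h2 : A.μ 1 (fun i => a i) = A.μ₁ (a 0) := by
        rw [μ₁_apply]; congr 1; funext i; congr 1; simp
      rw [h2]
      exact A.μ₁_μ₁ (A.truncHom_le _ _ _ ha0)
    · rw [h, truncHom_zero] at ha0
      have h1 : A.μ 1 (fun _ => a 0) = 0 := ha0.2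
      have h2 : A.μ 1 (fun i => a i) = 0 := by
        rw [← h1]; congr 1; funext i; congr 1; simp
      rw [h2]; exact Submodule.zero_mem _
  · have h0 := hpos 0 (by norm_num)
    have h1 := hpos 1 (by norm_num)
    have ha0 := ha 0 (by norm_num)
    have ha1 := ha 1 (by norm_num)
    simp only [Finset.sum_range_succ, Finset.range_zero, Finset.sum_empty, zero_add] at hneg ⊢
    have e0 : n 0 = 0 := by push_cast at hneg; omega
    have e1 : n 1 = 0 := by push_cast at hneg; omega
    rw [e0, truncHom_zero] at ha0
    rw [e1, truncHom_zero] at ha1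
    have h := A.μ₂_mem_cocycles ha0 ha1
    rw [e0, e1, show (0 : ℤ) + 0 + 2 - ((2 : ℕ) : ℤ) = 0 by norm_num, truncHom_zero, μ₂_eq]
    exact h

/-- The truncation `τ_{≤ 0} A`. -/
def trunc (A : AInfCat V) : AInfCat V where
  carrier := A.carrier
  hom := A.truncHom
  indep := A.indep.mono fun _ => A.truncHom_le _ _ _
  μ := A.μ
  μ_mem := A.μ_mem_truncHom
  rel d X n a ha := A.rel d X n a fun i hi => A.truncHom_le _ _ _ (ha i hi)

theorem trunc_coboundaries (A : AInfCat V) (u v : V) {n : ℤ} (hn : n ≤ 0) :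
    A.trunc.coboundaries u v n = A.coboundaries u v n := by
  change (A.truncHom u v (n - 1)).map A.μ₁ = _
  rw [truncHom_neg _ _ _ (by omega)]; rfl

theorem trunc_cocycles_neg (A : AInfCat V) (u v : V) {n : ℤ} (hn : n < 0) :
    A.trunc.cocycles u v n = A.cocycles u v n := by
  change A.truncHom u v n ⊓ LinearMap.ker A.μ₁ = _
  rw [truncHom_neg _ _ _ hn]; rfl

theorem trunc_cocycles_zero (A : AInfCat V) (u v : V) :
    A.trunc.cocycles u v 0 = A.cocycles u v 0 := by
  change A.truncHom u v 0 ⊓ LinearMap.ker A.μ₁ = _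
  rw [truncHom_zero]; exact inf_eq_left.2 inf_le_right

theorem trunc_cocycles_pos (A : AInfCat V) (u v : V) {n : ℤ} (hn : 0 < n) :
    A.trunc.cocycles u v n = ⊥ := by
  change A.truncHom u v n ⊓ LinearMap.ker A.μ₁ = _
  rw [truncHom_pos _ _ _ hn, bot_inf_eq]; rfl

/-- The inclusion of the truncation. -/
def truncIncl (A : AInfCat V) : AInfFunctor A.trunc A :=
  AInfFunctor.strict (A := A.trunc) (B := A) LinearMap.id (fun u v n => A.truncHom_le u v n)
    fun _ _ _ _ _ _ => rfl

/-- In degrees at most $0$ the cocycles and coboundaries agree with those of $A$. In positive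
degrees the truncation is zero, and concentration says that every cocycle of $A$ is a coboundary. -/
theorem truncIncl_isQuasiIso (A : AInfCat V) (hA : A.ConcentratedInDegreeZero) :
    A.truncIncl.IsQuasiIso := by
  intro u v n
  rcases lt_trichotomy n 0 with hn | rfl | hn
  · rw [trunc_coboundaries _ _ _ hn.le, trunc_cocycles_neg _ _ _ hn]
    refine ⟨fun a _ h => h, fun b hb => ⟨b, hb, ?_⟩⟩
    change b - b ∈ _
    rw [sub_self]; exact Submodule.zero_mem _
  · rw [trunc_coboundaries _ _ _ le_rfl, trunc_cocycles_zero]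
    refine ⟨fun a _ h => h, fun b hb => ⟨b, hb, ?_⟩⟩
    change b - b ∈ _
    rw [sub_self]; exact Submodule.zero_mem _
  · rw [trunc_cocycles_pos _ _ _ hn]
    refine ⟨fun a ha _ => ?_, fun b hb => ⟨0, Submodule.zero_mem _, ?_⟩⟩
    · rw [(Submodule.mem_bot ℂ).1 ha]; exact Submodule.zero_mem _
    · change b - 0 ∈ _
      rw [sub_zero]; exact hA.mem_coboundaries hn.ne' hb

/-- Linear projections onto the hom-spaces. -/
theorem exists_proj (A : AInfCat V) :
    ∃ π : ∀ t : V × V × ℤ, A.carrier →ₗ[ℂ] A.hom t.1 t.2.1 t.2.2,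
      (∀ (t) (a : A.hom t.1 t.2.1 t.2.2), π t a = a) ∧
      ∀ t t', t ≠ t' → ∀ a ∈ A.hom t'.1 t'.2.1 t'.2.2, π t a = 0 := by
  classical
  -- Independence makes the map from the direct sum of the hom-spaces to the carrier injective. Over
  -- a field it has a linear left inverse, whose coordinates are the projections.
  have h := A.indep.dfinsupp_lsum_injective
  obtain ⟨g, hg⟩ := LinearMap.exists_leftInverse_of_injective _ (LinearMap.ker_eq_bot.2 h)
  have key : ∀ (t) (a : A.hom t.1 t.2.1 t.2.2), g a = DFinsupp.single t a := by
    intro t a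
    have := LinearMap.congr_fun hg (DFinsupp.single t a)
    simpa using this
  refine ⟨fun t => (DFinsupp.lapply t).comp g, fun t a => ?_, fun t t' htt a ha => ?_⟩
  · simp [key]
  · have := key t' ⟨a, ha⟩
    simp only [LinearMap.comp_apply, this, DFinsupp.lapply_apply]
    exact DFinsupp.single_eq_of_ne htt

theorem update_pair_zero {M : Type} (x y z : M) : Function.update ![x, y] 0 z = ![z, y] := by
  funext i; fin_cases i <;> simp

theorem update_pair_one {M : Type} (x y z : M) : Function.update ![x, y] 1 z = ![x, z] := by
  funext i; fin_cases i <;> simp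

theorem μ₂_mem (A : AInfCat V) {u v w : V} {n m : ℤ} {a b : A.carrier}
    (ha : a ∈ A.hom u v n) (hb : b ∈ A.hom v w m) : A.μ 2 ![a, b] ∈ A.hom u w (n + m) := by
  have h := A.μ_mem 2 (fun i => if i = 0 then u else if i = 1 then v else w)
    (fun i => if i = 0 then n else m) (fun i => if i = 0 then a else b) (by norm_num)
    (by intro i hi; interval_cases i; exacts [by simpa using ha, by simpa using hb])
  have e : (fun i : Fin 2 => if (i : ℕ) = 0 then a else b) = ![a, b] := by
    funext i; fin_cases i <;> rfl
  rw [e] at h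
  simpa [Finset.sum_range_succ] using h

theorem μ₃_mem (A : AInfCat V) {u v w x : V} {n m k : ℤ} {a b c : A.carrier}
    (ha : a ∈ A.hom u v n) (hb : b ∈ A.hom v w m) (hc : c ∈ A.hom w x k) :
    A.μ 3 ![a, b, c] ∈ A.hom u x (n + m + k - 1) := by
  have h := A.μ_mem 3 (fun i => if i = 0 then u else if i = 1 then v else if i = 2 then w else x)
    (fun i => if i = 0 then n else if i = 1 then m else k)
    (fun i => if i = 0 then a else if i = 1 then b else c) (by norm_num)
    (by intro i hi; interval_cases i;
        exacts [by simpa using ha, by simpa using hb, by simpa using hc])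
  have e : (fun i : Fin 3 => if (i : ℕ) = 0 then a else if (i : ℕ) = 1 then b else c) =
      ![a, b, c] := by
    funext i; fin_cases i <;> rfl
  rw [e] at h
  simp only [Finset.sum_range_succ, Finset.range_zero, Finset.sum_empty] at h
  norm_num at h
  rwa [show n + m + k + 2 - 3 = n + m + k - 1 by ring] at h

theorem μ₂_add_left (A : AInfCat V) (a a' b : A.carrier) :
    A.μ 2 ![a + a', b] = A.μ 2 ![a, b] + A.μ 2 ![a', b] := by
  have h := (A.μ 2).map_update_add ![0, b] 0 a a'
  rwa [update_pair_zero, update_pair_zero, update_pair_zero] at h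

theorem μ₂_add_right (A : AInfCat V) (a b b' : A.carrier) :
    A.μ 2 ![a, b + b'] = A.μ 2 ![a, b] + A.μ 2 ![a, b'] := by
  have h := (A.μ 2).map_update_add ![a, 0] 1 b b'
  rwa [update_pair_one, update_pair_one, update_pair_one] at h

theorem μ₂_smul_left (A : AInfCat V) (t : ℂ) (a b : A.carrier) :
    A.μ 2 ![t • a, b] = t • A.μ 2 ![a, b] := by
  have h := (A.μ 2).map_update_smul ![0, b] 0 t a
  rwa [update_pair_zero, update_pair_zero] at h

theorem μ₂_smul_right (A : AInfCat V) (t : ℂ) (a b : A.carrier) :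
    A.μ 2 ![a, t • b] = t • A.μ 2 ![a, b] := by
  have h := (A.μ 2).map_update_smul ![a, 0] 1 t b
  rwa [update_pair_one, update_pair_one] at h

theorem μ₂_zero_left (A : AInfCat V) (b : A.carrier) : A.μ 2 ![0, b] = 0 :=
  (A.μ 2).map_coord_zero 0 rfl

theorem μ₂_zero_right (A : AInfCat V) (a : A.carrier) : A.μ 2 ![a, 0] = 0 :=
  (A.μ 2).map_coord_zero 1 rfl

/-! ### Degree-zero cohomology and formality -/

/-- The product of degree `0` cocycles. -/
def cocyclesMul (A : AInfCat V) (u v w : V) :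
    A.cocycles u v 0 →ₗ[ℂ] A.cocycles v w 0 →ₗ[ℂ] A.cocycles u w 0 :=
  LinearMap.mk₂ ℂ (fun a b => ⟨A.μ 2 ![a, b], by simpa using A.μ₂_mem_cocycles a.2 b.2⟩)
    (fun a a' b => Subtype.ext (A.μ₂_add_left a a' b))
    (fun t a b => Subtype.ext (A.μ₂_smul_left t a b))
    (fun a b b' => Subtype.ext (A.μ₂_add_right a b b'))
    (fun t a b => Subtype.ext (A.μ₂_smul_right t a b))

theorem μ₂_coboundary_left (A : AInfCat V) {u v w : V} {a b : A.carrier}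
    (ha : a ∈ A.coboundaries u v 0) (hb : b ∈ A.cocycles v w 0) :
    A.μ 2 ![a, b] ∈ A.coboundaries u w 0 := by
  obtain ⟨h, hh, rfl⟩ := ha
  have h1 := A.rel_two hh hb.1
  have hb' : A.μ₁ b = 0 := hb.2
  rw [hb', μ₂_zero_right, smul_zero, add_zero] at h1
  refine ⟨-A.μ 2 ![h, b], neg_mem ?_, ?_⟩
  · simpa using A.μ₂_mem hh hb.1
  · rw [map_neg]; exact (eq_neg_of_add_eq_zero_left h1).symm

theorem μ₂_coboundary_right (A : AInfCat V) {u v w : V} {a b : A.carrier}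
    (ha : a ∈ A.cocycles u v 0) (hb : b ∈ A.coboundaries v w 0) :
    A.μ 2 ![a, b] ∈ A.coboundaries u w 0 := by
  obtain ⟨h, hh, rfl⟩ := hb
  have h1 := A.rel_two ha.1 hh
  have ha' : A.μ₁ a = 0 := ha.2
  have e : ((0 : ℤ) - 1).negOnePow = -1 := by decide
  rw [ha', μ₂_zero_left, zero_add, e, Units.neg_smul, one_smul] at h1
  refine ⟨A.μ 2 ![a, h], ?_, ?_⟩
  · simpa using A.μ₂_mem ha.1 hh
  · exact (neg_add_eq_zero.1 h1).symm

/-- The product on `H^0`. -/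
def hMul (A : AInfCat V) (u v w : V) : A.H u v 0 →ₗ[ℂ] A.H v w 0 →ₗ[ℂ] A.H u w 0 :=
  (Submodule.liftQ _ (Submodule.liftQ _
    ((A.cocyclesMul u v w).compr₂ (Submodule.mkQ _)) (by
      intro a ha
      rw [LinearMap.mem_ker]
      ext b
      simp only [LinearMap.compr₂_apply, Submodule.mkQ_apply, LinearMap.zero_apply]
      rw [Submodule.Quotient.mk_eq_zero]
      exact A.μ₂_coboundary_left ha b.2)).flip (by
    intro b hb
    rw [LinearMap.mem_ker]
    refine Submodule.linearMap_qext _ ?_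
    ext a
    simp only [LinearMap.flip_apply, LinearMap.comp_apply, Submodule.mkQ_apply,
      Submodule.liftQ_apply, LinearMap.compr₂_apply, LinearMap.zero_apply]
    rw [Submodule.Quotient.mk_eq_zero]
    exact A.μ₂_coboundary_right a.2 hb)).flip

theorem hMul_mk (A : AInfCat V) {u v w : V} (a : A.cocycles u v 0) (b : A.cocycles v w 0) :
    A.hMul u v w (Submodule.Quotient.mk a) (Submodule.Quotient.mk b) =
      Submodule.Quotient.mk (A.cocyclesMul u v w a b) := rfl

/-- By `rel_three` the two bracketings of representatives differ by a coboundary: in degree $0$ the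
sign is $-1$, so the sum there becomes a difference. -/
theorem hMul_assoc (A : AInfCat V) {u v w x : V} (a : A.H u v 0) (b : A.H v w 0)
    (c : A.H w x 0) :
    A.hMul u w x (A.hMul u v w a b) c = A.hMul u v x a (A.hMul v w x b c) := by
  obtain ⟨a, rfl⟩ := Submodule.Quotient.mk_surjective _ a
  obtain ⟨b, rfl⟩ := Submodule.Quotient.mk_surjective _ b
  obtain ⟨c, rfl⟩ := Submodule.Quotient.mk_surjective _ c
  simp only [hMul_mk]
  rw [Submodule.Quotient.eq]
  change A.μ 2 ![A.μ 2 ![a, b], c] - A.μ 2 ![a, A.μ 2 ![b, c]] ∈ A.coboundaries u x 0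
  have h := A.rel_three a.2 b.2 c.2
  have e : ((0 : ℤ) - 1).negOnePow = -1 := by decide
  rw [e, Units.neg_smul, one_smul, ← sub_eq_add_neg] at h
  refine ⟨-A.μ 3 ![a, b, c], neg_mem ?_, ?_⟩
  · simpa using A.μ₃_mem a.2.1 b.2.1 c.2.1
  · rw [map_neg]; exact (eq_neg_of_add_eq_zero_left h).symm

section HZeroMul

variable [Fintype V]

/-- The product of the total algebra of `H^0`, in the order of the operations `μ²`. -/
def hZeroMul (A : AInfCat V) (a b : ∀ t : V × V, A.H t.1 t.2 0) : ∀ t : V × V, A.H t.1 t.2 0 :=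
  fun t => ∑ v, A.hMul t.1 v t.2 (a (t.1, v)) (b (v, t.2))

theorem hZeroMul_assoc (A : AInfCat V) (a b c : ∀ t : V × V, A.H t.1 t.2 0) :
    A.hZeroMul (A.hZeroMul a b) c = A.hZeroMul a (A.hZeroMul b c) := by
  funext t
  simp only [hZeroMul, map_sum, LinearMap.sum_apply]
  rw [Finset.sum_comm]
  simp only [hMul_assoc]

/-- The operations of the cohomology category. -/
def hZeroμ (A : AInfCat V) : (d : ℕ) →
    MultilinearMap ℂ (fun _ : Fin d => ∀ t : V × V, A.H t.1 t.2 0) (∀ t : V × V, A.H t.1 t.2 0)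
  | 2 =>
    { toFun := fun a => A.hZeroMul (a 0) (a 1)
      map_update_add' := by
        intro _ a i x y
        funext t
        fin_cases i <;> simp [hZeroMul, Finset.sum_add_distrib]
      map_update_smul' := by
        intro _ a i r x
        funext t
        fin_cases i <;> simp [hZeroMul, Finset.smul_sum] }
  | _ => 0

theorem hZeroμ_two (A : AInfCat V) (a : Fin 2 → ∀ t : V × V, A.H t.1 t.2 0) :
    A.hZeroμ 2 a = A.hZeroMul (a 0) (a 1) := rfl

theorem hZeroμ_ne_two (A : AInfCat V) {d : ℕ} (hd : d ≠ 2) : A.hZeroμ d = 0 := by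
  match d with
  | 0 => rfl
  | 1 => rfl
  | 2 => exact absurd rfl hd
  | d + 3 => rfl

end HZeroMul

section HZero

variable [DecidableEq V]

/-- The hom-spaces of the cohomology category. -/
def hZeroHom (A : AInfCat V) (u v : V) (n : ℤ) : Submodule ℂ (∀ t : V × V, A.H t.1 t.2 0) :=
  if n = 0 then LinearMap.range (LinearMap.single ℂ (fun t : V × V => A.H t.1 t.2 0) (u, v))
  else ⊥

theorem hZeroHom_zero (A : AInfCat V) (u v : V) : A.hZeroHom u v 0 =
    LinearMap.range (LinearMap.single ℂ (fun t : V × V => A.H t.1 t.2 0) (u, v)) := if_pos rfl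

theorem hZeroHom_ne_zero (A : AInfCat V) (u v : V) {n : ℤ} (hn : n ≠ 0) :
    A.hZeroHom u v n = ⊥ := if_neg hn

theorem hZeroHom_indep (A : AInfCat V) :
    iSupIndep fun t : V × V × ℤ => A.hZeroHom t.1 t.2.1 t.2.2 := by
  rintro ⟨u, v, n⟩
  rw [Submodule.disjoint_def]
  intro f hf hf'
  by_cases hn : n = 0
  · subst hn
    have hle : (⨆ j, ⨆ (_ : j ≠ ((u, v, 0) : V × V × ℤ)), A.hZeroHom j.1 j.2.1 j.2.2) ≤
        LinearMap.ker (LinearMap.proj (R := ℂ) (φ := fun t : V × V => A.H t.1 t.2 0) (u, v)) := by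
      refine iSup₂_le fun ⟨u', v', n'⟩ hj => ?_
      by_cases hn' : n' = 0
      · subst hn'
        change A.hZeroHom u' v' 0 ≤ _
        rw [hZeroHom_zero]
        rintro _ ⟨x, rfl⟩
        rw [LinearMap.mem_ker, LinearMap.proj_apply, LinearMap.single_apply]
        have hne : ((u, v) : V × V) ≠ (u', v') := by
          rintro ⟨⟩
          exact hj rfl
        exact Pi.single_eq_of_ne (M := fun t : V × V => A.H t.1 t.2 0) hne x
      · change A.hZeroHom u' v' n' ≤ _
        rw [hZeroHom_ne_zero _ _ _ hn']; exact bot_le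
    have h1 : f (u, v) = 0 := hle hf'
    change f ∈ A.hZeroHom u v 0 at hf
    rw [hZeroHom_zero] at hf
    obtain ⟨x, rfl⟩ := hf
    rw [LinearMap.single_apply, Pi.single_eq_same] at h1
    rw [h1, map_zero]
  · change f ∈ A.hZeroHom u v n at hf
    rwa [hZeroHom_ne_zero _ _ _ hn] at hf

/-- The linear map underlying the functor from the truncation of `A` to the cohomology category
of `B` that is induced by maps `e` on cohomology. -/
theorem exists_toHZero (A B : AInfCat V) (e : ∀ u v : V, A.H u v 0 →ₗ[ℂ] B.H u v 0) :
    ∃ φ : A.carrier →ₗ[ℂ] (∀ t : V × V, B.H t.1 t.2 0),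
      (∀ u v n, n ≠ 0 → ∀ a ∈ A.truncHom u v n, φ a = 0) ∧
      ∀ (u v) (a : A.cocycles u v 0), φ a = Pi.single (u, v) (e u v (Submodule.Quotient.mk a)) := by
  obtain ⟨π, h1, h2⟩ := A.trunc.exists_proj
  have hz : ∀ t : V × V, A.truncHom t.1 t.2 0 ≤ A.cocycles t.1 t.2 0 := fun t =>
    (A.truncHom_zero t.1 t.2).le
  let ρ : ∀ t : V × V, A.carrier →ₗ[ℂ] A.truncHom t.1 t.2 0 := fun t => π (t.1, t.2, 0)
  let φ : A.carrier →ₗ[ℂ] (∀ t : V × V, B.H t.1 t.2 0) := LinearMap.pi fun t =>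
    (e t.1 t.2).comp ((Submodule.mkQ _).comp ((Submodule.inclusion (hz t)).comp (ρ t)))
  have hφ : ∀ a t, φ a t = e t.1 t.2 (Submodule.Quotient.mk
      (Submodule.inclusion (hz t) (ρ t a))) := fun _ _ => rfl
  have h1 : ∀ (t) (a : A.truncHom t.1 t.2 0), ρ t a = a := fun t => h1 (t.1, t.2, 0)
  have h2 : ∀ (t : V × V) u v n, (t.1, t.2, (0 : ℤ)) ≠ (u, v, n) → ∀ a ∈ A.truncHom u v n,
      ρ t a = 0 := fun t u v n h => h2 (t.1, t.2, 0) (u, v, n) h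
  refine ⟨φ, fun u v n hn a ha => ?_, fun u v a => ?_⟩
  · funext t
    rw [hφ, h2 t u v n (by simp [Ne.symm hn]) a ha, map_zero,
      Submodule.Quotient.mk_zero, map_zero]
    rfl
  · have ha : (a : A.carrier) ∈ A.truncHom u v 0 := (A.truncHom_zero u v).ge a.2
    funext ⟨s, t⟩
    by_cases h : (s, t) = (u, v)
    · obtain ⟨rfl, rfl⟩ := Prod.mk.inj h
      rw [hφ, Pi.single_eq_same, h1 (s, t) ⟨a, ha⟩]
      rfl
    · rw [hφ, Pi.single_eq_of_ne h, h2 (s, t) u v 0 (by rintro ⟨⟩; exact h rfl) a ha,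
        map_zero, Submodule.Quotient.mk_zero, map_zero]

variable [Fintype V]

theorem hZeroMul_single (A : AInfCat V) {u v w : V} (a : A.H u v 0) (b : A.H v w 0) :
    A.hZeroMul (Pi.single (u, v) a) (Pi.single (v, w) b) = Pi.single (u, w) (A.hMul u v w a b) := by
  funext ⟨s, t⟩
  rw [hZeroMul, Finset.sum_eq_single v]
  · by_cases h1 : s = u
    · by_cases h2 : t = w
      · subst h1 h2; simp
      · rw [Pi.single_eq_of_ne (i := (u, w)) (by simp [h2]), Pi.single_eq_of_ne (i := (v, w)) (by simp [h2]), map_zero]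
    · rw [Pi.single_eq_of_ne (i := (u, w)) (by simp [h1]), Pi.single_eq_of_ne (i := (u, v)) (by simp [h1]), map_zero,
        LinearMap.zero_apply]
  · intro v' _ h
    rw [Pi.single_eq_of_ne (i := (u, v)) (by simp [h]), map_zero, LinearMap.zero_apply]
  · intro h; exact absurd (Finset.mem_univ _) h

/-- The cohomology category in degree `0`, with trivial differential and higher products. -/
def hZero (A : AInfCat V) : AInfCat V where
  carrier := ∀ t : V × V, A.H t.1 t.2 0
  hom := A.hZeroHom
  indep := A.hZeroHom_indep
  μ := A.hZeroμ
  μ_mem d X n a hd ha := by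
    by_cases h2 : d = 2
    · subst h2
      have ha0 := ha 0 (by norm_num)
      have ha1 := ha 1 (by norm_num)
      rw [hZeroμ_two]
      by_cases h0 : n 0 = 0
      · by_cases h1 : n 1 = 0
        · rw [h0, hZeroHom_zero] at ha0
          rw [h1, hZeroHom_zero] at ha1
          obtain ⟨x, hx⟩ := ha0
          obtain ⟨y, hy⟩ := ha1
          rw [LinearMap.single_apply] at hx hy
          change A.hZeroMul (a 0) (a 1) ∈ _
          rw [← hx, ← hy]
          simp only [Finset.sum_range_succ, Finset.range_zero, Finset.sum_empty, h0, h1]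
          rw [show (0 : ℤ) + 0 + 0 + 2 - ((2 : ℕ) : ℤ) = 0 by norm_num, hZeroHom_zero]
          exact ⟨A.hMul _ _ _ x y, (A.hZeroMul_single x y).symm⟩
        · rw [hZeroHom_ne_zero _ _ _ h1, Submodule.mem_bot] at ha1
          have : A.hZeroμ 2 (fun i => a i) = 0 := (A.hZeroμ 2).map_coord_zero 1 ha1
          rw [hZeroμ_two] at this
          rw [this]; exact Submodule.zero_mem _
      · rw [hZeroHom_ne_zero _ _ _ h0, Submodule.mem_bot] at ha0
        have : A.hZeroμ 2 (fun i => a i) = 0 := (A.hZeroμ 2).map_coord_zero 0 ha0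
        rw [hZeroμ_two] at this
        rw [this]; exact Submodule.zero_mem _
    · rw [hZeroμ_ne_two _ h2]; exact Submodule.zero_mem _
  rel d X n a ha := by
    -- Only $\mu^2$ is nonzero, so a term survives only if the inner and the outer operation both
    -- have two inputs. This forces $d=3$, and the relation is associativity.
    by_cases h3 : d = 3
    · subst h3
      rw [show Finset.Icc 1 3 = {1, 2, 3} by rfl, Finset.sum_insert (by simp),
        Finset.sum_pair (by norm_num), Finset.sum_eq_zero, Finset.sum_eq_zero (s := Finset.range (3 + 1 - 3)),
        zero_add, add_zero]
      · rw [show Finset.range (3 + 1 - 2) = {0, 1} by rfl, Finset.sum_pair (by norm_num)]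
        simp only [Finset.range_zero, Finset.sum_empty, Int.negOnePow_zero, one_smul,
          Finset.sum_range_one]
        change A.hZeroMul (A.hZeroMul (a 0) (a 1)) (a 2) +
          (n 0 - 1).negOnePow • A.hZeroMul (a 0) (A.hZeroMul (a 1) (a 2)) = 0
        rw [hZeroMul_assoc]
        -- The sign is the required $-1$ in degree $0$; in any other degree the first input
        -- vanishes, so the sign does not matter.
        by_cases h0 : n 0 = 0
        · have e : ((0 : ℤ) - 1).negOnePow = -1 := by decide
          rw [h0, e, Units.neg_smul, one_smul, add_neg_cancel]
        · have ha0 := ha 0 (by norm_num)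
          rw [hZeroHom_ne_zero _ _ _ h0, Submodule.mem_bot] at ha0
          have : A.hZeroμ 2 ![a 0, A.hZeroMul (a 1) (a 2)] = 0 :=
            (A.hZeroμ 2).map_coord_zero 0 ha0
          rw [hZeroμ_two] at this
          change A.hZeroMul (a 0) (A.hZeroMul (a 1) (a 2)) = 0 at this
          rw [this, smul_zero, add_zero]
      · intro r hr
        rw [hZeroμ_ne_two _ (by norm_num)]
        simp
      · intro r hr
        rw [hZeroμ_ne_two _ (by norm_num)]
        simp
    · refine Finset.sum_eq_zero fun s hs => Finset.sum_eq_zero fun r hr => ?_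
      rw [Finset.mem_Icc] at hs
      rw [Finset.mem_range] at hr
      by_cases h : d + 1 - s = 2
      · rw [MultilinearMap.map_coord_zero _ (⟨r, hr⟩ : Fin (d + 1 - s)), smul_zero]
        simp [hZeroμ_ne_two A (d := s) (by omega)]
      · rw [hZeroμ_ne_two _ h]; simp

/-- The functor sends a degree-zero cocycle to the image of its class under `e` and kills negative
degrees. It is strict: coboundaries map to zero ($d=1$), products are respected by `hmul` ($d=2$),
and for $d\ge 3$ the output has negative degree. -/
theorem trunc_quasiIso_hZero (A B : AInfCat V) (hA : A.ConcentratedInDegreeZero)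
    (e : ∀ u v : V, A.H u v 0 ≃ₗ[ℂ] B.H u v 0)
    (hmul : ∀ {u v w : V} (a : A.cocycles u v 0) (b : A.cocycles v w 0),
      e u w (Submodule.Quotient.mk (A.cocyclesMul u v w a b)) =
        B.hMul u v w (e u v (Submodule.Quotient.mk a)) (e v w (Submodule.Quotient.mk b))) :
    ∃ f : AInfFunctor A.trunc B.hZero, f.IsQuasiIso := by
  obtain ⟨φ, h0, h1⟩ := exists_toHZero A B fun u v => (e u v).toLinearMap
  have hcob : ∀ (u v) (a : A.carrier), a ∈ A.coboundaries u v 0 → φ a = 0 := by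
    intro u v a ha
    have h2 := h1 u v ⟨a, A.coboundaries_le_cocycles u v 0 ha⟩
    have h3 : (Submodule.Quotient.mk ⟨a, A.coboundaries_le_cocycles u v 0 ha⟩ : A.H u v 0) = 0 :=
      (Submodule.Quotient.mk_eq_zero _).2 ha
    rw [h3, map_zero, Pi.single_zero] at h2
    exact h2
  have hzero : ∀ (u v n) (a : A.carrier), a ∈ A.truncHom u v n → n ≠ 0 → φ a = 0 :=
    fun u v n a ha hn => h0 u v n hn a ha
  have hmem : ∀ u v n, ∀ a ∈ A.truncHom u v n, φ a ∈ B.hZeroHom u v n := by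
    intro u v n a ha
    by_cases hn : n = 0
    · subst hn
      have ha' : a ∈ A.cocycles u v 0 := (A.truncHom_zero u v).le ha
      rw [hZeroHom_zero]
      exact ⟨_, (h1 u v ⟨a, ha'⟩).symm⟩
    · rw [h0 u v n hn a ha]; exact Submodule.zero_mem _
  have hμ : ∀ (d : ℕ) (X : ℕ → V) (n : ℕ → ℤ) (a : ℕ → A.carrier), 1 ≤ d →
      (∀ i < d, a i ∈ A.truncHom (X i) (X (i + 1)) (n i)) →
        B.hZeroμ d (fun i => φ (a i)) = φ (A.μ d fun i => a i) := by
    intro d X n a hd ha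
    have hmem := A.μ_mem_truncHom d X n a hd ha
    by_cases hpos : ∃ i < d, 0 < n i
    · obtain ⟨i, hi, h⟩ := hpos
      have h2 : a i = 0 := by
        have h2 : a i ∈ A.truncHom _ _ _ := ha i hi
        rwa [truncHom_pos _ _ _ h, Submodule.mem_bot] at h2
      rw [(A.μ d).map_coord_zero (⟨i, hi⟩ : Fin d) h2, map_zero]
      exact (B.hZeroμ d).map_coord_zero (⟨i, hi⟩ : Fin d) (by simp [h2])
    push Not at hpos
    by_cases h2 : d = 2
    · subst h2
      by_cases hn0 : n 0 = 0
      · by_cases hn1 : n 1 = 0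
        · have ha0 : a 0 ∈ A.truncHom _ _ _ := ha 0 (by norm_num)
          have ha1 : a 1 ∈ A.truncHom _ _ _ := ha 1 (by norm_num)
          rw [hn0, truncHom_zero] at ha0
          rw [hn1, truncHom_zero] at ha1
          rw [hZeroμ_two, μ₂_eq]
          change B.hZeroMul (φ (a 0)) (φ (a 1)) = _
          have e0 := h1 _ _ ⟨a 0, ha0⟩
          have e1 := h1 _ _ ⟨a 1, ha1⟩
          have e2 := h1 _ _ (A.cocyclesMul _ _ _ ⟨a 0, ha0⟩ ⟨a 1, ha1⟩)
          change φ (a 0) = _ at e0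
          change φ (a 1) = _ at e1
          change φ (A.μ 2 ![a 0, a 1]) = _ at e2
          rw [e0, e1, e2]
          refine (B.hZeroMul_single _ _).trans ?_
          exact congrArg _ (hmul _ _).symm
        · have := hzero _ _ _ _ (ha 1 (by norm_num)) hn1
          rw [hzero _ _ _ _ hmem]
          · exact (B.hZeroμ 2).map_coord_zero 1 this
          · have h3 := hpos 1 (by norm_num)
            simp only [Finset.sum_range_succ, Finset.range_zero, Finset.sum_empty]
            push_cast; omega
      · have := hzero _ _ _ _ (ha 0 (by norm_num)) hn0
        rw [hzero _ _ _ _ hmem]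
        · exact (B.hZeroμ 2).map_coord_zero 0 this
        · have h3 := hpos 1 (by norm_num)
          have h4 := hpos 0 (by norm_num)
          simp only [Finset.sum_range_succ, Finset.range_zero, Finset.sum_empty]
          push_cast; omega
    · rw [hZeroμ_ne_two _ h2]
      change (0 : ∀ t : V × V, B.H t.1 t.2 0) = _
      by_cases h3 : d = 1
      · subst h3
        have ha0 : a 0 ∈ A.truncHom _ _ _ := ha 0 (by norm_num)
        simp only [Finset.sum_range_one] at hmem
        by_cases hn : n 0 = -1
        · have h4 : (A.μ 1 fun i => a i) = A.μ₁ (a 0) := by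
            rw [μ₁_apply]; congr 1; funext i; congr 1; simp
          rw [h4, hcob (X 0) (X 1)]
          refine ⟨a 0, ?_, rfl⟩
          rw [hn] at ha0
          exact A.truncHom_le _ _ _ ha0
        · rw [hzero _ _ _ _ hmem]
          push_cast; omega
      · have hs : ∑ i ∈ Finset.range d, n i ≤ 0 := Finset.sum_nonpos fun i hi =>
          hpos i (Finset.mem_range.1 hi)
        rw [hzero _ _ _ _ hmem (by omega)]
  let f : AInfFunctor A.trunc B.hZero :=
    AInfFunctor.strict (A := A.trunc) (B := B.hZero) φ hmem hμ
  have hμ₁ : ∀ x, B.hZero.μ₁ x = 0 := by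
    intro x
    change B.hZeroμ 1 (fun _ => x) = 0
    rw [hZeroμ_ne_two _ (by norm_num)]; rfl
  have hcobB : ∀ u v n, B.hZero.coboundaries u v n = ⊥ := by
    intro u v n
    rw [eq_bot_iff]
    rintro _ ⟨x, -, rfl⟩
    exact hμ₁ x
  have key : ∀ u v n, (∀ a ∈ A.trunc.cocycles u v n, φ a = 0 → a ∈ A.trunc.coboundaries u v n) ∧
      ∀ b ∈ B.hZeroHom u v n, ∃ a ∈ A.trunc.cocycles u v n, b - φ a = 0 := by
    intro u v n
    by_cases hn : n = 0
    · subst hn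
      rw [trunc_coboundaries _ _ _ le_rfl, trunc_cocycles_zero, hZeroHom_zero]
      refine ⟨fun a (ha : a ∈ A.cocycles u v 0) h => ?_, ?_⟩
      · have h1 := h1 u v ⟨a, ha⟩
        change φ a = _ at h1
        rw [h] at h1
        have h2 := congrFun h1.symm (u, v)
        rw [Pi.single_eq_same] at h2
        change e u v (Submodule.Quotient.mk ⟨a, ha⟩) = 0 at h2
        rw [LinearEquiv.map_eq_zero_iff, Submodule.Quotient.mk_eq_zero] at h2
        exact h2
      · rintro _ ⟨x, rfl⟩
        obtain ⟨a, ha⟩ := Submodule.Quotient.mk_surjective _ ((e u v).symm x)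
        refine ⟨(a : A.carrier), a.2, ?_⟩
        rw [h1 u v a]
        simp only [LinearEquiv.coe_coe, ha, LinearEquiv.apply_symm_apply]
        exact sub_self _
    · refine ⟨fun a ha _ => ?_, fun b hb => ⟨(0 : A.carrier), Submodule.zero_mem _, ?_⟩⟩
      · rcases lt_or_gt_of_ne hn with h | h
        · rw [trunc_cocycles_neg _ _ _ h] at ha
          rw [trunc_coboundaries _ _ _ h.le]
          exact hA.mem_coboundaries hn ha
        · rw [trunc_cocycles_pos _ _ _ h] at ha
          rw [(Submodule.mem_bot ℂ).1 ha]; exact Submodule.zero_mem _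
      · rw [hZeroHom_ne_zero _ _ _ hn] at hb
        rw [(Submodule.mem_bot ℂ).1 hb, map_zero, sub_zero]
  refine ⟨f, fun u v n => ⟨fun a ha h => (key u v n).1 a ha ?_, fun b hb => ?_⟩⟩
  · rw [hcobB] at h
    exact (Submodule.mem_bot ℂ).1 h
  · obtain ⟨a, ha, h⟩ := (key u v n).2 b hb.1
    refine ⟨a, ha, ?_⟩
    rw [hcobB]
    exact (Submodule.mem_bot ℂ).2 h

/-- The zigzag is $A\leftarrow\tau_{\le0}A\to H^0(B)\leftarrow\tau_{\le0}B\to B$. The given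
isomorphism of cohomology categories enters only in the second arrow. -/
theorem intrinsicallyFormal_of_concentratedInDegreeZero (B : AInfCat V)
    (hB : B.ConcentratedInDegreeZero) : B.IntrinsicallyFormal := by
  intro A h
  have hA := hB.of_hIso h
  obtain ⟨e, he⟩ := h
  have hmul : ∀ {u v w : V} (a : A.cocycles u v 0) (b : A.cocycles v w 0),
      e u w 0 (Submodule.Quotient.mk (A.cocyclesMul u v w a b)) =
        B.hMul u v w (e u v 0 (Submodule.Quotient.mk a)) (e v w 0 (Submodule.Quotient.mk b)) := by
    intro u v w a b
    obtain ⟨a', ha'⟩ := Submodule.Quotient.mk_surjective _ (e u v 0 (Submodule.Quotient.mk a))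
    obtain ⟨b', hb'⟩ := Submodule.Quotient.mk_surjective _ (e v w 0 (Submodule.Quotient.mk b))
    rw [← ha', ← hb', hMul_mk]
    exact he u v w 0 0 a b a' b' ha'.symm hb'.symm
  obtain ⟨f, hf⟩ := A.trunc_quasiIso_hZero B hA (fun u v => e u v 0) hmul
  obtain ⟨g, hg⟩ := B.trunc_quasiIso_hZero B hB (fun u v => LinearEquiv.refl ℂ _)
    fun a b => rfl
  have h1 : QuasiIsomorphic A A.trunc :=
    (Relation.EqvGen.rel _ _ ⟨A.truncIncl, A.truncIncl_isQuasiIso hA⟩).symm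
  have h2 : QuasiIsomorphic A.trunc B.hZero := Relation.EqvGen.rel _ _ ⟨f, hf⟩
  have h3 : QuasiIsomorphic B.hZero B.trunc := (Relation.EqvGen.rel _ _ ⟨g, hg⟩).symm
  have h4 : QuasiIsomorphic B.trunc B :=
    Relation.EqvGen.rel _ _ ⟨B.truncIncl, B.truncIncl_isQuasiIso hB⟩
  exact ((h1.trans _ _ _ h2).trans _ _ _ h3).trans _ _ _ h4

end HZero

end AInfCat

end

/-! ### Projection to homogeneous components -/

noncomputable section

open MvPolynomial

section Projection

variable {L : Type} [AddCommGroup L] {δ : Fin 2 → L} {c : L}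

/-- All monomials of `d` have weight `a`, and cancellation in the group $L$ shows that a product
monomial has weight `a + b` exactly when its other factor has weight `b`. -/
theorem weightedHomogeneousComponent_mul_left {a b : L} {d : PolyS}
    (hd : IsWeightedHomogeneous δ d a) (f : PolyS) :
    weightedHomogeneousComponent δ (a + b) (d * f) = d * weightedHomogeneousComponent δ b f := by
  classical
  ext e
  rw [coeff_weightedHomogeneousComponent, coeff_mul, coeff_mul]
  have key : ∀ x ∈ Finset.HasAntidiagonal.antidiagonal e,
      coeff x.1 d * coeff x.2 (weightedHomogeneousComponent δ b f) =
        if Finsupp.weight δ e = a + b then coeff x.1 d * coeff x.2 f else 0 := by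
    intro x hx
    rw [Finset.HasAntidiagonal.mem_antidiagonal] at hx
    rw [coeff_weightedHomogeneousComponent]
    by_cases h0 : coeff x.1 d = 0
    · simp [h0]
    · have h1 := hd h0
      have h2 : Finsupp.weight δ e = a + Finsupp.weight δ x.2 := by rw [← hx, map_add, h1]
      rw [h2, mul_ite, mul_zero]
      simp only [add_right_inj]
  rw [Finset.sum_congr rfl key]
  split_ifs <;> simp

variable (δ c) in
/-- The projection of `S` to `shiftHom δ c α k β l n`. -/
def shiftProj (α : L) (k : ℤ) (β : L) (l : ℤ) (n : ℤ) : PolyS →ₗ[ℂ] PolyS :=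
  if Even (k + n - l) then weightedHomogeneousComponent δ (β + ((k + n - l) / 2) • c - α) else 0

theorem shiftProj_even {α β : L} {k l n m : ℤ} (hm : l + 2 * m = k + n) (f : PolyS) :
    shiftProj δ c α k β l n f = weightedHomogeneousComponent δ (β + m • c - α) f := by
  have h : k + n - l = 2 * m := by omega
  rw [shiftProj, if_pos ⟨m, by omega⟩, h, Int.mul_ediv_cancel_left _ (by norm_num)]

theorem shiftProj_odd {α β : L} {k l n : ℤ} (h : ¬ Even (k + n - l)) (f : PolyS) :
    shiftProj δ c α k β l n f = 0 := by
  rw [shiftProj, if_neg h]; rfl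

theorem shiftProj_mem (α : L) (k : ℤ) (β : L) (l : ℤ) (n : ℤ) (f : PolyS) :
    shiftProj δ c α k β l n f ∈ shiftHom δ c α k β l n := by
  refine ⟨fun m hm => ?_, fun h => shiftProj_odd h f⟩
  rw [shiftProj_even hm]
  exact weightedHomogeneousComponent_isWeightedHomogeneous _ _

theorem shiftProj_of_mem {α β : L} {k l n : ℤ} {f : PolyS} (hf : f ∈ shiftHom δ c α k β l n) :
    shiftProj δ c α k β l n f = f := by
  by_cases h : Even (k + n - l)
  · obtain ⟨m, hm⟩ := h
    have hm' : l + 2 * m = k + n := by omega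
    rw [shiftProj_even hm', (hf.1 m hm').weightedHomogeneousComponent_same]
  · rw [hf.2 h, map_zero]

theorem mul_shiftProj {α β γ : L} {k l j n m : ℤ} {d : PolyS}
    (hd : d ∈ shiftHom δ c β l γ j m) (f : PolyS) :
    d * shiftProj δ c α k β l n f = shiftProj δ c α k γ j (n + m) (d * f) := by
  by_cases h2 : Even (l + m - j)
  · obtain ⟨i, hi⟩ := h2
    have hi' : j + 2 * i = l + m := by omega
    by_cases h1 : Even (k + n - l)
    · obtain ⟨i', hi1⟩ := h1
      rw [shiftProj_even (m := i') (by omega), shiftProj_even (m := i + i') (by omega),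
        ← weightedHomogeneousComponent_mul_left (hd.1 i hi')]
      congr 2
      rw [add_smul]; abel
    · rw [shiftProj_odd h1, mul_zero, shiftProj_odd]
      rw [Int.even_iff] at *; omega
  · rw [hd.2 h2, zero_mul, zero_mul, map_zero]

theorem shiftProj_mul {α β γ : L} {k l j n m : ℤ} {d : PolyS}
    (hd : d ∈ shiftHom δ c α k β l m) (f : PolyS) :
    shiftProj δ c β l γ j n f * d = shiftProj δ c α k γ j (n + m) (f * d) := by
  by_cases h2 : Even (k + m - l)
  · obtain ⟨i, hi⟩ := h2
    have hi' : l + 2 * i = k + m := by omega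
    by_cases h1 : Even (l + n - j)
    · obtain ⟨i', hi1⟩ := h1
      rw [shiftProj_even (m := i') (by omega), shiftProj_even (m := i + i') (by omega), mul_comm,
        ← weightedHomogeneousComponent_mul_left (hd.1 i hi'), mul_comm]
      congr 2
      rw [add_smul]; abel
    · rw [shiftProj_odd h1, zero_mul, shiftProj_odd]
      rw [Int.even_iff] at *; omega
  · rw [hd.2 h2, mul_zero, mul_zero, map_zero]

end Projection

namespace MatFac

variable {L : Type} [AddCommGroup L] {δ : Fin 2 → L} {c : L} {W : PolyS}

/-- The projection of the space of all matrices to `Hom^n(K, M)`. -/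
def homProj (K M : MatFac δ c W) (n : ℤ) (f : Matrix M.ι K.ι PolyS) : Matrix M.ι K.ι PolyS :=
  Matrix.of fun t s => shiftProj δ c (K.wt s) (K.deg s) (M.wt t) (M.deg t) n (f t s)

theorem homProj_apply (K M : MatFac δ c W) (n : ℤ) (f : Matrix M.ι K.ι PolyS) (t : M.ι) (s : K.ι) :
    homProj K M n f t s = shiftProj δ c (K.wt s) (K.deg s) (M.wt t) (M.deg t) n (f t s) := rfl

theorem homProj_mem (K M : MatFac δ c W) (n : ℤ) (f : Matrix M.ι K.ι PolyS) :
    homProj K M n f ∈ hom K M n := fun _ _ => shiftProj_mem _ _ _ _ _ _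

theorem homProj_of_mem {K M : MatFac δ c W} {n : ℤ} {f : Matrix M.ι K.ι PolyS}
    (hf : f ∈ hom K M n) : homProj K M n f = f := by
  ext1 t s
  exact shiftProj_of_mem (hf t s)

theorem d_mul_homProj (K M : MatFac δ c W) (n : ℤ) (f : Matrix M.ι K.ι PolyS) :
    M.d * homProj K M n f = homProj K M (n + 1) (M.d * f) := by
  ext1 t s
  simp only [homProj, Matrix.mul_apply, Matrix.of_apply, map_sum]
  exact Finset.sum_congr rfl fun i _ => mul_shiftProj (M.d_mem t i) _

theorem homProj_mul_d (K M : MatFac δ c W) (n : ℤ) (f : Matrix M.ι K.ι PolyS) :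
    homProj K M n f * K.d = homProj K M (n + 1) (f * K.d) := by
  ext1 t s
  simp only [homProj, Matrix.mul_apply, Matrix.of_apply, map_sum]
  exact Finset.sum_congr rfl fun i _ => shiftProj_mul (K.d_mem i s) _

theorem homProj_add_smul (K M : MatFac δ c W) (n : ℤ) (ε : ℂ) (f g : Matrix M.ι K.ι PolyS) :
    homProj K M n (f + ε • g) = homProj K M n f + ε • homProj K M n g := by
  ext1 t s
  simp [homProj]

/-- A homotopy can be replaced by a homogeneous one. -/
theorem exists_homotopy_mem {K M : MatFac δ c W} {n : ℤ} {f h : Matrix M.ι K.ι PolyS} {ε : ℂ}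
    (hf : f ∈ hom K M n) (e : M.d * h + ε • (h * K.d) = f) :
    ∃ h' ∈ hom K M (n - 1), M.d * h' + ε • (h' * K.d) = f := by
  -- The projection commutes with both differentials up to the shift of degree, so the projected
  -- homotopy bounds the projection of `f`, which is `f` itself. Homotopies may therefore be sought
  -- among all polynomial matrices.
  refine ⟨homProj K M (n - 1) h, homProj_mem _ _ _ _, ?_⟩
  rw [d_mul_homProj, homProj_mul_d, ← homProj_add_smul, e, sub_add_cancel, homProj_of_mem hf]

/-- The counterpart of `exists_homotopy_mem` for existence: a lift constructed without regard to the
grading stays closed after projection. -/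
theorem homProj_closed {K M : MatFac δ c W} {f : Matrix M.ι K.ι PolyS} {ε : ℂ}
    (e : M.d * f = ε • (f * K.d)) (n : ℤ) :
    M.d * homProj K M n f = ε • (homProj K M n f * K.d) := by
  rw [d_mul_homProj, homProj_mul_d, e]
  have := homProj_add_smul K M (n + 1) ε 0 (f * K.d)
  rw [zero_add] at this
  rw [this, homProj_of_mem (Submodule.zero_mem _), zero_add]

end MatFac
end

/-! ### Staircase ideals: syzygies, homotopies and lifts -/

noncomputable section

open MvPolynomial Matrix

theorem X_pow_mul_X_pow_dvd {a b : ℕ} {F : PolyS} (h0 : (X 0 : PolyS) ^ a ∣ F)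
    (h1 : (X 1 : PolyS) ^ b ∣ F) : (X 0 : PolyS) ^ a * X 1 ^ b ∣ F := by
  obtain ⟨k, rfl⟩ := h1
  have hX : Prime (X 0 : PolyS) := X_prime
  have h2 := hX.pow_dvd_of_dvd_mul_left a (fun h => by
    have := hX.dvd_of_dvd_pow h
    rw [X_dvd_X] at this
    exact absurd this (by decide)) h0
  rw [mul_comm]
  exact mul_dvd_mul_left _ h2

theorem X_pow_add_X_pow_ne_zero {p q : ℕ} :
    (X 0 : PolyS) ^ p + X 1 ^ q ≠ 0 := by
  intro h
  have h1 := congrArg (eval (![2, 1] : Fin 2 → ℂ)) h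
  simp at h1
  have h2 : ((2 : ℂ) ^ p + 1) = ((2 ^ p + 1 : ℕ) : ℂ) := by push_cast; ring
  rw [h2, Nat.cast_eq_zero] at h1
  exact Nat.succ_ne_zero _ h1

namespace Staircase

variable {p q : ℕ} (σ : Staircase p q)

/-- The generators of the ideal of a staircase. -/
def gen (s : ℕ) : PolyS := X 0 ^ σ.e s * X 1 ^ σ.f s

/-- The ideal of a staircase. -/
def ideal : Ideal PolyS := Ideal.span (Set.range fun s : Fin (σ.m + 1) => σ.gen s)

theorem mem_ideal_iff {F : PolyS} :
    F ∈ σ.ideal ↔ ∃ c : Fin (σ.m + 1) → PolyS, ∑ s : Fin (σ.m + 1), σ.gen s * c s = F := by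
  rw [ideal, Ideal.mem_span_range_iff_exists_fun]
  simp only [mul_comm]

theorem gen_ne_zero (s : ℕ) : σ.gen s ≠ 0 :=
  mul_ne_zero (pow_ne_zero _ (X_ne_zero _)) (pow_ne_zero _ (X_ne_zero _))

theorem e_antitone {s t : ℕ} (hst : s ≤ t) (ht : t ≤ σ.m) : σ.e t ≤ σ.e s := by
  induction t, hst using Nat.le_induction with
  | base => exact le_rfl
  | succ t _ ih => exact (σ.e_succ_le t (by omega)).trans (ih (by omega))

theorem f_monotone {s t : ℕ} (hst : s ≤ t) (ht : t ≤ σ.m) : σ.f s ≤ σ.f t := by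
  induction t, hst using Nat.le_induction with
  | base => exact le_rfl
  | succ t _ ih => exact (ih (by omega)).trans (σ.f_le_succ t (by omega))

theorem gen_mul_pow {t : ℕ} (ht : t < σ.m) :
    σ.gen t * X 1 ^ (σ.f (t + 1) - σ.f t) = X 0 ^ σ.e t * X 1 ^ σ.f (t + 1) := by
  rw [gen, mul_assoc, ← pow_add, Nat.add_sub_cancel' (σ.f_le_succ t ht)]

theorem gen_succ_mul_pow {t : ℕ} (ht : t < σ.m) :
    σ.gen (t + 1) * X 0 ^ (σ.e t - σ.e (t + 1)) = X 0 ^ σ.e t * X 1 ^ σ.f (t + 1) := by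
  rw [gen, mul_right_comm, ← pow_add, Nat.add_sub_cancel' (σ.e_succ_le t ht)]

theorem gen_vecMul_d₀ (t : Fin (σ.m + 1)) :
    ∑ s : Fin (σ.m + 1), σ.gen s * σ.d₀ s t =
      if t = Fin.last σ.m then X 0 ^ p + X 1 ^ q else 0 := by
  by_cases h : t = Fin.last σ.m
  · subst h
    have h1 : ∀ s : Fin (σ.m + 1), σ.gen s * σ.d₀ s (Fin.last σ.m) =
        (if s = 0 then σ.gen 0 * X 0 ^ (p - σ.e 0) else 0) +
          if s = Fin.last σ.m then σ.gen σ.m * X 1 ^ (q - σ.f σ.m) else 0 := by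
      intro s
      have e1 : (s : ℕ) = 0 ↔ s = 0 := Fin.val_eq_zero_iff
      have e2 : (s : ℕ) = σ.m ↔ s = Fin.last σ.m := by rw [Fin.ext_iff, Fin.val_last]
      simp only [d₀, Matrix.of_apply, Fin.val_last, if_true, mul_add, mul_ite, mul_zero]
      congr 1
      · split_ifs with h1 h2 h2
        · rw [h1]
        · exact absurd (e1.1 h1) h2
        · exact absurd (e1.2 h2) h1
        · rfl
      · split_ifs with h1 h2 h2
        · rw [h1]
        · exact absurd (e2.1 h1) h2
        · exact absurd (e2.2 h2) h1
        · rfl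
    rw [Finset.sum_congr rfl fun s _ => h1 s, Finset.sum_add_distrib, Finset.sum_ite_eq',
      Finset.sum_ite_eq', if_pos (Finset.mem_univ _), if_pos (Finset.mem_univ _), if_pos rfl,
      gen, gen, σ.f_zero, σ.e_last, pow_zero, pow_zero, mul_one, one_mul, ← pow_add, ← pow_add,
      Nat.add_sub_cancel' σ.e_zero_le, Nat.add_sub_cancel' σ.f_last_le]
  · have ht : (t : ℕ) < σ.m := lt_of_le_of_ne (Nat.lt_succ_iff.1 t.2) fun h' => h (Fin.ext h')
    have h1 : ∀ s : Fin (σ.m + 1), σ.gen s * σ.d₀ s t =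
        (if s = t then X 0 ^ σ.e t * X 1 ^ σ.f (t + 1) else 0) -
          if s = ⟨t + 1, by omega⟩ then X 0 ^ σ.e t * X 1 ^ σ.f (t + 1) else 0 := by
      intro s
      simp only [d₀, Matrix.of_apply, if_neg ht.ne, Fin.ext_iff]
      split_ifs with h1 h2 h2
      · omega
      · rw [h1, gen_mul_pow σ ht, sub_zero]
      · rw [h2, mul_neg, gen_succ_mul_pow σ ht, zero_sub]
      · simp
    rw [Finset.sum_congr rfl fun s _ => h1 s, Finset.sum_sub_distrib, Finset.sum_ite_eq',
      Finset.sum_ite_eq', if_pos (Finset.mem_univ _), if_pos (Finset.mem_univ _), if_neg h, sub_self]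

/-- The row of generators times `d₀` is $W$ times the last unit row. Multiplying by the adjugate on
the right and cancelling $W$ gives the claim. It identifies the row of the differential at the
module generator with the generators of the ideal. -/
theorem adjugate_d₀_last (s : Fin (σ.m + 1)) :
    σ.d₀.adjugate (Fin.last σ.m) s = σ.gen s := by
  have h1 : ∀ t, ((fun s : Fin (σ.m + 1) => σ.gen s) ᵥ* σ.d₀) t =
      if t = Fin.last σ.m then X 0 ^ p + X 1 ^ q else 0 := σ.gen_vecMul_d₀
  have h2 := congrFun (Matrix.vecMul_vecMul (fun s : Fin (σ.m + 1) => σ.gen s) σ.d₀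
    σ.d₀.adjugate) s
  rw [Matrix.mul_adjugate, σ.det_d₀, Matrix.vecMul_smul, Matrix.vecMul_one] at h2
  refine mul_left_cancel₀ (X_pow_add_X_pow_ne_zero (p := p) (q := q)) (Eq.trans ?_ h2)
  rw [Matrix.vecMul, dotProduct, Finset.sum_eq_single (Fin.last σ.m)]
  · rw [h1, if_pos rfl]
  · intro t _ ht
    rw [h1, if_neg ht, zero_mul]
  · intro h; exact absurd (Finset.mem_univ _) h

theorem d₀_mulVec (h : ℕ → PolyS) (hlast : h σ.m = 0) (s : Fin (σ.m + 1)) :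
    ∑ t : Fin (σ.m + 1), σ.d₀ s t * h t =
      (if (s : ℕ) < σ.m then X 1 ^ (σ.f (s + 1) - σ.f s) * h s else 0) -
        if 0 < (s : ℕ) then X 0 ^ (σ.e (s - 1) - σ.e s) * h (s - 1) else 0 := by
  rw [Fin.sum_univ_castSucc, Fin.val_last, hlast, mul_zero, add_zero]
  obtain ⟨F, hF⟩ : ∃ F : ℕ → PolyS, ∀ t, F t =
      (if (s : ℕ) = t then X 1 ^ (σ.f (s + 1) - σ.f s) * h s else 0) -
        if t + 1 = (s : ℕ) then X 0 ^ (σ.e (s - 1) - σ.e s) * h (s - 1) else 0 :=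
    ⟨_, fun _ => rfl⟩
  have h1 : ∀ t : Fin σ.m, σ.d₀ s t.castSucc * h t.castSucc = F t := by
    intro t
    rw [hF]
    simp only [d₀, Matrix.of_apply, Fin.val_castSucc, if_neg t.2.ne]
    split_ifs with h1 h2 h2 h3 h4
    · omega
    · rw [h1, sub_zero]
    · rw [h2, Nat.add_sub_cancel]; ring
    · omega
    · omega
    · simp
  rw [Finset.sum_congr rfl fun t _ => h1 t, Fin.sum_univ_eq_sum_range F,
    Finset.sum_congr rfl fun t _ => hF t, Finset.sum_sub_distrib, Finset.sum_ite_eq]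
  congr 1
  · simp only [Finset.mem_range]
  · split_ifs with h2
    · rw [Finset.sum_eq_single ((s : ℕ) - 1)]
      · rw [if_pos (by omega)]
      · intro t _ ht; rw [if_neg (by omega)]
      · intro h; rw [Finset.mem_range] at h; omega
    · exact Finset.sum_eq_zero fun t _ => if_neg (by omega)

/-- The syzygies over `S` of the generators of a staircase. -/
theorem exists_syzygy (z : Fin (σ.m + 1) → PolyS)
    (hz : ∑ s : Fin (σ.m + 1), σ.gen s * z s = 0) :
    ∃ h : Fin (σ.m + 1) → PolyS, h (Fin.last σ.m) = 0 ∧ σ.d₀ *ᵥ h = z := by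
  let z' : ℕ → PolyS := fun s => if h : s < σ.m + 1 then z ⟨s, h⟩ else 0
  have hz' : ∀ s : Fin (σ.m + 1), z s = z' s := fun s => by simp only [z', dif_pos s.2]
  have hsum : ∑ s ∈ Finset.range (σ.m + 1), σ.gen s * z' s = 0 := by
    rw [← Fin.sum_univ_eq_sum_range (fun s => σ.gen s * z' s), ← hz]
    exact Finset.sum_congr rfl fun s _ => by rw [hz']
  have hex : ∀ t, ∃ h : PolyS, t < σ.m →
      ∑ s ∈ Finset.range (t + 1), σ.gen s * z' s = X 0 ^ σ.e t * X 1 ^ σ.f (t + 1) * h := by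
    intro t
    by_cases ht : t < σ.m
    -- The partial sum up to `t` is divisible by $x^{e_t}$ term by term and, being minus the
    -- remaining tail, also by $y^{f_{t+1}}$. The quotient is the coefficient of the syzygy between
    -- the neighbours `t` and `t + 1`.
    · obtain ⟨h, hh⟩ : X 0 ^ σ.e t * X 1 ^ σ.f (t + 1) ∣
          ∑ s ∈ Finset.range (t + 1), σ.gen s * z' s := by
        refine X_pow_mul_X_pow_dvd ?_ ?_
        · refine Finset.dvd_sum fun s hs => ?_
          rw [Finset.mem_range] at hs
          exact ((pow_dvd_pow _ (σ.e_antitone (by omega) ht.le)).mul_right _).mul_right _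
        · rw [← Finset.sum_range_add_sum_Ico _ (show t + 1 ≤ σ.m + 1 by omega)] at hsum
          rw [eq_neg_of_add_eq_zero_left hsum, dvd_neg]
          refine Finset.dvd_sum fun s hs => ?_
          rw [Finset.mem_Ico] at hs
          exact ((pow_dvd_pow _ (σ.f_monotone hs.1 (by omega))).mul_left _).mul_right _
      exact ⟨h, fun _ => hh⟩
    · exact ⟨0, fun h => absurd h ht⟩
  choose h₀ hh using hex
  let h : ℕ → PolyS := fun t => if t < σ.m then h₀ t else 0
  have hlast : h σ.m = 0 := if_neg (lt_irrefl _)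
  have hlt : ∀ t < σ.m, ∑ s ∈ Finset.range (t + 1), σ.gen s * z' s =
      X 0 ^ σ.e t * X 1 ^ σ.f (t + 1) * h t := by
    intro t ht
    rw [hh t ht]; simp only [h, if_pos ht]
  refine ⟨fun t => h t, hlast, ?_⟩
  funext s
  refine mul_left_cancel₀ (σ.gen_ne_zero s) ?_
  change σ.gen s * ∑ t : Fin (σ.m + 1), σ.d₀ s t * h t = σ.gen s * z s
  -- Multiplied by the generator `s`, the two terms of $(d_0h)_s$ become consecutive partial sums,
  -- and their difference is the summand of index `s`.
  rw [d₀_mulVec σ h hlast, mul_sub, hz']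
  have hs := s.2
  have e1 : σ.gen s * (if (s : ℕ) < σ.m then X 1 ^ (σ.f (s + 1) - σ.f s) * h s else 0) =
      ∑ t ∈ Finset.range (s + 1), σ.gen t * z' t := by
    split_ifs with h1
    · rw [hlt s h1, ← mul_assoc, gen_mul_pow σ h1]
    · have : (s : ℕ) = σ.m := by omega
      rw [this, hsum, mul_zero]
  have e2 : σ.gen s * (if 0 < (s : ℕ) then X 0 ^ (σ.e (s - 1) - σ.e s) * h (s - 1) else 0) =
      ∑ t ∈ Finset.range s, σ.gen t * z' t := by
    split_ifs with h1
    · obtain ⟨t, ht⟩ := Nat.exists_eq_add_of_le' h1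
      rw [ht, Nat.add_sub_cancel, hlt t (by omega), ← mul_assoc, gen_succ_mul_pow σ (by omega)]
    · have : (s : ℕ) = 0 := by omega
      rw [this]; simp
  rw [e1, e2, Finset.sum_range_succ, add_sub_cancel_left]

theorem d₀_mul_injective {κ : Type} {A B : Matrix (Fin (σ.m + 1)) κ PolyS}
    (h : σ.d₀ * A = σ.d₀ * B) : A = B := by
  have h1 := congrArg (fun M => σ.d₀.adjugate * M) h
  simp only [← Matrix.mul_assoc, Matrix.adjugate_mul, σ.det_d₀, Matrix.smul_mul,
    Matrix.one_mul] at h1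
  ext1 i j
  exact mul_left_cancel₀ (X_pow_add_X_pow_ne_zero (p := p) (q := q))
    (congrFun (congrFun h1 i) j)

/-- The differential of the matrix factorisation of a staircase. -/
abbrev diff : Matrix (Fin (σ.m + 1) ⊕ Fin (σ.m + 1)) (Fin (σ.m + 1) ⊕ Fin (σ.m + 1)) PolyS :=
  Matrix.fromBlocks 0 σ.d₀ σ.d₀.adjugate 0

theorem diff_mul_fromRows {κ : Type} (f₁ f₂ : Matrix (Fin (σ.m + 1)) κ PolyS) :
    σ.diff * Matrix.fromRows f₁ f₂ = Matrix.fromRows (σ.d₀ * f₂) (σ.d₀.adjugate * f₁) := by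
  rw [diff, Matrix.fromBlocks_mul_fromRows]; simp

theorem diff_sq : σ.diff * σ.diff = (X 0 ^ p + X 1 ^ q : PolyS) • 1 := by
  rw [diff, Matrix.fromBlocks_multiply]
  simp [Matrix.mul_adjugate, Matrix.adjugate_mul, σ.det_d₀, ← Matrix.fromBlocks_one,
    Matrix.fromBlocks_smul]

variable {κ : Type} [Fintype κ]

/-- When the row at the module generator vanishes, closedness says that the columns of the upper
block `f₁` are syzygies, so `f₁ = d₀ * h₂`. The block `h₂` is the homotopy: that it also accounts
for the lower block follows after applying the injective `d₀`. -/
theorem exists_homotopy_of_last_eq_zero {dK : Matrix κ κ PolyS} {ε : ℂ}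
    {f : Matrix (Fin (σ.m + 1) ⊕ Fin (σ.m + 1)) κ PolyS}
    (hf : σ.diff * f = ε • (f * dK)) (h0 : ∀ s, f (Sum.inr (Fin.last σ.m)) s = 0) :
    ∃ h : Matrix (Fin (σ.m + 1) ⊕ Fin (σ.m + 1)) κ PolyS, σ.diff * h + ε • (h * dK) = f := by
  obtain ⟨f₁, f₂, rfl⟩ : ∃ f₁ f₂, f = Matrix.fromRows f₁ f₂ :=
    ⟨f.toRows₁, f.toRows₂, (Matrix.fromRows_toRows f).symm⟩
  rw [diff_mul_fromRows, Matrix.fromRows_mul] at hf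
  have hf1 : σ.d₀ * f₂ = ε • (f₁ * dK) := by
    ext1 i j; exact congrFun (congrFun hf (Sum.inl i)) j
  have hf2 : σ.d₀.adjugate * f₁ = ε • (f₂ * dK) := by
    ext1 i j; exact congrFun (congrFun hf (Sum.inr i)) j
  have h0' : ∀ s, f₂ (Fin.last σ.m) s = 0 := h0
  have h1 : ∀ s, ∑ t : Fin (σ.m + 1), σ.gen t * f₁ t s = 0 := by
    intro s
    have := congrFun (congrFun hf2 (Fin.last σ.m)) s
    simpa [Matrix.mul_apply, h0', σ.adjugate_d₀_last] using this
  choose h hl hh using fun s => σ.exists_syzygy (fun t => f₁ t s) (h1 s)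
  let h₂ : Matrix (Fin (σ.m + 1)) κ PolyS := Matrix.of fun t s => h s t
  have e1 : σ.d₀ * h₂ = f₁ := by
    ext1 t s; exact congrFun (hh s) t
  refine ⟨Matrix.fromRows 0 h₂, ?_⟩
  have e2 : ε • (h₂ * dK) = f₂ := by
    refine σ.d₀_mul_injective ?_
    rw [hf1, Matrix.mul_smul, ← Matrix.mul_assoc, e1]
  rw [diff_mul_fromRows, Matrix.fromRows_mul, e1]
  ext1 i j
  rcases i with i | i
  · simp
  · simpa using congrFun (congrFun e2 i) j

variable [DecidableEq κ]

/-- A closed morphism to the matrix factorisation of a staircase is null-homotopic if its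
composition with the augmentation is zero. -/
theorem exists_homotopy {dK : Matrix κ κ PolyS} {ε : ℂ}
    (hK : dK * dK = (X 0 ^ p + X 1 ^ q : PolyS) • 1) (hε : ε * ε = 1)
    {f : Matrix (Fin (σ.m + 1) ⊕ Fin (σ.m + 1)) κ PolyS} (hf : σ.diff * f = ε • (f * dK))
    (h0 : ∀ s, f (Sum.inr (Fin.last σ.m)) s ∈ σ.ideal) :
    ∃ h : Matrix (Fin (σ.m + 1) ⊕ Fin (σ.m + 1)) κ PolyS, σ.diff * h + ε • (h * dK) = f := by
  choose c hc using fun s => σ.mem_ideal_iff.1 (h0 s)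
  -- The coboundary of `k` has the prescribed combination of generators as its row at the module
  -- generator. Subtracting it reduces to the case of a vanishing row.
  let k : Matrix (Fin (σ.m + 1) ⊕ Fin (σ.m + 1)) κ PolyS :=
    Matrix.fromRows (Matrix.of fun t s => c s t) 0
  have hk : σ.diff * (σ.diff * k + ε • (k * dK)) = ε • ((σ.diff * k + ε • (k * dK)) * dK) := by
    rw [Matrix.mul_add, Matrix.add_mul, ← Matrix.mul_assoc, diff_sq, Matrix.mul_smul, smul_add,
      Matrix.smul_mul ε, smul_smul, hε, one_smul, Matrix.mul_assoc k, hK, Matrix.mul_assoc]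
    simp [add_comm]
  obtain ⟨h, hh⟩ := σ.exists_homotopy_of_last_eq_zero (dK := dK) (ε := ε)
    (f := f - (σ.diff * k + ε • (k * dK)))
    (by rw [Matrix.mul_sub, hf, hk, Matrix.sub_mul, smul_sub])
    (by
      intro s
      rw [Matrix.sub_apply, diff_mul_fromRows, Matrix.fromRows_mul]
      simp only [Matrix.add_apply, Matrix.smul_apply, Matrix.fromRows_apply_inr, Matrix.zero_mul,
        Matrix.zero_apply, smul_zero, add_zero, Matrix.mul_apply, σ.adjugate_d₀_last,
        Matrix.of_apply]
      rw [hc, sub_self])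
  refine ⟨h + k, ?_⟩
  rw [Matrix.mul_add, Matrix.add_mul, smul_add, add_add_add_comm, hh, sub_add_cancel]

/-- A morphism to the module of a staircase lifts to a closed morphism to its matrix
factorisation. -/
theorem exists_lift {dK : Matrix κ κ PolyS} {ε : ℂ}
    (hK : dK * dK = (X 0 ^ p + X 1 ^ q : PolyS) • 1) (hε : ε * ε = 1) (φ : κ → PolyS)
    (hφ : ∀ s, (φ ᵥ* dK) s ∈ σ.ideal) :
    ∃ f : Matrix (Fin (σ.m + 1) ⊕ Fin (σ.m + 1)) κ PolyS, σ.diff * f = ε • (f * dK) ∧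
      ∀ s, f (Sum.inr (Fin.last σ.m)) s = φ s := by
  choose c hc using fun s => σ.mem_ideal_iff.1 (hφ s)
  let f₁ : Matrix (Fin (σ.m + 1)) κ PolyS := Matrix.of fun t s => ε • c s t
  have hf₁ : (fun t : Fin (σ.m + 1) => σ.gen t) ᵥ* f₁ = ε • (φ ᵥ* dK) := by
    funext s
    rw [Pi.smul_apply, ← hc, Finset.smul_sum]
    change ∑ t : Fin (σ.m + 1), σ.gen t * (ε • c s t) = _
    simp only [mul_smul_comm]
  -- `E` carries `φ` in the row of the module generator. The defect of closedness of the pair `f₁`,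
  -- `E` consists of syzygies, so it is `d₀ * h₂` with the last row of `h₂` zero; adding `h₂`
  -- repairs closedness without changing `φ`.
  let E : Matrix (Fin (σ.m + 1)) κ PolyS := Matrix.of fun t s => if t = Fin.last σ.m then φ s else 0
  have hE : (fun t : Fin (σ.m + 1) => σ.gen t) ᵥ* (σ.d₀ * E) =
      (X 0 ^ p + X 1 ^ q : PolyS) • φ := by
    rw [← Matrix.vecMul_vecMul]
    funext s
    change ∑ t, (∑ i : Fin (σ.m + 1), σ.gen i * σ.d₀ i t) * E t s = _
    simp [gen_vecMul_d₀, E]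
  have hz : ∀ s, ∑ t : Fin (σ.m + 1), σ.gen t * (ε • (f₁ * dK) - σ.d₀ * E) t s = 0 := by
    have : (fun t : Fin (σ.m + 1) => σ.gen t) ᵥ* (ε • (f₁ * dK) - σ.d₀ * E) = 0 := by
      rw [Matrix.vecMul_sub, hE, Matrix.vecMul_smul, ← Matrix.vecMul_vecMul, hf₁,
        Matrix.smul_vecMul, Matrix.vecMul_vecMul, hK, smul_smul, hε, one_smul,
        Matrix.vecMul_smul, Matrix.vecMul_one, sub_self]
    exact fun s => congrFun this s
  choose h hl hh using fun s => σ.exists_syzygy _ (hz s)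
  let h₂ : Matrix (Fin (σ.m + 1)) κ PolyS := Matrix.of fun t s => h s t
  have e1 : σ.d₀ * h₂ = ε • (f₁ * dK) - σ.d₀ * E := by
    ext1 t s; exact congrFun (hh s) t
  have e2 : σ.d₀ * (E + h₂) = ε • (f₁ * dK) := by
    rw [Matrix.mul_add, e1, add_sub_cancel]
  refine ⟨Matrix.fromRows f₁ (E + h₂), ?_, fun s => ?_⟩
  · have e3 : σ.d₀.adjugate * f₁ = ε • ((E + h₂) * dK) := by
      refine σ.d₀_mul_injective ?_
      rw [← Matrix.mul_assoc, Matrix.mul_adjugate, σ.det_d₀, Matrix.mul_smul, ← Matrix.mul_assoc,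
        e2, Matrix.smul_mul ε, smul_smul, hε, one_smul, Matrix.mul_assoc, hK]
      simp
    rw [diff_mul_fromRows, Matrix.fromRows_mul, e2, e3]
    ext1 i j
    rcases i with i | i <;> simp
  · have := hl s
    simp [E, h₂, this]

end Staircase

/-! ### Rank-one factorisations -/

section RankOne

variable {κ : Type} [Fintype κ] {w w' W : PolyS}

/-- The quotient of the first row by `w` is the homotopy. Closedness, after cancelling `w`, shows
that it also produces the second row. -/
theorem rankOne_exists_homotopy (hw : w ≠ 0) {dK : Matrix κ κ PolyS} {ε : ℂ}
    {f : Matrix (Fin 2) κ PolyS} (hf : !![0, w; w', 0] * f = ε • (f * dK))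
    (h0 : ∀ s, w ∣ f 0 s) :
    ∃ h : Matrix (Fin 2) κ PolyS, !![0, w; w', 0] * h + ε • (h * dK) = f := by
  choose c hc using fun s => h0 s
  refine ⟨Matrix.of ![0, c], ?_⟩
  have h1 : ∀ s, f 1 s = ε • ∑ i, c i * dK i s := by
    intro s
    have h2 := congrFun (congrFun hf 0) s
    simp only [Matrix.mul_apply, Fin.sum_univ_two, Matrix.smul_apply, hc] at h2
    refine mul_left_cancel₀ hw ?_
    simp only [Matrix.of_apply, Matrix.cons_val', Matrix.cons_val_zero, Matrix.cons_val_one,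
      zero_mul, zero_add, mul_assoc, ← Finset.mul_sum] at h2
    rw [mul_smul_comm, ← h2]
  ext1 i s
  fin_cases i
  · simp [hc s]
  · simp [h1 s, vecMul, dotProduct]

/-- A row `φ` compatible with the differential modulo `w` determines the second row as `ε` times the
quotient of `φ ᵥ* dK` by `w`; the other equation follows from `dK * dK = W • 1` by cancelling `w`.
-/
theorem rankOne_exists_lift [DecidableEq κ] (hw : w ≠ 0) (hW : w * w' = W)
    {dK : Matrix κ κ PolyS} {ε : ℂ} (hK : dK * dK = W • 1) (hε : ε * ε = 1) (φ : κ → PolyS)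
    (hφ : ∀ s, w ∣ (φ ᵥ* dK) s) :
    ∃ f : Matrix (Fin 2) κ PolyS, !![0, w; w', 0] * f = ε • (f * dK) ∧ ∀ s, f 0 s = φ s := by
  choose c hc using hφ
  have hc' : φ ᵥ* dK = w • c := funext hc
  have h1 : ε • ((ε • c) ᵥ* dK) = w' • φ := by
    rw [Matrix.smul_vecMul, smul_smul, hε, one_smul]
    have h2 : w • (c ᵥ* dK) = w • (w' • φ) := by
      rw [← Matrix.smul_vecMul, ← hc', Matrix.vecMul_vecMul, hK, Matrix.vecMul_smul,
        Matrix.vecMul_one, smul_smul, hW]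
    funext s
    exact mul_left_cancel₀ hw (congrFun h2 s)
  refine ⟨Matrix.of ![φ, ε • c], ?_, fun s => rfl⟩
  ext1 i s
  fin_cases i
  · simp [hc s]
  · simpa using (congrFun h1 s).symm

end RankOne

end

/-! ### The grading group, vertices and boundary degrees -/

noncomputable section

open MvPolynomial Matrix

namespace BPData

variable (D : BPData)

theorem P_pos : 0 < D.P := Nat.pos_of_ne_zero fun h => by
  have := D.p_pos; rw [p_eq, h] at this; simp at this

theorem Q_pos : 0 < D.Q := Nat.pos_of_ne_zero fun h => by
  have := D.q_pos; rw [q_eq, h] at this; simp at this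

/-- The class of `a x + b y` in the grading group. -/
def cls (a b : ℤ) : D.L := QuotientAddGroup.mk (a, b)

theorem cls_add (a b a' b' : ℤ) : D.cls a b + D.cls a' b' = D.cls (a + a') (b + b') := rfl

theorem cls_sub (a b a' b' : ℤ) : D.cls a b - D.cls a' b' = D.cls (a - a') (b - b') := rfl

theorem cls_zero : D.cls 0 0 = 0 := rfl

theorem cls_eq_iff {a b a' b' : ℤ} :
    D.cls a b = D.cls a' b' ↔ ∃ k : ℤ, a' = a + k * D.P ∧ b' = b - k * D.Q := by
  rw [cls, cls, QuotientAddGroup.eq, AddSubgroup.mem_zmultiples_iff]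
  refine exists_congr fun k => ?_
  simp only [Prod.ext_iff, Prod.smul_mk, smul_eq_mul, Prod.fst_add, Prod.snd_add, Prod.fst_neg,
    Prod.snd_neg]
  constructor
  · rintro ⟨h1, h2⟩
    exact ⟨by linarith, by linarith⟩
  · rintro ⟨h1, h2⟩
    exact ⟨by linarith, by linarith⟩

theorem nsmul_deg_zero (n : ℕ) : n • D.deg 0 = D.cls n 0 := by
  change ((n • ((1, 0) : ℤ × ℤ) : ℤ × ℤ) : D.L) = _
  simp [cls]

theorem nsmul_deg_one (n : ℕ) : n • D.deg 1 = D.cls 0 n := by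
  change ((n • ((0, 1) : ℤ × ℤ) : ℤ × ℤ) : D.L) = _
  simp [cls]

theorem zsmul_c (m : ℤ) : m • D.c = D.cls 0 (m * D.q) := by
  rw [← D.c_eq, nsmul_deg_one]
  change ((m • ((0, (D.q : ℤ)) : ℤ × ℤ) : ℤ × ℤ) : D.L) = _
  simp [cls]

theorem c_eq_cls : D.c = D.cls 0 D.q := by
  have := D.zsmul_c 1
  rwa [one_smul, one_mul] at this

theorem weight_eq (d : Fin 2 →₀ ℕ) : Finsupp.weight D.deg d = D.cls (d 0) (d 1) := by
  rw [Finsupp.weight_apply, Finsupp.sum_fintype _ _ (fun i => zero_smul ℕ (D.deg i)),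
    Fin.sum_univ_two, nsmul_deg_zero, nsmul_deg_one, cls_add, add_zero, zero_add]

theorem intCast_p : (D.p : ℤ) = D.ℓ * D.P := by exact_mod_cast D.p_eq

theorem intCast_q : (D.q : ℤ) = D.ℓ * D.Q := by exact_mod_cast D.q_eq

/-- If `a x + b y` is effective, then `b` is not too small. -/
theorem le_of_cls_eq {a b : ℤ} {n m : ℕ} (h : D.cls a b = D.cls n m) {t : ℤ}
    (ha : a < t * D.P) : (1 - t) * D.Q ≤ b := by
  obtain ⟨k, h1, h2⟩ := D.cls_eq_iff.1 h
  have hP : (0 : ℤ) < D.P := by exact_mod_cast D.P_pos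
  have hQ : (0 : ℤ) < D.Q := by exact_mod_cast D.Q_pos
  -- Representatives of one class differ by multiples of $(P,-Q)$. Making the first coordinate
  -- nonnegative takes at least $1-t$ steps, each of which costs $Q$ in the second coordinate.
  have hk : 1 - t ≤ k := by
    by_contra hk
    have h3 : k ≤ -t := by omega
    have h4 : k * (D.P : ℤ) ≤ -t * D.P := mul_le_mul_of_nonneg_right h3 hP.le
    have h5 : (0 : ℤ) ≤ n := Int.natCast_nonneg n
    linarith
  have h3 : (1 - t) * (D.Q : ℤ) ≤ k * D.Q := mul_le_mul_of_nonneg_right hk hQ.le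
  have h4 : (0 : ℤ) ≤ m := Int.natCast_nonneg m
  linarith

/-- In integer form the two boxes become one window of $P$ consecutive values of $i$, with an
additional lower bound for $j$ in its first column. This is the form in which classes in $L$ can be
compared. -/
theorem mem_V₀_iff {v : ℕ × ℕ} : v ∈ D.V₀ ↔ ((D.ℓ : ℤ) - 1) * D.P ≤ v.1 ∧ (v.1 : ℤ) < D.ℓ * D.P ∧
    1 ≤ v.2 ∧ v.2 < D.q ∧ ((v.1 : ℤ) = (D.ℓ - 1) * D.P → D.Q + 1 ≤ v.2) := by
  have hP := D.P_pos
  have hℓ := D.one_lt_ℓ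
  have hp := D.intCast_p
  have h1 : (((D.ℓ - 1) * D.P : ℕ) : ℤ) = ((D.ℓ : ℤ) - 1) * D.P := by
    rw [Nat.cast_mul, Nat.cast_sub hℓ.le, Nat.cast_one]
  have h2 : ((D.ℓ : ℤ) - 1) * D.P + D.P = D.p := by rw [hp]; ring
  rw [← hp, ← h1]
  rw [← h1] at h2
  obtain ⟨i, j⟩ := v
  simp only [V₀, Finset.mem_union, Finset.mem_product, Finset.mem_Icc, Finset.mem_singleton]
  generalize (D.ℓ - 1) * D.P = R at *
  have hQ := D.Q_pos
  norm_cast at *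
  omega

/-- The degree of a vertex. -/
def pos (v : ℕ × ℕ) : D.L := D.cls v.1 v.2

theorem nsmul_add_nsmul (v : ℕ × ℕ) : v.1 • D.deg 0 + v.2 • D.deg 1 = D.pos v := by
  rw [nsmul_deg_zero, nsmul_deg_one, cls_add, add_zero, zero_add, pos]

/-- The window has length $P$, whereas different representatives of a class have first coordinates
at least $P$ apart. -/
theorem eq_of_cls_eq {a b a' b' : ℤ} (h : D.cls a b = D.cls a' b')
    (h1 : ((D.ℓ : ℤ) - 1) * D.P ≤ a) (h2 : a < D.ℓ * D.P) (h3 : ((D.ℓ : ℤ) - 1) * D.P ≤ a')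
    (h4 : a' < D.ℓ * D.P) : a = a' ∧ b = b' := by
  obtain ⟨k, rfl, rfl⟩ := D.cls_eq_iff.1 h
  have hP : (0 : ℤ) < D.P := by exact_mod_cast D.P_pos
  have hk : k = 0 := by
    rcases lt_trichotomy k 0 with hk | hk | hk
    · have : k * (D.P : ℤ) ≤ -1 * D.P := mul_le_mul_of_nonneg_right (by omega) hP.le
      linarith
    · exact hk
    · have : 1 * (D.P : ℤ) ≤ k * D.P := mul_le_mul_of_nonneg_right (by omega) hP.le
      linarith
  subst hk
  simp

theorem pos_injOn {u v : ℕ × ℕ} (hu : ((D.ℓ : ℤ) - 1) * D.P ≤ u.1) (hu' : (u.1 : ℤ) < D.ℓ * D.P)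
    (hv : ((D.ℓ : ℤ) - 1) * D.P ≤ v.1) (hv' : (v.1 : ℤ) < D.ℓ * D.P) (h : D.pos u = D.pos v) :
    u = v := by
  obtain ⟨h1, h2⟩ := D.eq_of_cls_eq h hu hu' hv hv'
  exact Prod.ext (by exact_mod_cast h1) (by exact_mod_cast h2)

theorem pos_inj {u v : ℕ × ℕ} (hu : u ∈ D.V₀) (hv : v ∈ D.V₀) (h : D.pos u = D.pos v) : u = v := by
  rw [mem_V₀_iff] at hu hv
  exact D.pos_injOn hu.1 hu.2.1 hv.1 hv.2.1 h

/-- The degrees of the generators and syzygies of the ideals of the objects `K_0^{i,j}`; they lie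
just below the degrees of the vertices. -/
def Boundary (a : D.L) : Prop := ∃ A B : ℤ, a = D.cls A B ∧
  ((A = (D.ℓ - 1) * D.P ∧ 0 ≤ B ∧ B ≤ D.Q) ∨
    (((D.ℓ : ℤ) - 1) * D.P < A ∧ A < D.ℓ * D.P ∧ B = 0))

variable {D}

/-- Returning to the window after subtracting an effective class takes $k\ge0$ steps, so the second
coordinate can only drop. It starts at most at $Q$ in the first column and at $0$ in the others, so
it never rises to the height of a vertex. -/
theorem Boundary.sub_ne_pos {a : D.L} (ha : D.Boundary a) (n m : ℕ) {v : ℕ × ℕ} (hv : v ∈ D.V₀) :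
    a - D.cls n m ≠ D.pos v := by
  obtain ⟨A, B, rfl, hAB⟩ := ha
  intro h
  rw [cls_sub] at h
  obtain ⟨k, h1, h2⟩ := D.cls_eq_iff.1 h
  obtain ⟨h3, h4, h5, h6, h7⟩ := D.mem_V₀_iff.1 hv
  have hP : (0 : ℤ) < D.P := by exact_mod_cast D.P_pos
  have hQ : (0 : ℤ) < D.Q := by exact_mod_cast D.Q_pos
  have hk : 0 ≤ k := by
    by_contra hk
    have : k * (D.P : ℤ) ≤ -1 * D.P := mul_le_mul_of_nonneg_right (by omega) hP.le
    rcases hAB with ⟨hA, hB⟩ | ⟨hA, hA', hB⟩ <;> linarith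
  have hkQ : 0 ≤ k * (D.Q : ℤ) := mul_nonneg hk hQ.le
  rcases hAB with ⟨hA, hB, hB'⟩ | ⟨hA, hA', hB⟩
  · rcases hk.eq_or_lt with h0 | h0
    · subst h0
      have := h7 (by linarith)
      omega
    · have : 1 * (D.Q : ℤ) ≤ k * D.Q := mul_le_mul_of_nonneg_right (by omega) hQ.le
      omega
  · omega

/-- Adding multiples of $c$ moves by $q$ within a column. Modulo $q$ the heights of boundary
degrees, $0,\dots,Q$ in the first column and $0$ elsewhere, are disjoint from those of the vertices.
-/
theorem Boundary.add_ne_pos {a : D.L} (ha : D.Boundary a) (m : ℤ) {v : ℕ × ℕ} (hv : v ∈ D.V₀) :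
    a + m • D.c ≠ D.pos v := by
  obtain ⟨A, B, rfl, hAB⟩ := ha
  intro h
  rw [zsmul_c, cls_add, add_zero] at h
  obtain ⟨h3, h4, h5, h6, h7⟩ := D.mem_V₀_iff.1 hv
  have hP : (0 : ℤ) < D.P := by exact_mod_cast D.P_pos
  have hQ : (0 : ℤ) < D.Q := by exact_mod_cast D.Q_pos
  have hq := D.intCast_q
  have hℓ : (1 : ℤ) < D.ℓ := by exact_mod_cast D.one_lt_ℓ
  obtain ⟨h1, h2⟩ := D.eq_of_cls_eq h (by rcases hAB with h | h <;> linarith)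
    (by rcases hAB with h | h <;> linarith) h3 h4
  have hq0 : (D.Q : ℤ) < D.q := by rw [hq]; nlinarith
  have key : ∀ {x : ℤ}, 0 < x + m * D.q → x + m * D.q < D.q → 0 ≤ x → x < D.q → m = 0 := by
    intro x k1 k2 k3 k4
    have e1 : m < 1 := by
      by_contra hm
      have : 1 * (D.q : ℤ) ≤ m * D.q := mul_le_mul_of_nonneg_right (by omega) (by omega)
      omega
    have e2 : -1 < m := by
      by_contra hm
      have : m * (D.q : ℤ) ≤ -1 * D.q := mul_le_mul_of_nonneg_right (by omega) (by omega)
      omega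
    omega
  have hm : m = 0 := by
    rcases hAB with ⟨hA, hB, hB'⟩ | ⟨hA, hA', hB⟩
    · exact key (x := B) (by omega) (by omega) hB (by omega)
    · exact key (x := B) (by omega) (by omega) (by omega) (by omega)
  subst hm
  rw [zero_mul, add_zero] at h2
  rcases hAB with ⟨hA, hB, hB'⟩ | ⟨hA, hA', hB⟩
  · have := h7 (by linarith)
    omega
  · omega

theorem pos_add_eq_pos {u v : ℕ × ℕ} (hu : u ∈ D.V₀) (hv : v ∈ D.V₀) {m : ℤ}
    (h : D.pos u + m • D.c = D.pos v) : m = 0 := by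
  rw [zsmul_c, pos, pos, cls_add, add_zero] at h
  obtain ⟨h1, h2, h3, h4, -⟩ := D.mem_V₀_iff.1 hu
  obtain ⟨k1, k2, k3, k4, -⟩ := D.mem_V₀_iff.1 hv
  obtain ⟨-, e⟩ := D.eq_of_cls_eq h h1 h2 k1 k2
  by_contra hm
  rcases lt_or_gt_of_ne hm with hm | hm
  · have : m * (D.q : ℤ) ≤ -1 * D.q := mul_le_mul_of_nonneg_right (by omega) (by omega)
    omega
  · have : 1 * (D.q : ℤ) ≤ m * D.q := mul_le_mul_of_nonneg_right (by omega) (by omega)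
    omega

/-- Together with `Boundary.exists_cls` this determines for which $m$ the class $mc-a$ is effective,
and hence in which cohomological degrees a generator of weight $a$ can map to the base generator of
$K_{w_r}[3]$. -/
theorem Boundary.one_le {a : D.L} (ha : D.Boundary a) {m : ℤ} {n n' : ℕ}
    (h : m • D.c - a = D.cls n n') : 1 ≤ m := by
  obtain ⟨A, B, rfl, hAB⟩ := ha
  rw [zsmul_c, cls_sub, zero_sub] at h
  have hP : (0 : ℤ) < D.P := by exact_mod_cast D.P_pos
  have hQ : (0 : ℤ) < D.Q := by exact_mod_cast D.Q_pos
  have hℓ : (1 : ℤ) < D.ℓ := by exact_mod_cast D.one_lt_ℓ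
  have h1 := D.le_of_cls_eq h (t := 2 - D.ℓ)
    (by rcases hAB with h | h <;> linarith)
  have h2 : (0 : ℤ) < (1 - (2 - D.ℓ)) * D.Q := mul_pos (by omega) hQ
  by_contra hm
  have h3 : m * (D.q : ℤ) ≤ 0 := mul_nonpos_of_nonpos_of_nonneg (by omega) (by omega)
  rcases hAB with h | h <;> omega

theorem Boundary.exists_cls {a : D.L} (ha : D.Boundary a) {m : ℤ} (hm : 1 ≤ m) :
    ∃ n n' : ℕ, m • D.c - a = D.cls n n' := by
  obtain ⟨A, B, rfl, hAB⟩ := ha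
  have hP : (0 : ℤ) < D.P := by exact_mod_cast D.P_pos
  have hQ : (0 : ℤ) < D.Q := by exact_mod_cast D.Q_pos
  have hq := D.intCast_q
  have h1 : 1 * (D.q : ℤ) ≤ m * D.q := mul_le_mul_of_nonneg_right hm (by omega)
  rw [zsmul_c, cls_sub, zero_sub]
  rcases hAB with ⟨hA, hB, hB'⟩ | ⟨hA, hA', hB⟩
  · refine ⟨0, (m * D.q - B - (D.ℓ - 1) * D.Q).toNat, D.cls_eq_iff.2 ⟨D.ℓ - 1, ?_, ?_⟩⟩
    · rw [hA]; push_cast; ring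
    · rw [Int.toNat_of_nonneg]
      have : ((D.ℓ : ℤ) - 1) * D.Q = D.q - D.Q := by rw [hq]; ring
      omega
  · refine ⟨(D.ℓ * D.P - A).toNat, (m * D.q - D.q).toNat, D.cls_eq_iff.2 ⟨D.ℓ, ?_, ?_⟩⟩
    · rw [Int.toNat_of_nonneg (by omega)]; ring
    · rw [Int.toNat_of_nonneg (by omega), hB, hq]; ring

/-- The analogue of `Boundary.one_le` for the generator covering the module. In the first column the
effectivity bound is weaker by $Q$, which the condition $j>Q$ compensates. -/
theorem one_le_of_pos_sub_c {v : ℕ × ℕ} (hv : v ∈ D.V₀) {m : ℤ} {n n' : ℕ}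
    (h : m • D.c - (D.pos v - D.c) = D.cls n n') : 1 ≤ m := by
  have hP : (0 : ℤ) < D.P := by exact_mod_cast D.P_pos
  have hQ : (0 : ℤ) < D.Q := by exact_mod_cast D.Q_pos
  have hq := D.intCast_q
  obtain ⟨h1, h2, h3, h4, h5⟩ := D.mem_V₀_iff.1 hv
  rw [zsmul_c, c_eq_cls, pos, cls_sub, cls_sub] at h
  by_contra hm
  have h6 : m * (D.q : ℤ) ≤ 0 := mul_nonpos_of_nonpos_of_nonneg (by omega) (by omega)
  rcases h1.eq_or_lt with h7 | h7
  · have h8 := D.le_of_cls_eq h (t := 2 - D.ℓ) (by linarith)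
    have h9 := h5 h7.symm
    have : (1 - (2 - (D.ℓ : ℤ))) * D.Q = D.q - D.Q := by rw [hq]; ring
    omega
  · have h8 := D.le_of_cls_eq h (t := 1 - D.ℓ) (by linarith)
    have : (1 - (1 - (D.ℓ : ℤ))) * D.Q = D.q := by rw [hq]; ring
    omega

theorem exists_cls_pos_sub_c {v : ℕ × ℕ} (hv : v ∈ D.V₀) {m : ℤ} (hm : 1 ≤ m) :
    ∃ n n' : ℕ, m • D.c - (D.pos v - D.c) = D.cls n n' := by
  have hq := D.intCast_q
  obtain ⟨h1, h2, h3, h4, h5⟩ := D.mem_V₀_iff.1 hv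
  rw [zsmul_c, c_eq_cls, pos, cls_sub, cls_sub]
  have h1 : 1 * (D.q : ℤ) ≤ m * D.q := mul_le_mul_of_nonneg_right hm (by omega)
  refine ⟨(D.ℓ * D.P - v.1 : ℤ).toNat, (m * D.q - v.2 : ℤ).toNat, D.cls_eq_iff.2 ⟨D.ℓ, ?_, ?_⟩⟩
  · rw [Int.toNat_of_nonneg (by omega)]; ring
  · rw [Int.toNat_of_nonneg (by omega), hq]; ring

theorem nonneg_of_zsmul_c {m : ℤ} {n n' : ℕ} (h : m • D.c = D.cls n n') : 0 ≤ m := by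
  have hP : (0 : ℤ) < D.P := by exact_mod_cast D.P_pos
  rw [zsmul_c] at h
  have h1 := D.le_of_cls_eq h (t := 1) (by linarith)
  by_contra hm
  have hq : (0 : ℤ) < D.q := by exact_mod_cast D.q_pos
  have : m * (D.q : ℤ) ≤ -1 * D.q := mul_le_mul_of_nonneg_right (by omega) hq.le
  omega

theorem nonneg_of_zsmul_c_add {m : ℤ} {n n' : ℕ} (h : m • D.c + D.P • D.deg 0 = D.cls n n') :
    0 ≤ m := by
  have hP : (0 : ℤ) < D.P := by exact_mod_cast D.P_pos
  have hQ : (0 : ℤ) < D.Q := by exact_mod_cast D.Q_pos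
  have hℓ : (1 : ℤ) < D.ℓ := by exact_mod_cast D.one_lt_ℓ
  rw [zsmul_c, nsmul_deg_zero, cls_add] at h
  have h1 := D.le_of_cls_eq h (t := 2) (by linarith)
  by_contra hm
  have hq := D.intCast_q
  have hq0 : (D.Q : ℤ) < D.q := by rw [hq]; nlinarith
  have : m * (D.q : ℤ) ≤ -1 * D.q := mul_le_mul_of_nonneg_right (by omega) (by omega)
  omega

/-- The degrees of the generators of `K_{w_r}` are boundary degrees, up to multiples of `c`. -/
theorem boundary_c : D.Boundary D.c := by
  refine ⟨(D.ℓ - 1) * D.P, D.Q, ?_, Or.inl ⟨rfl, by positivity, le_rfl⟩⟩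
  rw [c_eq_cls, cls_eq_iff]
  exact ⟨D.ℓ - 1, by ring, by rw [D.intCast_q]; ring⟩

theorem boundary_c_sub : D.Boundary (D.c - D.P • D.deg 0) := by
  refine ⟨(D.ℓ - 1) * D.P, 0, ?_, Or.inl ⟨rfl, le_rfl, by positivity⟩⟩
  rw [c_eq_cls, nsmul_deg_zero, cls_sub, cls_eq_iff]
  exact ⟨D.ℓ, by ring, by rw [D.intCast_q]; ring⟩

/-- Composites of morphisms between the objects `K_0^{i,j}` do not pass through syzygies. -/
theorem pos_sub_ne_cls {v : ℕ × ℕ} (hv : v ∈ D.V₀) (n n' : ℕ) :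
    D.pos v - D.c - D.cls ((D.ℓ - 1) * D.P) 0 ≠ D.cls n n' := by
  intro h
  have hq := D.intCast_q
  obtain ⟨h1, h2, h3, h4, h5⟩ := D.mem_V₀_iff.1 hv
  rw [c_eq_cls, pos, cls_sub, cls_sub] at h
  have h8 := D.le_of_cls_eq h (t := 1) (by linarith)
  omega

end BPData
end

/-! ### Weights of the staircases of $K_0^{i,j}$ -/

noncomputable section

open MvPolynomial Matrix

namespace BPData

variable {D : BPData}

/-- Cancelling $\ell$ shows that $k$ is the quotient of $j-1$ by $Q$. -/
theorem k_mul_le {j : ℕ} (hj : 1 ≤ j) : D.k j * D.Q + 1 ≤ j ∧ j ≤ D.k j * D.Q + D.Q := by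
  have hℓ : 0 < D.ℓ := lt_trans one_pos D.one_lt_ℓ
  have h1 : D.k j = (j - 1) / D.Q := by
    rw [k, q_eq, mul_comm D.ℓ D.Q, Nat.mul_div_mul_right _ _ hℓ]
  have h2 := Nat.div_add_mod (j - 1) D.Q
  have h3 := Nat.mod_lt (j - 1) D.Q_pos
  rw [← h1, mul_comm] at h2
  omega

theorem intCast_sub_one_mul : (((D.ℓ - 1) * D.P : ℕ) : ℤ) = ((D.ℓ : ℤ) - 1) * D.P := by
  rw [Nat.cast_mul, Nat.cast_sub D.one_lt_ℓ.le, Nat.cast_one]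

/-- The position of a vertex in its column of the quiver. -/
theorem exists_offset (v : D.V₀) : ∃ i : ℕ, v.1.1 = (D.ℓ - 1) * D.P + i ∧ i < D.P ∧ 1 ≤ v.1.2 ∧
    v.1.2 < D.q ∧ (i = 0 → D.Q + 1 ≤ v.1.2) := by
  obtain ⟨h1, h2, h3, h4, h5⟩ := D.mem_V₀_iff.1 v.2
  rw [← intCast_sub_one_mul] at h1 h5
  have h6 : (D.ℓ : ℤ) * D.P = ((D.ℓ - 1) * D.P : ℕ) + D.P := by
    rw [intCast_sub_one_mul]; ring
  refine ⟨v.1.1 - (D.ℓ - 1) * D.P, by omega, by omega, h3, h4, fun h => h5 (by omega)⟩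

variable (v : D.V₀)

theorem stair_m_of_zero {i : ℕ} (hi : v.1.1 = (D.ℓ - 1) * D.P + i) (h0 : i = 0) :
    (D.stair v).m = D.k v.1.2 := by
  simp [stair, hi, h0]

theorem stair_m_of_pos {i : ℕ} (hi : v.1.1 = (D.ℓ - 1) * D.P + i) (h0 : 0 < i) :
    (D.stair v).m = D.k v.1.2 + 1 := by
  simp only [stair, hi]
  rw [if_neg (by omega)]

theorem stair_e {i : ℕ} (hi : v.1.1 = (D.ℓ - 1) * D.P + i) {s : ℕ} (hs : s ≤ D.k v.1.2) :
    (D.stair v).e s = i + (D.k v.1.2 - s) * D.P := by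
  simp only [stair, if_pos hs, hi, Nat.add_sub_cancel_left]

theorem stair_e_last : (D.stair v).e (D.k v.1.2 + 1) = 0 := by
  simp [stair]

theorem stair_f_succ (s : ℕ) : (D.stair v).f (s + 1) = v.1.2 - (D.k v.1.2 - s) * D.Q := by
  simp only [stair, Nat.succ_ne_zero, if_false]
  congr 2
  omega

theorem stair_wt_eq (e f : ℕ) :
    v.1.1 • D.deg 0 + v.1.2 • D.deg 1 - (e • D.deg 0 + f • D.deg 1) =
      D.cls (v.1.1 - e) (v.1.2 - f) := by
  rw [nsmul_add_nsmul, pos, nsmul_deg_zero, nsmul_deg_one, cls_add, cls_sub, add_zero, zero_add]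

/-- Shifting by multiples of $(P,-Q)$ moves the pure power of $x$ to $((\ell-1)P,\,j-kQ)$, the mixed
generators to $((\ell-1)P,\,Q)$, and the generator $y^j$, present only outside the first column, to
$(i,0)$. -/
theorem boundary_wt₁ (s : Fin ((D.stair v).m + 1)) :
    D.Boundary ((D.stair v).wt₁ D.deg (v.1.1 • D.deg 0 + v.1.2 • D.deg 1) s) := by
  obtain ⟨i, hi, hiP, h1, h2, h3⟩ := exists_offset v
  obtain ⟨hk1, hk2⟩ := k_mul_le (D := D) h1
  have hs := s.2
  have hR := D.intCast_sub_one_mul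
  rw [Staircase.wt₁, stair_wt_eq]
  rcases Nat.eq_zero_or_pos (s : ℕ) with h0 | h0
  · rw [h0, stair_e v hi (Nat.zero_le _), Staircase.f_zero, hi]
    refine ⟨(D.ℓ - 1) * D.P, v.1.2 - D.k v.1.2 * D.Q, D.cls_eq_iff.2 ⟨D.k v.1.2, ?_, ?_⟩,
      Or.inl ⟨rfl, ?_, ?_⟩⟩
    · push_cast at hR ⊢; rw [hR, Nat.sub_zero]; ring
    · push_cast; ring
    · zify at hk1; linarith
    · zify at hk2; linarith
  · obtain ⟨t, ht⟩ := Nat.exists_eq_add_of_le' h0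
    rw [ht, stair_f_succ]
    by_cases hsk : (s : ℕ) ≤ D.k v.1.2
    · rw [ht] at hsk
      rw [stair_e v hi hsk, hi]
      have hle : (D.k v.1.2 - t) * D.Q ≤ v.1.2 := by
        have : (D.k v.1.2 - t) * D.Q ≤ D.k v.1.2 * D.Q := Nat.mul_le_mul_right _ (by omega)
        omega
      refine ⟨(D.ℓ - 1) * D.P, D.Q, D.cls_eq_iff.2 ⟨D.k v.1.2 - (t + 1), ?_, ?_⟩,
        Or.inl ⟨rfl, by positivity, le_rfl⟩⟩
      · push_cast [hsk] at hR ⊢; rw [hR]; ring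
      · push_cast [hle, (by omega : t ≤ D.k v.1.2)]; ring
    · rcases Nat.eq_zero_or_pos i with h4 | h4
      · have := stair_m_of_zero v hi h4
        omega
      · have := stair_m_of_pos v hi h4
        have h5 : t = D.k v.1.2 := by omega
        subst h5
        rw [stair_e_last, hi]
        refine ⟨(D.ℓ - 1) * D.P + i, 0, ?_, Or.inr ⟨by omega, ?_, rfl⟩⟩
        · congr 1
          · push_cast at hR ⊢; rw [hR]; ring
          · simp
        · have : (D.ℓ : ℤ) * D.P = (D.ℓ - 1) * D.P + D.P := by ring
          omega

theorem wt₂_last : (D.stair v).wt₂ D.deg D.c (v.1.1 • D.deg 0 + v.1.2 • D.deg 1)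
    (Fin.last _) = D.pos v - D.c := by
  rw [Staircase.wt₂, Fin.val_last, if_pos rfl, nsmul_add_nsmul]

/-- A syzygy between neighbours has the degree of their least common multiple. Consecutive ones
differ by $(P,-Q)$, which is zero in $L$, so all these weights coincide. -/
theorem wt₂_of_ne_last {t : Fin ((D.stair v).m + 1)} (ht : t ≠ Fin.last _) :
    (D.stair v).wt₂ D.deg D.c (v.1.1 • D.deg 0 + v.1.2 • D.deg 1) t =
      D.cls ((D.ℓ - 1) * D.P) 0 := by
  obtain ⟨i, hi, hiP, h1, h2, h3⟩ := exists_offset v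
  obtain ⟨hk1, hk2⟩ := k_mul_le (D := D) h1
  have hR := D.intCast_sub_one_mul
  have ht' : (t : ℕ) < (D.stair v).m :=
    lt_of_le_of_ne (Nat.lt_succ_iff.1 t.2) fun h' => ht (Fin.ext h')
  have htk : (t : ℕ) ≤ D.k v.1.2 := by
    rcases Nat.eq_zero_or_pos i with h4 | h4
    · have := stair_m_of_zero v hi h4
      omega
    · have := stair_m_of_pos v hi h4
      omega
  have hle : (D.k v.1.2 - t) * D.Q ≤ v.1.2 := by
    have : (D.k v.1.2 - t) * D.Q ≤ D.k v.1.2 * D.Q := Nat.mul_le_mul_right _ (by omega)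
    omega
  rw [Staircase.wt₂, if_neg ht'.ne, stair_wt_eq, stair_e v hi htk, stair_f_succ, hi]
  refine D.cls_eq_iff.2 ⟨D.k v.1.2 - t, ?_, ?_⟩
  · push_cast [htk] at hR ⊢; rw [hR]; ring
  · push_cast [hle, htk]; ring

theorem boundary_wt₂ {t : Fin ((D.stair v).m + 1)} (ht : t ≠ Fin.last _) :
    D.Boundary ((D.stair v).wt₂ D.deg D.c (v.1.1 • D.deg 0 + v.1.2 • D.deg 1) t) :=
  ⟨(D.ℓ - 1) * D.P, 0, wt₂_of_ne_last v ht, Or.inl ⟨rfl, le_rfl, by positivity⟩⟩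

/-- A monomial that leads to `v` from a degree outside the quiver lies in the ideal. -/
theorem exists_gen_le (a b : ℕ) (h : ∀ u ∈ D.V₀, D.pos v - D.cls a b ≠ D.pos u) :
    ∃ s ≤ (D.stair v).m, (D.stair v).e s ≤ a ∧ (D.stair v).f s ≤ b := by
  obtain ⟨i, hi, hiP, h1, h2, h3⟩ := exists_offset v
  have hP := D.P_pos
  have hR := D.intCast_sub_one_mul
  set K := D.k v.1.2 with hK
  -- Here $t$ is $(a-i)/P$ rounded up, which makes $((\ell-1)P+r,\;j-b-tQ)$ the window
  -- representative of the source degree. It fails to be a vertex only if the second coordinate is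
  -- at most $0$, or at most $Q$ with $r=0$.
  obtain ⟨t, r, hr, hatr⟩ : ∃ t r : ℕ, r < D.P ∧ a + r = i + t * D.P := by
    have e1 := Nat.div_add_mod (a + (D.P - 1 - i)) D.P
    have e2 := Nat.mod_lt (a + (D.P - 1 - i)) hP
    refine ⟨(a + (D.P - 1 - i)) / D.P, D.P - 1 - (a + (D.P - 1 - i)) % D.P, by omega, ?_⟩
    rw [mul_comm] at e1
    omega
  have hpos : (1 ≤ (v.1.2 : ℤ) - b - t * D.Q → r = 0 ∧ (v.1.2 : ℤ) - b - t * D.Q ≤ D.Q) := by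
    intro h4
    by_contra h5
    obtain ⟨j, hj⟩ := Int.eq_ofNat_of_zero_le (show (0 : ℤ) ≤ v.1.2 - b - t * D.Q by omega)
    have htQ : (0 : ℤ) ≤ t * D.Q := by positivity
    refine h ((D.ℓ - 1) * D.P + r, j) ?_ ?_
    · rw [mem_V₀_iff]
      have e : (D.ℓ : ℤ) * D.P = ((D.ℓ - 1) * D.P : ℕ) + D.P := by rw [hR]; ring
      rw [e, ← hR]
      simp only
      refine ⟨by omega, by omega, by omega, by omega, fun h6 => ?_⟩
      omega
    · rw [pos, pos, cls_sub, cls_eq_iff]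
      refine ⟨t, ?_, ?_⟩
      · zify at hatr
        rw [hi]
        push_cast at hR ⊢
        rw [hR]
        linarith
      · simp only
        linarith
  have f_of : ∀ {s n : ℕ}, 1 ≤ s → s + n = K + 1 → v.1.2 ≤ b + n * D.Q →
      (D.stair v).f s ≤ b := by
    intro s n hs hsn hb
    obtain ⟨s, rfl⟩ := Nat.exists_eq_add_of_le' hs
    rw [stair_f_succ, ← hK, show K - s = n by omega]
    omega
  have e_of : ∀ {s n : ℕ}, s + n = K → i + n * D.P ≤ a → (D.stair v).e s ≤ a := by
    intro s n hsn ha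
    rw [stair_e v hi (by omega), ← hK, show K - s = n by omega]
    exact ha
  have hm : K ≤ (D.stair v).m := by
    rcases Nat.eq_zero_or_pos i with h4 | h4
    · rw [stair_m_of_zero v hi h4]
    · rw [stair_m_of_pos v hi h4]; omega
  have hzero : i + K * D.P ≤ a → ∃ s ≤ (D.stair v).m, (D.stair v).e s ≤ a ∧ (D.stair v).f s ≤ b :=
    fun h4 => ⟨0, Nat.zero_le _, e_of (n := K) (by omega) h4, by rw [Staircase.f_zero]; omega⟩
  -- The dividing generator has index $K-t$ if $r=0$ and $K+1-t$ if $r>0$. Whenever this is not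
  -- positive, the pure power of $x$, of index $0$, divides already.
  rcases Nat.eq_zero_or_pos r with hr0 | hr0
  · rcases lt_or_ge t K with htK | htK
    · refine ⟨K - t, by omega, e_of (n := t) (by omega) (by omega),
        f_of (n := t + 1) (by omega) (by omega) ?_⟩
      zify
      rw [add_mul, one_mul]
      by_contra h4
      have := hpos (by push Not at h4; have := D.Q_pos; omega)
      omega
    · refine hzero ?_
      have : K * D.P ≤ t * D.P := Nat.mul_le_mul_right _ htK
      omega
  · have hb : (v.1.2 : ℤ) ≤ b + t * D.Q := by
      by_contra h4
      have := hpos (by omega)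
      omega
    rcases Nat.eq_zero_or_pos t with ht0 | ht0
    · subst ht0
      have h4 : 0 < i := by omega
      refine ⟨K + 1, (stair_m_of_pos v hi h4).ge, by rw [stair_e_last]; omega,
        f_of (n := 0) (by omega) (by omega) (by zify; exact hb)⟩
    · obtain ⟨t', rfl⟩ : ∃ t', t = t' + 1 := ⟨t - 1, by omega⟩
      rename' t' => t
      have e1 : (t + 1) * D.P = t * D.P + D.P := by ring
      rcases lt_or_ge t K with htK | htK
      · exact ⟨K - t, by omega, e_of (n := t) (by omega) (by omega),
          f_of (n := t + 1) (by omega) (by omega) (by zify; push_cast at hb; exact hb)⟩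
      · refine hzero ?_
        have : K * D.P ≤ t * D.P := Nat.mul_le_mul_right _ htK
        omega

end BPData
end

/-! ### Graded pieces of the ideals and points on the curves $w_r=0$ -/

noncomputable section

open MvPolynomial Matrix

theorem X_pow_mul_X_pow_eq_monomial (a b : ℕ) : (X 0 : PolyS) ^ a * X 1 ^ b =
    monomial (Finsupp.single 0 a + Finsupp.single 1 b) 1 := by
  rw [X_pow_eq_monomial, X_pow_eq_monomial, monomial_mul, one_mul]

theorem monomial_eq_C_mul (d : Fin 2 →₀ ℕ) (z : ℂ) :
    (monomial d z : PolyS) = C z * (X 0 ^ d 0 * X 1 ^ d 1) := by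
  rw [monomial_eq, Finsupp.prod_fintype _ _ (fun i => pow_zero _), Fin.prod_univ_two]

theorem le_of_coeff_X_pow_mul_ne_zero {a b : ℕ} {F : PolyS} {d : Fin 2 →₀ ℕ}
    (h : coeff d (X 0 ^ a * X 1 ^ b * F) ≠ 0) : a ≤ d 0 ∧ b ≤ d 1 := by
  rw [X_pow_mul_X_pow_eq_monomial, coeff_monomial_mul'] at h
  split_ifs at h with h1
  · exact ⟨by simpa using h1 0, by simpa using h1 1⟩
  · exact absurd rfl h

namespace BPData

variable {D : BPData}

theorem eq_zero_of_not_effective {f : PolyS} {a : D.L} (hf : IsWeightedHomogeneous D.deg f a)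
    (h : ∀ n m : ℕ, a ≠ D.cls n m) : f = 0 := by
  by_contra hne
  obtain ⟨d, hd⟩ := exists_coeff_ne_zero hne
  exact h _ _ ((hf hd).symm.trans (D.weight_eq d))

theorem X_pow_mul_X_pow_homogeneous (n m : ℕ) :
    IsWeightedHomogeneous D.deg ((X 0 : PolyS) ^ n * X 1 ^ m) (D.cls n m) := by
  have := (X_pow_isWeightedHomogeneous (δ := D.deg) 0 n).mul
    (X_pow_isWeightedHomogeneous (δ := D.deg) 1 m)
  rwa [nsmul_deg_zero, nsmul_deg_one, cls_add, add_zero, zero_add] at this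

/-- Every monomial of `f` leads to `v` from the non-vertex degree `a`, so `exists_gen_le` provides a
generator dividing it. Thus the module of `v` is nonzero only in degrees of vertices. -/
theorem mem_ideal_of_homogeneous (v : D.V₀) {a : D.L} {f : PolyS}
    (hf : IsWeightedHomogeneous D.deg f (D.pos v - a)) (ha : ∀ u ∈ D.V₀, a ≠ D.pos u) :
    f ∈ (D.stair v).ideal := by
  rw [f.as_sum]
  refine Ideal.sum_mem _ fun d hd => ?_
  have hw := hf (mem_support_iff.1 hd)
  rw [weight_eq] at hw
  obtain ⟨s, hs, h1, h2⟩ := exists_gen_le v (d 0) (d 1) (fun u hu h => ha u hu (by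
    rw [hw] at h; rw [← h]; abel))
  have hmem : (D.stair v).gen s ∈ (D.stair v).ideal :=
    Ideal.subset_span ⟨⟨s, Nat.lt_succ_iff.2 hs⟩, rfl⟩
  rw [monomial_eq_C_mul]
  refine Ideal.mul_mem_left _ _ ?_
  refine Ideal.mem_of_dvd _ ?_ hmem
  exact mul_dvd_mul (pow_dvd_pow _ h1) (pow_dvd_pow _ h2)

/-- A monomial of `f` would be a multiple of a generator, and generators sit in boundary degrees,
below which there is no vertex. So in degrees of vertices the ideal imposes no relations. -/
theorem eq_zero_of_mem_ideal (v : D.V₀) {u : ℕ × ℕ} (hu : u ∈ D.V₀) {f : PolyS}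
    (hf : IsWeightedHomogeneous D.deg f (D.pos v - D.pos u)) (hI : f ∈ (D.stair v).ideal) :
    f = 0 := by
  by_contra hne
  obtain ⟨d, hd⟩ := exists_coeff_ne_zero hne
  have hw := hf hd
  rw [weight_eq] at hw
  obtain ⟨c, rfl⟩ := (D.stair v).mem_ideal_iff.1 hI
  rw [coeff_sum] at hd
  obtain ⟨s, -, hs⟩ := Finset.exists_ne_zero_of_sum_ne_zero hd
  obtain ⟨h1, h2⟩ := le_of_coeff_X_pow_mul_ne_zero hs
  refine (boundary_wt₁ v s).sub_ne_pos (d 0 - (D.stair v).e s) (d 1 - (D.stair v).f s) hu ?_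
  rw [Staircase.wt₁, nsmul_add_nsmul, nsmul_deg_zero, nsmul_deg_one, sub_sub, cls_add, cls_add,
    sub_eq_iff_eq_add, ← sub_eq_iff_eq_add', ← hw]
  congr 1 <;> omega

theorem root_ne_zero (r : Fin D.ℓ) : D.root r ≠ 0 :=
  mul_ne_zero (Complex.exp_ne_zero _)
    (pow_ne_zero _ (D.η_primitive.ne_zero (lt_trans one_pos D.one_lt_ℓ).ne'))

theorem root_injective : Function.Injective D.root := by
  intro r s h
  have h0 := D.η_primitive.ne_zero (lt_trans one_pos D.one_lt_ℓ).ne'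
  have h1 := mul_left_cancel₀ (Complex.exp_ne_zero _) h
  rw [pow_succ, pow_succ] at h1
  exact Fin.ext (D.η_primitive.pow_inj r.2 s.2 (mul_right_cancel₀ h0 h1))

theorem exists_pow_eq_root (r : Fin D.ℓ) : ∃ z : ℂ, z ^ D.P = D.root r :=
  IsAlgClosed.exists_pow_nat_eq _ D.P_pos

/-- A `P`-th root of the coefficient of `w_r`. -/
def rootP (r : Fin D.ℓ) : ℂ := (exists_pow_eq_root r).choose

theorem rootP_pow (r : Fin D.ℓ) : rootP r ^ D.P = D.root r := (exists_pow_eq_root r).choose_spec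

theorem rootP_ne_zero (r : Fin D.ℓ) : rootP r ≠ 0 := by
  intro h
  have := rootP_pow r
  rw [h, zero_pow D.P_pos.ne'] at this
  exact root_ne_zero r this.symm

/-- Evaluation at a point of the curve `w_r = 0`. -/
def ev (r : Fin D.ℓ) : PolyS →ₐ[ℂ] ℂ := aeval ![rootP r, 1]

theorem ev_X_zero (r : Fin D.ℓ) : ev r (X 0) = rootP r := by simp [ev]

theorem ev_X_one (r : Fin D.ℓ) : ev r (X 1) = 1 := by simp [ev]

theorem ev_C (r : Fin D.ℓ) (z : ℂ) : ev r (C z) = z := by simp [ev]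

theorem ev_w (r s : Fin D.ℓ) : ev r (D.w s) = D.root r - D.root s := by
  rw [w, map_sub, map_mul, map_pow, map_pow, ev_X_zero, ev_X_one, ev_C, rootP_pow, one_pow, mul_one]

theorem ev_w_self (r : Fin D.ℓ) : ev r (D.w r) = 0 := by rw [ev_w, sub_self]

theorem ev_w_ne {r s : Fin D.ℓ} (h : r ≠ s) : ev r (D.w s) ≠ 0 := by
  rw [ev_w, sub_ne_zero]; exact fun h' => h (root_injective h')

theorem ev_prod_erase_w_self (r : Fin D.ℓ) : ev r (∏ s ∈ Finset.univ.erase r, D.w s) ≠ 0 := by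
  rw [map_prod]
  exact Finset.prod_ne_zero_iff.2 fun s hs => ev_w_ne (Finset.ne_of_mem_erase hs).symm

theorem w_mul_prod_erase (r : Fin D.ℓ) : D.w r * ∏ s ∈ Finset.univ.erase r, D.w s = D.W := by
  rw [Finset.mul_prod_erase _ _ (Finset.mem_univ r), prod_w]

theorem W_ne_zero : D.W ≠ 0 := X_pow_add_X_pow_ne_zero

theorem w_ne_zero (r : Fin D.ℓ) : D.w r ≠ 0 := by
  intro h
  have := w_mul_prod_erase r
  rw [h, zero_mul] at this
  exact W_ne_zero this.symm

theorem w_dvd_pow_sub (r : Fin D.ℓ) (n m k : ℕ) :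
    D.w r ∣ X 0 ^ (n + k * D.P) * X 1 ^ m - C (D.root r ^ k) * (X 0 ^ n * X 1 ^ (m + k * D.Q)) := by
  have h := sub_dvd_pow_sub_pow (X 0 ^ D.P : PolyS) (C (D.root r) * X 1 ^ D.Q) k
  have e : (X 0 : PolyS) ^ (n + k * D.P) * X 1 ^ m -
      C (D.root r ^ k) * (X 0 ^ n * X 1 ^ (m + k * D.Q)) =
      ((X 0 ^ D.P) ^ k - (C (D.root r) * X 1 ^ D.Q) ^ k) * (X 0 ^ n * X 1 ^ m) := by
    rw [map_pow]; ring
  rw [e]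
  exact h.mul_right _

/-- A homogeneous polynomial is divisible by `w_r` if it vanishes at one point of the curve. -/
theorem w_dvd_of_ev_eq_zero {r : Fin D.ℓ} {f : PolyS} {a : D.L}
    (hf : IsWeightedHomogeneous D.deg f a) (h0 : ev r f = 0) : D.w r ∣ f := by
  by_cases hne : f = 0
  · rw [hne]; exact dvd_zero _
  -- Monomials of equal weight differ by powers of $x^Py^{-Q}$. Relative to the one with least
  -- $x$-exponent, each is congruent modulo $w_r$ to a scalar multiple of it, and evaluation reads
  -- off the total scalar.
  obtain ⟨d₀, hd₀, hmin⟩ := Finset.exists_min_image f.support (fun d => d 0)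
    (support_nonempty.2 hne)
  have hw₀ := hf (mem_support_iff.1 hd₀)
  have key : ∀ d ∈ f.support, ∃ z : ℂ,
      D.w r ∣ X 0 ^ d 0 * X 1 ^ d 1 - C z * (X 0 ^ d₀ 0 * X 1 ^ d₀ 1) := by
    intro d hd
    have hw := hf (mem_support_iff.1 hd)
    rw [← hw₀, weight_eq, weight_eq, eq_comm, cls_eq_iff] at hw
    obtain ⟨k, h1, h2⟩ := hw
    have hle := hmin d hd
    have hP : (0 : ℤ) < D.P := by exact_mod_cast D.P_pos
    have hk : 0 ≤ k := by
      by_contra hk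
      have : k * (D.P : ℤ) ≤ -1 * D.P := mul_le_mul_of_nonneg_right (by omega) hP.le
      omega
    obtain ⟨k, rfl⟩ := Int.eq_ofNat_of_zero_le hk
    refine ⟨D.root r ^ k, ?_⟩
    have e1 : d 0 = d₀ 0 + k * D.P := by zify; exact h1
    have e2 : d₀ 1 = d 1 + k * D.Q := by zify; linarith
    rw [e1, e2]
    exact w_dvd_pow_sub r _ _ _
  choose! z hz using key
  have h1 : D.w r ∣ f - C (∑ d ∈ f.support, coeff d f * z d) * (X 0 ^ d₀ 0 * X 1 ^ d₀ 1) := by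
    have e : f - C (∑ d ∈ f.support, coeff d f * z d) * (X 0 ^ d₀ 0 * X 1 ^ d₀ 1) =
        ∑ d ∈ f.support, C (coeff d f) *
          (X 0 ^ d 0 * X 1 ^ d 1 - C (z d) * (X 0 ^ d₀ 0 * X 1 ^ d₀ 1)) := by
      simp only [mul_sub, Finset.sum_sub_distrib, map_sum, map_mul, Finset.sum_mul, mul_assoc]
      congr 1
      conv_lhs => rw [f.as_sum]
      exact Finset.sum_congr rfl fun d _ => monomial_eq_C_mul _ _
    rw [e]
    exact Finset.dvd_sum fun d hd => (hz d hd).mul_left _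
  have h2 : ∑ d ∈ f.support, coeff d f * z d = 0 := by
    obtain ⟨g, hg⟩ := h1
    have h3 := congrArg (ev r) hg
    rw [map_mul, ev_w_self, zero_mul, map_sub, h0, map_mul, map_mul, map_pow, map_pow, ev_X_zero,
      ev_X_one, ev_C, one_pow, mul_one, zero_sub, neg_eq_zero] at h3
    exact (mul_eq_zero.1 h3).resolve_right (pow_ne_zero _ (rootP_ne_zero r))
  rwa [h2, map_zero, zero_mul, sub_zero] at h1

/-- Homogeneous polynomials of an effective degree take all values. -/
theorem exists_homogeneous_ev_eq (r : Fin D.ℓ) {a : D.L} (ha : ∃ n m : ℕ, a = D.cls n m) (z : ℂ) :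
    ∃ f : PolyS, IsWeightedHomogeneous D.deg f a ∧ ev r f = z := by
  obtain ⟨n, m, rfl⟩ := ha
  refine ⟨C (z * (rootP r ^ n)⁻¹) * (X 0 ^ n * X 1 ^ m), ?_, ?_⟩
  · have := (isWeightedHomogeneous_C D.deg (z * (rootP r ^ n)⁻¹)).mul
      (X_pow_mul_X_pow_homogeneous (D := D) n m)
    rwa [zero_add] at this
  · rw [map_mul (ev r), ev_C, map_mul, map_pow, map_pow, ev_X_zero, ev_X_one, one_pow, mul_one,
      mul_assoc, inv_mul_cancel₀ (pow_ne_zero _ (rootP_ne_zero r)), mul_one]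

end BPData
end

/-! ### Homotopies into $K_{w_r}$ and staircases restricted to the curve -/

noncomputable section

open MvPolynomial Matrix

/-- Subtracting the coboundary of the map with first row `ψ` makes the first row divisible by `w`.
The obstruction is therefore the row modulo `w` and modulo the image of the source differential. -/
theorem rankOne_exists_homotopy_of_row {κ : Type} [Fintype κ] [DecidableEq κ] {w w' W : PolyS}
    (hw : w ≠ 0) (hW : w * w' = W) {dK : Matrix κ κ PolyS} {ε : ℂ} (hK : dK * dK = W • 1)
    (hε : ε * ε = 1) {f : Matrix (Fin 2) κ PolyS} (hf : !![0, w; w', 0] * f = ε • (f * dK))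
    (ψ : κ → PolyS) (h0 : ∀ s, w ∣ f 0 s - ε • (ψ ᵥ* dK) s) :
    ∃ h : Matrix (Fin 2) κ PolyS, !![0, w; w', 0] * h + ε • (h * dK) = f := by
  set d : Matrix (Fin 2) (Fin 2) PolyS := !![0, w; w', 0] with hd
  have hdd : d * d = W • 1 := by
    ext1 i j
    fin_cases i <;> fin_cases j <;> simp [hd, ← hW, mul_comm]
  let k : Matrix (Fin 2) κ PolyS := Matrix.of ![ψ, 0]
  have hk : d * (d * k + ε • (k * dK)) = ε • ((d * k + ε • (k * dK)) * dK) := by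
    rw [Matrix.mul_add, Matrix.add_mul, ← Matrix.mul_assoc, hdd, Matrix.mul_smul, smul_add,
      Matrix.smul_mul ε, smul_smul, hε, one_smul, Matrix.mul_assoc k, hK, Matrix.mul_assoc]
    simp [add_comm]
  obtain ⟨h, hh⟩ := rankOne_exists_homotopy hw (w' := w') (dK := dK) (ε := ε)
    (f := f - (d * k + ε • (k * dK)))
    (by rw [← hd, Matrix.mul_sub, hf, hk, Matrix.sub_mul, smul_sub])
    (by
      intro s
      have e : (f - (d * k + ε • (k * dK))) 0 s = f 0 s - ε • (ψ ᵥ* dK) s := by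
        simp [hd, k]
      rw [e]
      exact h0 s)
  refine ⟨h + k, ?_⟩
  rw [Matrix.mul_add, Matrix.add_mul, smul_add, add_add_add_comm, hh, sub_add_cancel]

namespace Staircase

variable {p q : ℕ} (σ : Staircase p q)

theorem vecMul_d₀_of_lt (α : Fin (σ.m + 1) → PolyS) {t : ℕ} (ht : t < σ.m) :
    (α ᵥ* σ.d₀) ⟨t, by omega⟩ = α ⟨t, by omega⟩ * X 1 ^ (σ.f (t + 1) - σ.f t) -
      α ⟨t + 1, by omega⟩ * X 0 ^ (σ.e t - σ.e (t + 1)) := by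
  have h1 : ∀ s : Fin (σ.m + 1), α s * σ.d₀ s ⟨t, by omega⟩ =
      (if s = ⟨t, by omega⟩ then
        α ⟨t, by omega⟩ * X 1 ^ (σ.f (t + 1) - σ.f t) else 0) -
      if s = ⟨t + 1, by omega⟩ then α ⟨t + 1, by omega⟩ * X 0 ^ (σ.e t - σ.e (t + 1)) else 0 := by
    intro s
    simp only [d₀, Matrix.of_apply, if_neg ht.ne, Fin.ext_iff]
    split_ifs with h1 h2 h2
    · omega
    · rw [sub_zero]; congr 2; exact Fin.ext h1
    · rw [mul_neg, zero_sub]; congr 3; exact Fin.ext h2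
    · simp
  rw [Matrix.vecMul, dotProduct, Finset.sum_congr rfl fun s _ => h1 s, Finset.sum_sub_distrib,
    Finset.sum_ite_eq', Finset.sum_ite_eq', if_pos (Finset.mem_univ _), if_pos (Finset.mem_univ _)]

end Staircase

namespace BPData

variable {D : BPData}

theorem ev_gen (v : D.V₀) (r : Fin D.ℓ) (s : ℕ) :
    ev r ((D.stair v).gen s) = rootP r ^ (D.stair v).e s := by
  rw [Staircase.gen, map_mul, map_pow, map_pow, ev_X_zero, ev_X_one, one_pow, mul_one]

theorem ev_gen_last (v : D.V₀) (r : Fin D.ℓ) : ev r ((D.stair v).gen (D.stair v).m) = 1 := by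
  rw [ev_gen, Staircase.e_last, pow_zero]

theorem ev_vecMul_d₀_of_lt (v : D.V₀) (r : Fin D.ℓ) (α : Fin ((D.stair v).m + 1) → PolyS) {t : ℕ}
    (ht : t < (D.stair v).m) :
    ev r ((α ᵥ* (D.stair v).d₀) ⟨t, by omega⟩) = ev r (α ⟨t, by omega⟩) -
      ev r (α ⟨t + 1, by omega⟩) * rootP r ^ ((D.stair v).e t - (D.stair v).e (t + 1)) := by
  rw [Staircase.vecMul_d₀_of_lt _ _ ht, map_sub, map_mul, map_mul, map_pow, map_pow, ev_X_one,
    ev_X_zero, one_pow, mul_one]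

/-- The kernel of the presentation matrix on the curve `w_r = 0` is spanned by the generators. -/
theorem ev_eq_of_vecMul_d₀ (v : D.V₀) (r : Fin D.ℓ) (α : Fin ((D.stair v).m + 1) → PolyS)
    (h : ∀ t, ev r ((α ᵥ* (D.stair v).d₀) t) = 0) (s : Fin ((D.stair v).m + 1)) :
    ev r (α s) = ev r (α (Fin.last _)) * ev r ((D.stair v).gen s) := by
  have key : ∀ n s : ℕ, ∀ hs : s + n = (D.stair v).m, ev r (α ⟨s, by omega⟩) =
      ev r (α (Fin.last _)) * rootP r ^ (D.stair v).e s := by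
    intro n
    induction n with
    | zero =>
      intro s hs
      obtain rfl : s = (D.stair v).m := by omega
      rw [Staircase.e_last, pow_zero, mul_one]; rfl
    | succ n ih =>
      intro s hs
      have h1 := h ⟨s, by omega⟩
      rw [ev_vecMul_d₀_of_lt v r α (by omega), ih (s + 1) (by omega), mul_assoc, ← pow_add,
        Nat.add_sub_cancel' ((D.stair v).e_succ_le s (by omega)), sub_eq_zero] at h1
      exact h1
  rw [ev_gen]
  exact key ((D.stair v).m - s) s (by have := s.2; omega)

/-- The complex of evaluations on the curve `w_r = 0` is exact. -/
theorem exists_vecMul_d₀_eq (v : D.V₀) (r : Fin D.ℓ) (b : Fin ((D.stair v).m + 1) → PolyS)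
    (h : ∀ s, ev r ((b ᵥ* (D.stair v).d₀.adjugate) s) = 0) :
    ∃ α : Fin ((D.stair v).m + 1) → ℂ, ∀ β : Fin ((D.stair v).m + 1) → PolyS,
      (∀ s, ev r (β s) = α s) → ∀ t, ev r ((β ᵥ* (D.stair v).d₀) t) = ev r (b t) := by
  let b' : ℕ → ℂ := fun t => if h : t < (D.stair v).m + 1 then ev r (b ⟨t, h⟩) else 0
  -- This solves the backward recursion $\alpha_t-\rho^{e_t-e_{t+1}}\alpha_{t+1}=b_t$ with
  -- $\alpha_m=0$.
  let α : ℕ → ℂ := fun s => rootP r ^ (D.stair v).e s * ∑ t ∈ Finset.Ico s (D.stair v).m, b' t / rootP r ^ (D.stair v).e t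
  refine ⟨fun s => α s, fun β hβ => ?_⟩
  have hρ : ∀ n : ℕ, rootP r ^ n ≠ 0 := fun n => pow_ne_zero _ (rootP_ne_zero r)
  have hlt : ∀ t, ∀ ht : t < (D.stair v).m, ev r ((β ᵥ* (D.stair v).d₀) ⟨t, by omega⟩) = ev r (b ⟨t, by omega⟩) := by
    intro t ht
    have hb : ev r (b ⟨t, by omega⟩) = b' t := by
      simp only [b', dif_pos (show t < (D.stair v).m + 1 by omega)]
    rw [ev_vecMul_d₀_of_lt v r β ht, hβ, hβ, hb]
    simp only [α]
    rw [Finset.sum_eq_sum_Ico_succ_bot ht, mul_add, mul_div_cancel₀ _ (hρ _), mul_right_comm,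
      ← pow_add, Nat.add_sub_cancel' ((D.stair v).e_succ_le t ht), add_sub_cancel_right]
  -- The recursion omits the last coordinate. It is forced: at the point $W$ vanishes, so `b` and `β
  -- ᵥ* d₀` are both killed by the last column of the adjugate, whose entry in the last row
  -- evaluates to $1$.
  have hlast : ev r ((β ᵥ* (D.stair v).d₀) (Fin.last _)) = ev r (b (Fin.last _)) := by
    have h1 : ev r (((b - β ᵥ* (D.stair v).d₀) ᵥ* (D.stair v).d₀.adjugate) (Fin.last _)) = 0 := by
      rw [Matrix.sub_vecMul, Matrix.vecMul_vecMul, Matrix.mul_adjugate, (D.stair v).det_d₀, Matrix.vecMul_smul,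
        Matrix.vecMul_one, Pi.sub_apply, map_sub, h, Pi.smul_apply, smul_eq_mul, map_mul]
      have h2 : ev r (X 0 ^ D.p + X 1 ^ D.q) = 0 := by
        change ev r D.W = 0
        rw [← w_mul_prod_erase r, map_mul, ev_w_self, zero_mul]
      rw [h2, zero_mul, sub_zero]
    rw [Matrix.vecMul, dotProduct, map_sum, Finset.sum_eq_single (Fin.last _)] at h1
    · rw [map_mul, (D.stair v).adjugate_d₀_last, Fin.val_last, ev_gen_last, mul_one, Pi.sub_apply, map_sub,
        sub_eq_zero] at h1
      exact h1.symm
    · intro t _ ht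
      have ht' : (t : ℕ) < (D.stair v).m :=
        lt_of_le_of_ne (Nat.lt_succ_iff.1 t.2) fun h' => ht (Fin.ext h')
      rw [map_mul, Pi.sub_apply, map_sub, ← hlt t ht', sub_self, zero_mul]
    · intro h; exact absurd (Finset.mem_univ _) h
  intro t
  by_cases ht : t = Fin.last _
  · rw [ht, hlast]
  · exact hlt t (lt_of_le_of_ne (Nat.lt_succ_iff.1 t.2) fun h' => ht (Fin.ext h'))

end BPData
end

/-! ### Rows of morphisms into $K_0^{i,j}$ and $K_{w_r}[3]$ -/

noncomputable section

open MvPolynomial Matrix MatFac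

namespace BPData

variable {D : BPData}

/-- The generator of `K_0^{i,j}` that is mapped onto the generator of the module. -/
abbrev top (v : D.V₀) : (D.K₀ v).ι := Sum.inr (Fin.last (D.stair v).m)

theorem wt_top (v : D.V₀) : (D.K₀ v).wt (top v) = D.pos v - D.c := wt₂_last v

theorem exists_homotopy_K₀ (K : MatFac D.deg D.c D.W) (v : D.V₀) {n : ℤ} {ε : ℂ} (hε : ε * ε = 1)
    {f : Matrix (D.K₀ v).ι K.ι PolyS} (hf : f ∈ hom K (D.K₀ v) n)
    (hc : (D.K₀ v).d * f = ε • (f * K.d)) (h0 : ∀ s, f (top v) s ∈ (D.stair v).ideal) :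
    ∃ h ∈ hom K (D.K₀ v) (n - 1), (D.K₀ v).d * h + ε • (h * K.d) = f := by
  obtain ⟨h, hh⟩ := (D.stair v).exists_homotopy K.d_sq hε hc h0
  exact exists_homotopy_mem hf hh

/-- The entry is homogeneous of degree `pos v` minus the weight of `s` shifted by $-mc$. The
hypothesis says that this shifted weight is not a vertex, which is what `mem_ideal_of_homogeneous`
needs. -/
theorem top_mem_ideal {K : MatFac D.deg D.c D.W} {v : D.V₀} {n : ℤ}
    {f : Matrix (D.K₀ v).ι K.ι PolyS} (hf : f ∈ hom K (D.K₀ v) n) (s : K.ι)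
    (h : ∀ m : ℤ, K.deg s + n = 2 * m → ∀ u ∈ D.V₀, K.wt s + (-m) • D.c ≠ D.pos u) :
    f (top v) s ∈ (D.stair v).ideal := by
  have hd : (D.K₀ v).deg (top v) = -2 := rfl
  by_cases he : Even (K.deg s + n)
  · obtain ⟨m, hm⟩ := he
    have h1 := (hf (top v) s).1 (m + 1) (by rw [hd]; omega)
    rw [wt_top] at h1
    refine mem_ideal_of_homogeneous v (a := K.wt s + (-m) • D.c) ?_ (h m (by omega))
    convert h1 using 1
    module
  · rw [(hf (top v) s).2 (by rw [hd, sub_neg_eq_add]; rw [Int.even_iff] at *; omega)]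
    exact Ideal.zero_mem _

/-- All generators of the source but `top u` have boundary weights, and `top u` meets a vertex only
for the multiple of $c$ that belongs to cohomological degree $0$. -/
theorem top_mem_ideal_K₀ {u v : D.V₀} {n : ℤ} {f : Matrix (D.K₀ v).ι (D.K₀ u).ι PolyS}
    (hf : f ∈ hom (D.K₀ u) (D.K₀ v) n) {s : (D.K₀ u).ι} (hs : s ≠ top u ∨ n ≠ 0) :
    f (top v) s ∈ (D.stair v).ideal := by
  refine top_mem_ideal hf s fun m hm w hw => ?_
  rcases s with s | s
  · exact (boundary_wt₁ u s).add_ne_pos _ hw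
  · by_cases ht : s = Fin.last _
    · subst ht
      have hn : n ≠ 0 := hs.resolve_left fun h => h rfl
      intro h
      rw [wt_top] at h
      have h1 := pos_add_eq_pos (m := -1 - m) u.2 hw (by rw [← h]; module)
      change -2 + n = 2 * m at hm
      omega
    · exact (boundary_wt₂ u ht).add_ne_pos _ hw

/-- Both generators of $K_{w_r}$ have boundary weights up to a multiple of $c$, so no class from
$K_{w_r}[3]$ to a $K_0^{i,j}$ survives in any degree. -/
theorem top_mem_ideal_Kw {r : Fin D.ℓ} {v : D.V₀} {n : ℤ}
    {f : Matrix (D.K₀ v).ι ((D.Kw r).shift 3).ι PolyS}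
    (hf : f ∈ hom ((D.Kw r).shift 3) (D.K₀ v) n) (s : ((D.Kw r).shift 3).ι) :
    f (top v) s ∈ (D.stair v).ideal := by
  refine top_mem_ideal hf s fun m hm w hw => ?_
  change Fin 2 at s
  have h0 : ∃ a, D.Boundary a ∧ ((D.Kw r).shift 3).wt s = a - D.c := by
    fin_cases s
    · exact ⟨_, boundary_c, (sub_self _).symm⟩
    · refine ⟨_, boundary_c_sub, ?_⟩
      change -(D.P • D.deg 0) = _
      abel
  obtain ⟨a, ha, e⟩ := h0
  rw [e]
  have := ha.add_ne_pos (-1 - m) hw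
  convert this using 1
  module

/-- The differential of `K_{w_r}[3]`. -/
theorem shift_Kw_d (r : Fin D.ℓ) : ((D.Kw r).shift 3).d =
    !![0, -D.w r; -∏ s ∈ Finset.univ.erase r, D.w s, 0] := by
  change (3 : ℤ).negOnePow • !![0, D.w r; ∏ s ∈ Finset.univ.erase r, D.w s, 0] = _
  rw [Int.negOnePow_odd 3 (by decide)]
  ext1 i j
  fin_cases i <;> fin_cases j <;> simp

theorem exists_homotopy_Kw (K : MatFac D.deg D.c D.W) (r : Fin D.ℓ) {n : ℤ} {ε : ℂ}
    (hε : ε * ε = 1) {f : Matrix (Fin 2) K.ι PolyS} (hf : f ∈ hom K ((D.Kw r).shift 3) n)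
    (hc : !![0, -D.w r; -∏ s ∈ Finset.univ.erase r, D.w s, 0] * f = ε • (f * K.d))
    (ψ : K.ι → PolyS) (h0 : ∀ s, D.w r ∣ f 0 s - ε • (ψ ᵥ* K.d) s) :
    ∃ h ∈ hom K ((D.Kw r).shift 3) (n - 1), ((D.Kw r).shift 3).d * h + ε • (h * K.d) = f := by
  obtain ⟨h, hh⟩ := rankOne_exists_homotopy_of_row (w := -D.w r)
    (neg_ne_zero.2 (w_ne_zero r)) (by rw [neg_mul_neg, w_mul_prod_erase]) K.d_sq hε hc ψ
    (fun s => (neg_dvd).2 (h0 s))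
  refine exists_homotopy_mem hf (h := h) ?_
  rw [shift_Kw_d]
  exact hh

/-- The first row of the target differential vanishes at the point, so the first row of a closed map
is annihilated there by the source differential. -/
theorem ev_closed_row {κ : Type} [Fintype κ] {r : Fin D.ℓ} {f : Matrix (Fin 2) κ PolyS}
    {dK : Matrix κ κ PolyS} {ε : ℂ} (hε : ε * ε = 1)
    (hc : !![0, -D.w r; -∏ s ∈ Finset.univ.erase r, D.w s, 0] * f = ε • (f * dK)) (s : κ) :
    ev r (((f 0) ᵥ* dK) s) = 0 := by
  have h1 := congrArg (ev r) (congrFun (congrFun hc 0) s)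
  rw [Matrix.mul_apply, Fin.sum_univ_two] at h1
  simp only [Matrix.of_apply, Matrix.cons_val', Matrix.cons_val_zero, Matrix.cons_val_one,
    zero_mul, zero_add, map_neg, neg_mul, map_mul, ev_w_self, neg_zero, Matrix.smul_apply,
    map_smul, smul_eq_mul] at h1
  have hε0 : ε ≠ 0 := by rintro rfl; simp at hε
  exact (mul_eq_zero.1 h1.symm).resolve_left hε0

theorem w_dvd_sub {r : Fin D.ℓ} {f g : PolyS} {a : D.L} (hf : IsWeightedHomogeneous D.deg f a)
    (hg : IsWeightedHomogeneous D.deg g a) (h : ev r f = ev r g) : D.w r ∣ f - g :=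
  w_dvd_of_ev_eq_zero (hf.sub hg) (by rw [map_sub, h, sub_self])

end BPData
end

/-! ### Null-homotopy of morphisms into $K_{w_r}[3]$ -/

noncomputable section

open MvPolynomial Matrix MatFac

namespace BPData

variable {D : BPData}

/-- The generator of `K_0^{i,j}` that corresponds to the generator `y^*` of the ideal. -/
abbrev bot (v : D.V₀) : (D.K₀ v).ι := Sum.inl (Fin.last (D.stair v).m)

section

variable {u : D.V₀} {r : Fin D.ℓ} {n : ℤ}
  {f : Matrix (Fin 2) (Fin ((D.stair u).m + 1) ⊕ Fin ((D.stair u).m + 1)) PolyS}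

theorem homogeneous_inl (hf : f ∈ hom (D.K₀ u) ((D.Kw r).shift 3) n) {m : ℤ} (hm : n = 2 * m)
    (s : Fin ((D.stair u).m + 1)) : IsWeightedHomogeneous D.deg (f 0 (Sum.inl s))
      ((m + 1) • D.c - (D.stair u).wt₁ D.deg (u.1.1 • D.deg 0 + u.1.2 • D.deg 1) s) := by
  have h := (hf (0 : Fin 2) (Sum.inl s)).1 (m + 1) (by
    change (0 - 3 : ℤ) + 2 * (m + 1) = -1 + n
    omega)
  have e : ((D.Kw r).shift 3).wt (0 : Fin 2) = 0 := rfl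
  rw [e, zero_add] at h
  exact h

theorem homogeneous_inr (hf : f ∈ hom (D.K₀ u) ((D.Kw r).shift 3) n) {m : ℤ} (hm : n + 1 = 2 * m)
    (s : Fin ((D.stair u).m + 1)) : IsWeightedHomogeneous D.deg (f 0 (Sum.inr s))
      (m • D.c - (D.stair u).wt₂ D.deg D.c (u.1.1 • D.deg 0 + u.1.2 • D.deg 1) s) := by
  have h := (hf (0 : Fin 2) (Sum.inr s)).1 m (by
    change (0 - 3 : ℤ) + 2 * m = -2 + n
    omega)
  have e : ((D.Kw r).shift 3).wt (0 : Fin 2) = 0 := rfl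
  rw [e, zero_add] at h
  exact h

theorem inl_eq_zero (hf : f ∈ hom (D.K₀ u) ((D.Kw r).shift 3) n) (hn : ¬ Even n ∨ n < 0)
    (s : Fin ((D.stair u).m + 1)) : f 0 (Sum.inl s) = 0 := by
  by_cases h : Even n
  · obtain ⟨m, hm⟩ := h
    refine eq_zero_of_not_effective (homogeneous_inl hf (m := m) (by omega) s) fun a b h => ?_
    have := (boundary_wt₁ u s).one_le h
    rcases hn with h' | h'
    · exact h' ⟨m, hm⟩
    · omega
  · refine (hf (0 : Fin 2) (Sum.inl s)).2 ?_
    change ¬ Even (-1 + n - (0 - 3))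
    rw [Int.even_iff] at *; omega

theorem inr_eq_zero (hf : f ∈ hom (D.K₀ u) ((D.Kw r).shift 3) n) (hn : Even n ∨ n < 0)
    (s : Fin ((D.stair u).m + 1)) : f 0 (Sum.inr s) = 0 := by
  by_cases h : Even n
  · refine (hf (0 : Fin 2) (Sum.inr s)).2 ?_
    change ¬ Even (-2 + n - (0 - 3))
    rw [Int.even_iff] at *; omega
  · obtain ⟨m, hm⟩ := Int.not_even_iff_odd.1 h
    refine eq_zero_of_not_effective (homogeneous_inr hf (m := m + 1) (by omega) s) fun a b h' => ?_
    have h1 : 1 ≤ m + 1 := by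
      by_cases hs : s = Fin.last _
      · subst hs
        rw [wt₂_last] at h'
        exact one_le_of_pos_sub_c u.2 h'
      · exact (boundary_wt₂ u hs).one_le h'
    have := hn.resolve_left h
    omega

/-- For $n=2m$ the row at the point is a multiple of the row of generators. A multiple of the module
generator removes it if $mc-(\mathrm{pos}\,u-c)$ is effective, which holds for $m\ge1$; for $m=0$
the multiple is the invariant assumed to vanish. For odd $n$ the row is a boundary by
`exists_vecMul_d₀_eq`, and for $n<0$ it is zero. -/
theorem exists_homotopy_K₀_Kw {ε : ℂ} (hε : ε * ε = 1)
    (hf : f ∈ hom (D.K₀ u) ((D.Kw r).shift 3) n)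
    (hc : !![0, -D.w r; -∏ s ∈ Finset.univ.erase r, D.w s, 0] * f =
      ε • (f * (D.stair u).diff))
    (h0 : n = 0 → ev r (f 0 (bot u)) = 0) :
    ∃ h ∈ hom (D.K₀ u) ((D.Kw r).shift 3) (n - 1),
      ((D.Kw r).shift 3).d * h + ε • (h * (D.K₀ u).d) = f := by
  have hrow := ev_closed_row hε hc
  have hinl : ∀ (ψ : Fin ((D.stair u).m + 1) ⊕ Fin ((D.stair u).m + 1) → PolyS) s,
      (ψ ᵥ* (D.stair u).diff) (Sum.inl s) =
        ((fun t => ψ (Sum.inr t)) ᵥ* (D.stair u).d₀.adjugate) s := by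
    intro ψ s
    simp [Staircase.diff, Matrix.vecMul, dotProduct, Fintype.sum_sum_type]
  have hinr : ∀ (ψ : Fin ((D.stair u).m + 1) ⊕ Fin ((D.stair u).m + 1) → PolyS) s,
      (ψ ᵥ* (D.stair u).diff) (Sum.inr s) =
        ((fun t => ψ (Sum.inl t)) ᵥ* (D.stair u).d₀) s := by
    intro ψ s
    simp [Staircase.diff, Matrix.vecMul, dotProduct, Fintype.sum_sum_type]
  have hgen : ∀ s, ev r ((f 0 ∘ Sum.inl ᵥ* (D.stair u).d₀) s) = 0 := by
    intro s; rw [← hrow (Sum.inr s), hinr]; rfl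
  suffices h : ∃ ψ : Fin ((D.stair u).m + 1) ⊕ Fin ((D.stair u).m + 1) → PolyS,
      ∀ s, D.w r ∣ f 0 s - ε • (ψ ᵥ* (D.stair u).diff) s by
    obtain ⟨ψ, hψ⟩ := h
    exact exists_homotopy_Kw (D.K₀ u) r hε hf hc ψ hψ
  rcases lt_or_ge n 0 with hn | hn
  · refine ⟨0, fun s => ?_⟩
    rw [Matrix.zero_vecMul, Pi.zero_apply, smul_zero, sub_zero]
    rcases s with s | s
    · rw [inl_eq_zero hf (Or.inr hn)]; exact dvd_zero _
    · rw [inr_eq_zero hf (Or.inr hn)]; exact dvd_zero _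
  by_cases he : Even n
  · obtain ⟨m, hm⟩ := he
    obtain ⟨z, hz, hz'⟩ : ∃ z, IsWeightedHomogeneous D.deg z (m • D.c - (D.pos u - D.c)) ∧
        ev r z = ε * ev r (f 0 (bot u)) := by
      by_cases hm0 : m = 0
      · exact ⟨0, isWeightedHomogeneous_zero _ _ _, by rw [h0 (by omega)]; simp⟩
      · exact exists_homogeneous_ev_eq r (exists_cls_pos_sub_c u.2 (by omega)) _
    refine ⟨Sum.elim 0 (Pi.single (Fin.last _) z), fun s => ?_⟩
    rcases s with s | s
    · rw [hinl]
      change _ ∣ _ - ε • ((Pi.single (Fin.last _) z) ᵥ* (D.stair u).d₀.adjugate) s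
      rw [Matrix.single_vecMul]
      change _ ∣ _ - ε • (z * (D.stair u).d₀.adjugate (Fin.last _) s)
      rw [(D.stair u).adjugate_d₀_last]
      refine w_dvd_sub (homogeneous_inl hf (m := m) (by omega) s) ?_ ?_
      · refine (weightedHomogeneousSubmodule ℂ D.deg _).smul_mem ε ?_
        have h1 := hz.mul (X_pow_mul_X_pow_homogeneous (D := D) ((D.stair u).e s) ((D.stair u).f s))
        rw [mem_weightedHomogeneousSubmodule]
        convert h1 using 1
        · rfl
        · rw [Staircase.wt₁, nsmul_add_nsmul, nsmul_deg_zero, nsmul_deg_one, cls_add, add_zero,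
            zero_add]
          module
      · rw [map_smul, map_mul, hz', smul_eq_mul, ← mul_assoc, ← mul_assoc, hε, one_mul]
        exact ev_eq_of_vecMul_d₀ u r (f 0 ∘ Sum.inl) hgen s
    · rw [hinr, inr_eq_zero hf (Or.inl ⟨m, hm⟩)]
      change _ ∣ 0 - ε • ((0 : Fin _ → PolyS) ᵥ* _) s
      simp
  · obtain ⟨m, hm⟩ := Int.not_even_iff_odd.1 he
    obtain ⟨α, hα⟩ := exists_vecMul_d₀_eq u r (f 0 ∘ Sum.inr) (by
      intro s; rw [← hrow (Sum.inl s), hinl]; rfl)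
    -- As $n=2m+1$ is nonnegative, $m+1\ge1$, so the required degrees are effective and homogeneous
    -- polynomials realise the prescribed values.
    choose β hβ hβ' using fun s =>
      exists_homogeneous_ev_eq r ((boundary_wt₁ u s).exists_cls (m := m + 1) (by omega)) (α s)
    refine ⟨Sum.elim (ε • β) 0, fun s => ?_⟩
    rcases s with s | s
    · rw [hinl, inl_eq_zero hf (Or.inl he)]
      change _ ∣ 0 - ε • ((0 : Fin _ → PolyS) ᵥ* _) s
      simp
    · rw [hinr]
      change _ ∣ _ - ε • ((ε • β) ᵥ* _) s
      rw [Matrix.smul_vecMul, Pi.smul_apply, smul_smul, hε, one_smul]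
      refine w_dvd_sub (homogeneous_inr hf (m := m + 1) (by omega) s) ?_ ?_
      · rw [Matrix.vecMul, dotProduct]
        refine IsWeightedHomogeneous.sum _ _ _ fun t _ => ?_
        have h1 := (hβ t).mul ((D.stair u).d₀_homogeneous rfl D.c_eq
          (u.1.1 • D.deg 0 + u.1.2 • D.deg 1) t s)
        convert h1 using 1
        abel
      · exact (hα β hβ' s).symm

end

section

variable {r s : Fin D.ℓ} {n : ℤ} {f : Matrix (Fin 2) (Fin 2) PolyS}

theorem homogeneous_zero_zero (hf : f ∈ hom ((D.Kw s).shift 3) ((D.Kw r).shift 3) n) {m : ℤ}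
    (hm : n = 2 * m) : IsWeightedHomogeneous D.deg (f 0 0) (m • D.c) := by
  have h := (hf (0 : Fin 2) (0 : Fin 2)).1 m (by
    change (0 - 3 : ℤ) + 2 * m = (0 - 3) + n
    omega)
  have e : ((D.Kw r).shift 3).wt (0 : Fin 2) = 0 := rfl
  have e' : ((D.Kw s).shift 3).wt (0 : Fin 2) = 0 := rfl
  rwa [e, e', zero_add, sub_zero] at h

theorem homogeneous_zero_one (hf : f ∈ hom ((D.Kw s).shift 3) ((D.Kw r).shift 3) n) {m : ℤ}
    (hm : n = 2 * m + 1) :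
    IsWeightedHomogeneous D.deg (f 0 1) (m • D.c + D.P • D.deg 0) := by
  have h := (hf (0 : Fin 2) (1 : Fin 2)).1 m (by
    change (0 - 3 : ℤ) + 2 * m = (-1 - 3) + n
    omega)
  have e : ((D.Kw r).shift 3).wt (0 : Fin 2) = 0 := rfl
  have e' : ((D.Kw s).shift 3).wt (1 : Fin 2) = -(D.P • D.deg 0) := rfl
  rwa [e, e', zero_add, sub_neg_eq_add] at h

theorem zero_zero_eq_zero (hf : f ∈ hom ((D.Kw s).shift 3) ((D.Kw r).shift 3) n)
    (hn : ¬ Even n ∨ n < 0) : f 0 0 = 0 := by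
  by_cases h : Even n
  · obtain ⟨m, hm⟩ := h
    refine eq_zero_of_not_effective (homogeneous_zero_zero hf (m := m) (by omega)) fun a b h => ?_
    have := nonneg_of_zsmul_c h
    rcases hn with h' | h'
    · exact h' ⟨m, hm⟩
    · omega
  · refine (hf (0 : Fin 2) (0 : Fin 2)).2 ?_
    change ¬ Even ((0 - 3) + n - (0 - 3))
    rw [Int.even_iff] at *; omega

theorem zero_one_eq_zero (hf : f ∈ hom ((D.Kw s).shift 3) ((D.Kw r).shift 3) n)
    (hn : Even n ∨ n < 0) : f 0 1 = 0 := by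
  by_cases h : Even n
  · refine (hf (0 : Fin 2) (1 : Fin 2)).2 ?_
    change ¬ Even ((-1 - 3) + n - (0 - 3))
    rw [Int.even_iff] at *; omega
  · obtain ⟨m, hm⟩ := Int.not_even_iff_odd.1 h
    refine eq_zero_of_not_effective (homogeneous_zero_one hf (m := m) (by omega)) fun a b h' => ?_
    have := nonneg_of_zsmul_c_add h'
    have := hn.resolve_left h
    omega

/-- For even $n$ closedness makes the value of the row vanish if $r\ne s$; if $r=s$ a multiple of
$W/w_s$, nonzero at the point, cancels it unless $n=0$. For odd $n$ the roles are exchanged: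
closedness suffices if $r=s$, and a multiple of $w_s$ cancels the value if $r\ne s$. -/
theorem exists_homotopy_Kw_Kw {ε : ℂ} (hε : ε * ε = 1)
    (hf : f ∈ hom ((D.Kw s).shift 3) ((D.Kw r).shift 3) n)
    (hc : !![0, -D.w r; -∏ s ∈ Finset.univ.erase r, D.w s, 0] * f =
      ε • (f * !![0, -D.w s; -∏ t ∈ Finset.univ.erase s, D.w t, 0]))
    (h0 : n = 0 → s = r → ev r (f 0 0) = 0) :
    ∃ h ∈ hom ((D.Kw s).shift 3) ((D.Kw r).shift 3) (n - 1),
      ((D.Kw r).shift 3).d * h + ε • (h * ((D.Kw s).shift 3).d) = f := by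
  have hrow := ev_closed_row hε hc
  have e0 : ∀ ψ : Fin 2 → PolyS, (ψ ᵥ* !![0, -D.w s; -∏ t ∈ Finset.univ.erase s, D.w t, 0]) 0 =
      -(ψ 1 * ∏ t ∈ Finset.univ.erase s, D.w t) := by
    intro ψ; simp [Matrix.vecMul, dotProduct, Fin.sum_univ_two]
  have e1 : ∀ ψ : Fin 2 → PolyS, (ψ ᵥ* !![0, -D.w s; -∏ t ∈ Finset.univ.erase s, D.w t, 0]) 1 =
      -(ψ 0 * D.w s) := by
    intro ψ; simp [Matrix.vecMul, dotProduct, Fin.sum_univ_two]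
  have h2 := hrow 0
  have h3 := hrow 1
  rw [e0, map_neg, neg_eq_zero, map_mul, mul_eq_zero] at h2
  rw [e1, map_neg, neg_eq_zero, map_mul, mul_eq_zero] at h3
  suffices h : ∃ ψ : Fin 2 → PolyS,
      D.w r ∣ f 0 0 + ε • (ψ 1 * ∏ t ∈ Finset.univ.erase s, D.w t) ∧
      D.w r ∣ f 0 1 + ε • (ψ 0 * D.w s) by
    obtain ⟨ψ, hψ, hψ'⟩ := h
    refine exists_homotopy_Kw ((D.Kw s).shift 3) r hε hf (by rw [shift_Kw_d]; exact hc) ψ ?_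
    rw [shift_Kw_d]
    intro i
    change Fin 2 at i
    fin_cases i
    · change _ ∣ f 0 0 - ε • (ψ ᵥ* _) 0
      rwa [e0, smul_neg, sub_neg_eq_add]
    · change _ ∣ f 0 1 - ε • (ψ ᵥ* _) 1
      rwa [e1, smul_neg, sub_neg_eq_add]
  by_cases he : Even n
  · obtain ⟨m, hm⟩ := he
    rw [zero_one_eq_zero hf (Or.inl ⟨m, hm⟩)]
    have hom := homogeneous_zero_zero hf (m := m) (by omega)
    by_cases hz : ev r (f 0 0) = 0
    · exact ⟨0, by simpa using w_dvd_of_ev_eq_zero hom hz, by simp⟩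
    · obtain rfl : s = r := by
        by_contra hsr
        exact h3.elim hz (ev_w_ne (Ne.symm hsr))
      have hm1 : 1 ≤ m := by
        by_contra hm1
        rcases lt_or_ge n 0 with hn | hn
        · exact hz (by rw [zero_zero_eq_zero hf (Or.inr hn), map_zero])
        · exact hz (h0 (by omega) rfl)
      obtain ⟨z, hz1, hz2⟩ := exists_homogeneous_ev_eq s
        (a := (m - 1) • D.c + D.P • D.deg 0) (by
          have : 0 ≤ (m - 1) * D.q := mul_nonneg (by omega) (Int.natCast_nonneg _)
          obtain ⟨k, hk⟩ := Int.eq_ofNat_of_zero_le this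
          exact ⟨D.P, k, by rw [zsmul_c, nsmul_deg_zero, cls_add, hk, zero_add, add_zero]⟩)
        (-(ε * ev s (f 0 0) / ev s (∏ t ∈ Finset.univ.erase s, D.w t)))
      refine ⟨![0, z], ?_, by simp⟩
      refine w_dvd_of_ev_eq_zero (a := m • D.c) (hom.add
        ((weightedHomogeneousSubmodule ℂ D.deg _).smul_mem ε ?_)) ?_
      · have h4 := hz1.mul (D.prod_erase_w_homogeneous s)
        rw [mem_weightedHomogeneousSubmodule]
        convert h4 using 1
        · rfl
        · module
      · have h5 := ev_prod_erase_w_self s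
        rw [map_add, map_smul, map_mul]
        change _ + ε • (ev s z * _) = 0
        rw [hz2, smul_eq_mul, neg_mul, div_mul_cancel₀ _ h5]
        linear_combination (-ev s (f 0 0)) * hε
  · obtain ⟨m, hm⟩ := Int.not_even_iff_odd.1 he
    rw [zero_zero_eq_zero hf (Or.inl he)]
    have hom := homogeneous_zero_one hf (m := m) (by omega)
    by_cases hz : ev r (f 0 1) = 0
    · exact ⟨0, by simp, by simpa using w_dvd_of_ev_eq_zero hom hz⟩
    · have hsr : r ≠ s := by
        rintro rfl
        exact h2.elim hz (ev_prod_erase_w_self r)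
      have hm1 : 0 ≤ m := by
        by_contra hm1
        exact hz (by rw [zero_one_eq_zero hf (Or.inr (by omega)), map_zero])
      obtain ⟨z, hz1, hz2⟩ := exists_homogeneous_ev_eq r (a := m • D.c) (by
          have : 0 ≤ m * D.q := mul_nonneg (by omega) (Int.natCast_nonneg _)
          obtain ⟨k, hk⟩ := Int.eq_ofNat_of_zero_le this
          exact ⟨0, k, by rw [zsmul_c, hk]; rfl⟩)
        (-(ε * ev r (f 0 1) / ev r (D.w s)))
      refine ⟨![z, 0], by simp, ?_⟩
      refine w_dvd_of_ev_eq_zero (a := m • D.c + D.P • D.deg 0) (hom.add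
        ((weightedHomogeneousSubmodule ℂ D.deg _).smul_mem ε (hz1.mul (D.w_homogeneous s)))) ?_
      have h5 := ev_w_ne hsr
      rw [map_add, map_smul, map_mul]
      change _ + ε • (ev r z * _) = 0
      rw [hz2, smul_eq_mul, neg_mul, div_mul_cancel₀ _ h5]
      linear_combination (-ev r (f 0 1)) * hε

end

end BPData
end

/-! ### Invariants of closed morphisms of degree zero -/

noncomputable section

open MvPolynomial Matrix MatFac

namespace BPData

variable {D : BPData}

/-- The generators of `K_0^{i,j}` in cohomological degree `-1`. -/
abbrev gens (v : D.V₀) (s : Fin ((D.stair v).m + 1)) : (D.K₀ v).ι := Sum.inl s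

/-- The generators of `K_0^{i,j}` in cohomological degree `-2`. -/
abbrev syz (v : D.V₀) (s : Fin ((D.stair v).m + 1)) : (D.K₀ v).ι := Sum.inr s

/-- The generator of `K_{w_r}[3]` that comes from the generator of `S` in `K_{w_r}`. -/
abbrev base (r : Fin D.ℓ) : ((D.Kw r).shift 3).ι := (0 : Fin 2)

/-- The invariant of a closed morphism of degree `0` that detects its cohomology class. -/
def inv : (u v : D.Vertex) → Matrix (D.obj v).ι (D.obj u).ι PolyS →ₗ[ℂ] PolyS
  | Sum.inl u, Sum.inl v => Matrix.entryLinearMap ℂ PolyS (top v) (top u)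
  | Sum.inl u, Sum.inr r => Algebra.linearMap ℂ PolyS ∘ₗ (ev r).toLinearMap ∘ₗ
      Matrix.entryLinearMap ℂ PolyS (0 : Fin 2) (bot u)
  | Sum.inr s, Sum.inr r => if s = r then Algebra.linearMap ℂ PolyS ∘ₗ (ev r).toLinearMap ∘ₗ
      Matrix.entryLinearMap ℂ PolyS (0 : Fin 2) (0 : Fin 2) else 0
  | Sum.inr _, Sum.inl _ => 0

/-- For $n\ne0$ the hypothesis on the invariant is void, which gives concentration in degree $0$;
for $n=0$ the statement is that the invariant detects cohomology classes. The scalar `ε` covers both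
parities. -/
theorem exists_homotopy_obj (u v : D.Vertex) {n : ℤ} {ε : ℂ} (hε : ε * ε = 1)
    {f : Matrix (D.obj v).ι (D.obj u).ι PolyS} (hf : f ∈ hom (D.obj u) (D.obj v) n)
    (hc : (D.obj v).d * f = ε • (f * (D.obj u).d)) (h0 : n = 0 → inv u v f = 0) :
    ∃ h ∈ hom (D.obj u) (D.obj v) (n - 1), (D.obj v).d * h + ε • (h * (D.obj u).d) = f := by
  have hC : ∀ z : ℂ, algebraMap ℂ PolyS z = 0 → z = 0 := fun z hz =>
    (map_eq_zero_iff _ (algebraMap ℂ PolyS).injective).1 hz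
  rcases u with u | s <;> rcases v with v | r
  · refine exists_homotopy_K₀ (D.K₀ u) v hε hf hc fun s => ?_
    by_cases h : s ≠ top u ∨ n ≠ 0
    · exact top_mem_ideal_K₀ hf h
    · push Not at h
      rw [h.1, show f (top v) (top u) = 0 from h0 h.2]
      exact Ideal.zero_mem _
  · refine exists_homotopy_K₀_Kw hε hf ?_ fun h => hC _ (h0 h)
    rw [show (D.obj (Sum.inr r)).d = _ from shift_Kw_d r] at hc
    exact hc
  · exact exists_homotopy_K₀ _ v hε hf hc fun s => top_mem_ideal_Kw hf s
  · refine exists_homotopy_Kw_Kw hε hf ?_ fun h hsr => ?_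
    · have h1 : (D.obj (Sum.inr r)).d = _ := shift_Kw_d r
      have h2 : (D.obj (Sum.inr s)).d = _ := shift_Kw_d s
      rw [h1, h2] at hc
      exact hc
    · have := h0 h
      rw [inv, if_pos hsr] at this
      exact hC _ this

theorem homogeneous_inv {u v : D.V₀} {f : Matrix (D.K₀ v).ι (D.K₀ u).ι PolyS}
    (hf : f ∈ hom (D.K₀ u) (D.K₀ v) 0) :
    IsWeightedHomogeneous D.deg (f (top v) (top u)) (D.pos v - D.pos u) := by
  have h := (hf (top v) (top u)).1 0 rfl
  rw [wt_top, wt_top] at h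
  convert h using 1
  module

theorem K₀_d_mul_top {κ : Type} (v : D.V₀) (h : Matrix (D.K₀ v).ι κ PolyS) (s : κ) :
    ((D.K₀ v).d * h) (top v) s =
      ∑ j : Fin ((D.stair v).m + 1), (D.stair v).gen j * h (gens v j) s := by
  rw [Matrix.mul_apply]
  change ∑ i : Fin _ ⊕ Fin _, (D.stair v).diff (Sum.inr (Fin.last _)) i * h i s = _
  rw [Fintype.sum_sum_type]
  simp [Staircase.diff, (D.stair v).adjugate_d₀_last]

theorem vecMul_K₀_d_inl (v : D.V₀) (φ : (D.K₀ v).ι → PolyS) (j : Fin ((D.stair v).m + 1)) :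
    (φ ᵥ* (D.K₀ v).d) (gens v j) = ∑ s, φ (syz v s) * (D.stair v).d₀.adjugate s j := by
  change ∑ i : Fin _ ⊕ Fin _, φ i * (D.stair v).diff i (Sum.inl j) = _
  rw [Fintype.sum_sum_type]
  simp [Staircase.diff]

theorem vecMul_K₀_d_inr (v : D.V₀) (φ : (D.K₀ v).ι → PolyS) (j : Fin ((D.stair v).m + 1)) :
    (φ ᵥ* (D.K₀ v).d) (syz v j) = ∑ s, φ (gens v s) * (D.stair v).d₀ s j := by
  change ∑ i : Fin _ ⊕ Fin _, φ i * (D.stair v).diff i (Sum.inr j) = _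
  rw [Fintype.sum_sum_type]
  simp [Staircase.diff]

theorem mul_K₀_d_inl {κ : Type} (v : D.V₀) (h : Matrix κ (D.K₀ v).ι PolyS) (t : κ)
    (j : Fin ((D.stair v).m + 1)) :
    (h * (D.K₀ v).d) t (gens v j) = ∑ s, h t (syz v s) * (D.stair v).d₀.adjugate s j :=
  vecMul_K₀_d_inl v (h t) j

theorem mul_K₀_d_inr {κ : Type} (v : D.V₀) (h : Matrix κ (D.K₀ v).ι PolyS) (t : κ)
    (j : Fin ((D.stair v).m + 1)) :
    (h * (D.K₀ v).d) t (syz v j) = ∑ s, h t (gens v s) * (D.stair v).d₀ s j :=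
  vecMul_K₀_d_inr v (h t) j

theorem ev_shift_Kw_d_mul {κ : Type} (r : Fin D.ℓ) (h : Matrix ((D.Kw r).shift 3).ι κ PolyS)
    (s : κ) : ev r ((((D.Kw r).shift 3).d * h) (base r) s) = 0 := by
  rw [Matrix.mul_apply, shift_Kw_d]
  change ev r (∑ i : Fin 2, !![0, -D.w r; -∏ s ∈ Finset.univ.erase r, D.w s, 0] 0 i * h i s) = 0
  rw [Fin.sum_univ_two]
  simp [ev_w_self]

/-- The entry lies in the ideal of `v`, yet its degree is the difference of two vertices, where the
ideal is zero. -/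
theorem inv_boundary_K₀ {u v : D.V₀} {h : Matrix (D.K₀ v).ι (D.K₀ u).ι PolyS}
    (hh : h ∈ hom (D.K₀ u) (D.K₀ v) (-1)) :
    ((D.K₀ v).d * h + h * (D.K₀ u).d) (top v) (top u) = 0 := by
  refine eq_zero_of_mem_ideal v u.2 (homogeneous_inv (Submodule.add_mem _ ?_ ?_)) ?_
  · simpa using mul_mem_hom hh (D.K₀ v).d_mem
  · simpa using mul_mem_hom (D.K₀ u).d_mem hh
  rw [Matrix.add_apply, K₀_d_mul_top, mul_K₀_d_inr]
  refine Ideal.add_mem _ (Ideal.sum_mem _ fun j _ => ?_) (Ideal.sum_mem _ fun j _ => ?_)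
  · exact Ideal.mul_mem_right _ _ (Ideal.subset_span ⟨j, rfl⟩)
  · exact Ideal.mul_mem_right _ _ (top_mem_ideal_K₀ hh (Or.inr (by norm_num)))

/-- The factor $w_r$ kills the contribution of the target differential at the point, and the entries
of `h` that enter the other contribution vanish in degree $-1$. -/
theorem inv_boundary_K₀_Kw {u : D.V₀} {r : Fin D.ℓ}
    {h : Matrix ((D.Kw r).shift 3).ι (D.K₀ u).ι PolyS}
    (hh : h ∈ hom (D.K₀ u) ((D.Kw r).shift 3) (-1)) :
    ev r ((((D.Kw r).shift 3).d * h + h * (D.K₀ u).d) (base r) (bot u)) = 0 := by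
  rw [Matrix.add_apply, map_add, ev_shift_Kw_d_mul, mul_K₀_d_inl, Finset.sum_eq_zero]
  · simp
  · intro j _
    rw [show h (base r) (syz u j) = 0 from inr_eq_zero hh (Or.inr (by norm_num)) j, zero_mul]

theorem inv_boundary_Kw {r : Fin D.ℓ} {h : Matrix ((D.Kw r).shift 3).ι ((D.Kw r).shift 3).ι PolyS}
    (hh : h ∈ hom ((D.Kw r).shift 3) ((D.Kw r).shift 3) (-1)) :
    ev r ((((D.Kw r).shift 3).d * h + h * ((D.Kw r).shift 3).d) (base r) (base r)) = 0 := by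
  rw [Matrix.add_apply, map_add, ev_shift_Kw_d_mul, Matrix.mul_apply,
    shift_Kw_d]
  change 0 + ev r (∑ i : Fin 2, h (0 : Fin 2) i *
    !![0, -D.w r; -∏ s ∈ Finset.univ.erase r, D.w s, 0] i 0) = 0
  rw [Fin.sum_univ_two, show h (0 : Fin 2) (1 : Fin 2) = 0 from
    zero_one_eq_zero hh (Or.inr (by norm_num))]
  simp

/-- Null-homotopic morphisms have invariant zero. -/
theorem inv_boundary (u v : D.Vertex) {h : Matrix (D.obj v).ι (D.obj u).ι PolyS}
    (hh : h ∈ hom (D.obj u) (D.obj v) (-1)) :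
    inv u v ((D.obj v).d * h + h * (D.obj u).d) = 0 := by
  rcases u with u | s <;> rcases v with v | r
  · exact inv_boundary_K₀ hh
  · exact (congrArg (algebraMap ℂ PolyS) (inv_boundary_K₀_Kw hh)).trans (map_zero _)
  · rfl
  · by_cases hsr : s = r
    · subst hsr
      rw [inv, if_pos rfl]
      exact (congrArg (algebraMap ℂ PolyS) (inv_boundary_Kw hh)).trans (map_zero _)
    · rw [inv, if_neg hsr]; rfl

theorem top_inr_eq_zero {u v : D.V₀} {f : Matrix (D.K₀ v).ι (D.K₀ u).ι PolyS}
    (hf : f ∈ hom (D.K₀ u) (D.K₀ v) 0) {t : Fin ((D.stair u).m + 1)} (ht : t ≠ Fin.last _) :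
    f (top v) (syz u t) = 0 := by
  have h := (hf (top v) (syz u t)).1 0 rfl
  refine eq_zero_of_not_effective h fun a b h' => pos_sub_ne_cls v.2 a b ?_
  rw [← h', wt_top, zero_smul, add_zero]
  congr 1
  exact (wt₂_of_ne_last u ht).symm

/-- In the matrix product only the summand through `top v` survives: the generators of degree $-1$
have the wrong parity, and the other syzygies would require a non-effective degree. -/
theorem inv_mul_inl (u v w : D.V₀) {f : Matrix (D.K₀ v).ι (D.K₀ u).ι PolyS}
    {g : Matrix (D.K₀ w).ι (D.K₀ v).ι PolyS} (hf : f ∈ hom (D.K₀ u) (D.K₀ v) 0)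
    (hg : g ∈ hom (D.K₀ v) (D.K₀ w) 0) :
    inv (Sum.inl u) (Sum.inl w) (g * f) =
      inv (Sum.inl v) (Sum.inl w) g * inv (Sum.inl u) (Sum.inl v) f := by
  change (g * f) (top w) (top u) = g (top w) (top v) * f (top v) (top u)
  rw [Matrix.mul_apply]
  refine Finset.sum_eq_single (top v) (fun s _ hs => ?_) fun h => absurd (Finset.mem_univ _) h
  rcases s with s | s
  · rw [(hf (Sum.inl s) (top u)).2, mul_zero]
    change ¬ Even ((-2 + 0 - (-1)) : ℤ)
    decide
  · rw [top_inr_eq_zero hg (fun h => hs (by rw [h])), zero_mul]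

theorem ev_inl_eq {u : D.V₀} {r : Fin D.ℓ} {f : Matrix ((D.Kw r).shift 3).ι (D.K₀ u).ι PolyS}
    (hc : ((D.Kw r).shift 3).d * f = f * (D.K₀ u).d) (s : Fin ((D.stair u).m + 1)) :
    ev r (f (base r) (gens u s)) = ev r (f (base r) (bot u)) * ev r ((D.stair u).gen s) := by
  refine ev_eq_of_vecMul_d₀ u r (fun j => f (base r) (gens u j)) (fun t => ?_) s
  have h1 := congrArg (ev r) (congrFun (congrFun hc (base r)) (syz u t))
  rw [ev_shift_Kw_d_mul, mul_K₀_d_inr] at h1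
  exact h1.symm

/-- At the point, the row of `g` is its invariant times the row of generators of `v`. Closedness of
`f` at the entry `(top v, bot u)` evaluates this row against the column of `f` as the value of `f
(top v) (top u)`. -/
theorem inv_mul_inr (u v : D.V₀) (r : Fin D.ℓ) {f : Matrix (D.K₀ v).ι (D.K₀ u).ι PolyS}
    {g : Matrix ((D.Kw r).shift 3).ι (D.K₀ v).ι PolyS} (hf : f ∈ hom (D.K₀ u) (D.K₀ v) 0)
    (hg : g ∈ hom (D.K₀ v) ((D.Kw r).shift 3) 0) (hfc : (D.K₀ v).d * f = f * (D.K₀ u).d)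
    (hgc : ((D.Kw r).shift 3).d * g = g * (D.K₀ v).d) :
    inv (Sum.inl u) (Sum.inr r) (g * f) =
      inv (Sum.inl v) (Sum.inr r) g * C (ev r (inv (Sum.inl u) (Sum.inl v) f)) := by
  change C (ev r ((g * f) (base r) (bot u))) = C (ev r (g (base r) (bot v))) * C (ev r (f (top v) (top u)))
  rw [← map_mul]
  congr 1
  have h1 := congrFun (congrFun hfc (top v)) (bot u)
  rw [K₀_d_mul_top, mul_K₀_d_inl, Finset.sum_eq_single (M := PolyS) (Fin.last (D.stair u).m)
    (fun t _ ht => by rw [top_inr_eq_zero hf ht, zero_mul])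
    (fun h => absurd (Finset.mem_univ _) h), (D.stair u).adjugate_d₀_last] at h1
  have h2 := congrArg (ev r) h1
  rw [map_mul (ev r) (f _ _), Fin.val_last, ev_gen_last, mul_one, map_sum] at h2
  rw [← h2, Matrix.mul_apply, map_sum, Finset.mul_sum]
  refine (Fintype.sum_sum_type (fun s : Fin _ ⊕ Fin _ => ev r (g (base r) s * f s (bot u)))).trans ?_
  rw [Finset.sum_eq_zero (s := Finset.univ)
    (f := fun t => ev r (g (base r) (syz v t) * f (syz v t) (bot u))), add_zero]
  · refine Finset.sum_congr rfl fun j _ => ?_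
    rw [map_mul, map_mul, ev_inl_eq hgc, mul_assoc]
  · intro t _
    rw [show g (base r) (syz v t) = 0 from inr_eq_zero hg (Or.inl Even.zero) t, zero_mul,
      map_zero]

/-- Multiplication by `F` respects the modules: `F` times a generator of the ideal of `u` comes from
a boundary degree, hence lies in the ideal of `v`. The lift is projected to degree $0$, which leaves
its entry `F` unchanged. -/
theorem exists_closed_K₀ (u v : D.V₀) {F : PolyS}
    (hF : IsWeightedHomogeneous D.deg F (D.pos v - D.pos u)) :
    ∃ f ∈ hom (D.K₀ u) (D.K₀ v) 0, (D.K₀ v).d * f = f * (D.K₀ u).d ∧ f (top v) (top u) = F := by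
  obtain ⟨f, hf, hf'⟩ : ∃ f : Matrix (D.K₀ v).ι (D.K₀ u).ι PolyS,
      (D.K₀ v).d * f = (1 : ℂ) • (f * (D.K₀ u).d) ∧ ∀ s, f (top v) s = (Pi.single (top u) F : (D.K₀ u).ι → PolyS) s :=
    (D.stair v).exists_lift (ε := 1) (D.K₀ u).d_sq (one_mul 1)
    (Pi.single (top u) F) (fun s => by
      rw [Matrix.single_vecMul]
      change F * (D.stair u).diff _ s ∈ _
      rcases s with s | s
      · change F * (D.stair u).d₀.adjugate _ s ∈ _
        rw [(D.stair u).adjugate_d₀_last]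
        refine mem_ideal_of_homogeneous v (a := (D.stair u).wt₁ D.deg
          (u.1.1 • D.deg 0 + u.1.2 • D.deg 1) s) ?_ ?_
        · have h1 := hF.mul
            (X_pow_mul_X_pow_homogeneous (D := D) ((D.stair u).e s) ((D.stair u).f s))
          convert h1 using 1
          · rfl
          · rw [Staircase.wt₁, nsmul_add_nsmul, nsmul_deg_zero, nsmul_deg_one, cls_add, add_zero,
              zero_add]
            module
        · intro w hw h
          exact (boundary_wt₁ u s).add_ne_pos 0 hw (by rw [zero_smul, add_zero, h])
      · change F * (0 : PolyS) ∈ _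
        simp)
  have hc := homProj_closed (K := D.K₀ u) (M := D.K₀ v) hf 0
  rw [one_smul] at hc
  refine ⟨homProj (D.K₀ u) (D.K₀ v) 0 f, homProj_mem _ _ _ _, hc, ?_⟩
  have h1 : f (top v) (top u) = F := (hf' _).trans (Pi.single_eq_same _ _)
  rw [homProj_apply, h1]
  refine shiftProj_of_mem ⟨fun m hm => ?_, fun h => absurd ?_ h⟩
  · obtain rfl : m = 0 := by
      change (-2 : ℤ) + 2 * m = -2 + 0 at hm
      omega
    rw [wt_top, wt_top]
    convert hF using 1
    module
  · change Even ((-2 + 0 - -2) : ℤ)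
    decide

/-- The row consists of homogeneous polynomials with the same values at the point as the generators
of the ideal. Its product with `d₀` then vanishes at the point, as it does for the generators
themselves, and homogeneity turns this into divisibility by $w_r$. -/
theorem exists_closed_Kw (u : D.V₀) (r : Fin D.ℓ) :
    ∃ f ∈ hom (D.K₀ u) ((D.Kw r).shift 3) 0,
      ((D.Kw r).shift 3).d * f = f * (D.K₀ u).d ∧ inv (Sum.inl u) (Sum.inr r) f = 1 := by
  choose β hβ hβ' using fun s : Fin ((D.stair u).m + 1) =>
    exists_homogeneous_ev_eq r ((boundary_wt₁ u s).exists_cls le_rfl) (ev r ((D.stair u).gen s))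
  obtain ⟨φ, hφ₁, hφ₂⟩ : ∃ φ : (D.K₀ u).ι → PolyS, (∀ s, φ (gens u s) = β s) ∧
      ∀ s, φ (syz u s) = 0 := ⟨Sum.elim β 0, fun _ => rfl, fun _ => rfl⟩
  obtain ⟨f, hf, hf'⟩ : ∃ f : Matrix ((D.Kw r).shift 3).ι (D.K₀ u).ι PolyS,
      ((D.Kw r).shift 3).d * f = (1 : ℂ) • (f * (D.K₀ u).d) ∧
      ∀ s, f (base r) s = φ s := by
    rw [shift_Kw_d]
    refine rankOne_exists_lift (w := -D.w r) (ε := 1) (neg_ne_zero.2 (w_ne_zero r))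
      (by rw [neg_mul_neg, w_mul_prod_erase]) (D.K₀ u).d_sq (one_mul 1) φ fun s => ?_
    rw [neg_dvd]
    rcases s with s | s
    · rw [vecMul_K₀_d_inl]
      simp [hφ₂]
    · rw [vecMul_K₀_d_inr]
      simp only [hφ₁]
      refine w_dvd_of_ev_eq_zero (a := (1 : ℤ) • D.c - (D.stair u).wt₂ D.deg D.c
        (u.1.1 • D.deg 0 + u.1.2 • D.deg 1) s) ?_ ?_
      · refine IsWeightedHomogeneous.sum _ _ _ fun t _ => ?_
        have h1 := (hβ t).mul ((D.stair u).d₀_homogeneous rfl D.c_eq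
          (u.1.1 • D.deg 0 + u.1.2 • D.deg 1) t s)
        convert h1 using 1
        abel
      · have h1 := congrArg (ev r) ((D.stair u).gen_vecMul_d₀ s)
        simp only [map_sum, map_mul, hβ'] at h1 ⊢
        rw [h1]
        split_ifs
        · change ev r D.W = 0
          rw [← w_mul_prod_erase r, map_mul, ev_w_self, zero_mul]
        · exact map_zero _
  have hc := homProj_closed (K := D.K₀ u) (M := (D.Kw r).shift 3) (f := f) (ε := 1)
    hf 0
  rw [one_smul] at hc
  refine ⟨homProj (D.K₀ u) ((D.Kw r).shift 3) 0 f, homProj_mem _ _ _ _, hc, ?_⟩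
  change algebraMap ℂ PolyS (ev r (homProj _ _ 0 f (base r) (bot u))) = 1
  rw [homProj_apply, show f (base r) (bot u) = β (Fin.last _) from (hf' _).trans (hφ₁ _),
    shiftProj_of_mem, hβ', Fin.val_last, ev_gen_last, map_one]
  refine ⟨fun m hm => ?_, fun h => absurd ?_ h⟩
  · obtain rfl : m = 1 := by
      change (0 - 3 : ℤ) + 2 * m = -1 + 0 at hm
      omega
    have e : ((D.Kw r).shift 3).wt (base r) = 0 := rfl
    rw [e, zero_add]
    exact hβ (Fin.last _)
  · change Even ((-1 + 0 - (0 - 3)) : ℤ)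
    decide

theorem inv_one (v : D.Vertex) : inv v v 1 = 1 := by
  rcases v with v | r
  · exact Matrix.one_apply_eq _
  · rw [inv, if_pos rfl]
    change algebraMap ℂ PolyS (ev r ((1 : Matrix (Fin 2) (Fin 2) PolyS) 0 0)) = 1
    simp

end BPData
end

/-! ### Components of endomorphisms of a direct sum -/

noncomputable section

open MvPolynomial Matrix

namespace MatFac

section Block

variable {L : Type} [AddCommGroup L] {δ : Fin 2 → L} {c : L} {W : PolyS}
variable {V : Type} [Fintype V] [DecidableEq V] (K : V → MatFac δ c W)

/-- The component `K u → K v` of an endomorphism of the direct sum. -/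
def block (u v : V) : Matrix (sum K).ι (sum K).ι PolyS →ₗ[ℂ] Matrix (K v).ι (K u).ι PolyS where
  toFun f := Matrix.of fun t s => f ⟨v, t⟩ ⟨u, s⟩
  map_add' _ _ := rfl
  map_smul' _ _ := rfl

/-- The endomorphism of the direct sum with given components. -/
def glue (G : ∀ u v, Matrix (K v).ι (K u).ι PolyS) : Matrix (sum K).ι (sum K).ι PolyS :=
  Matrix.of fun (t s : Σ v, (K v).ι) => G s.1 t.1 t.2 s.2

@[simp] theorem block_glue (G : ∀ u v, Matrix (K v).ι (K u).ι PolyS) (u v : V) :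
    block K u v (glue K G) = G u v := rfl

variable {K}

theorem block_ext {f g : Matrix (sum K).ι (sum K).ι PolyS}
    (h : ∀ u v, block K u v f = block K u v g) : f = g := by
  ext1 ⟨v, t⟩ ⟨u, s⟩
  exact congrFun (congrFun (h u v) t) s

theorem mem_hom_sum_iff {n : ℤ} {f : Matrix (sum K).ι (sum K).ι PolyS} :
    f ∈ hom (sum K) (sum K) n ↔ ∀ u v, block K u v f ∈ hom (K u) (K v) n :=
  ⟨fun h u v t s => h ⟨v, t⟩ ⟨u, s⟩, fun h ⟨v, t⟩ ⟨u, s⟩ => h u v t s⟩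

theorem block_mul (g f : Matrix (sum K).ι (sum K).ι PolyS) (u w : V) :
    block K u w (g * f) = ∑ v, block K v w g * block K u v f := by
  ext1 t s
  rw [Matrix.sum_apply]
  exact Fintype.sum_sigma fun i : Σ v, (K v).ι => g ⟨w, t⟩ i * f i ⟨u, s⟩

theorem block_d_self (u : V) : block K u u (sum K).d = (K u).d := by
  ext1 t s
  exact Matrix.blockDiagonal'_apply_eq (fun v => (K v).d) u t s

theorem block_d_ne {u v : V} (h : v ≠ u) : block K u v (sum K).d = 0 := by
  ext1 t s
  exact Matrix.blockDiagonal'_apply_ne (fun v => (K v).d) t s h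

theorem block_d_mul (f : Matrix (sum K).ι (sum K).ι PolyS) (u v : V) :
    block K u v ((sum K).d * f) = (K v).d * block K u v f := by
  rw [block_mul, Finset.sum_eq_single v, block_d_self]
  · intro w _ hw
    rw [block_d_ne (Ne.symm hw), Matrix.zero_mul]
  · exact fun h => absurd (Finset.mem_univ _) h

theorem block_mul_d (f : Matrix (sum K).ι (sum K).ι PolyS) (u v : V) :
    block K u v (f * (sum K).d) = block K u v f * (K u).d := by
  rw [block_mul, Finset.sum_eq_single u, block_d_self]
  · intro w _ hw
    rw [block_d_ne hw, Matrix.mul_zero]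
  · exact fun h => absurd (Finset.mem_univ _) h

theorem block_idem_self (u : V) : block K u u (idem K u : Matrix _ _ PolyS) = 1 := by
  ext1 t s
  change (Matrix.diagonal fun s => if vtx K s = u then (1 : PolyS) else 0)
    (⟨u, t⟩ : Σ v, (K v).ι) ⟨u, s⟩ = _
  rw [Matrix.one_apply]
  by_cases h : t = s
  · subst h
    rw [if_pos rfl]
    exact (Matrix.diagonal_apply_eq _ _).trans (if_pos rfl)
  · rw [if_neg h]
    exact Matrix.diagonal_apply_ne _ fun h' => h (sigma_mk_injective (β := fun v => (K v).ι) (i := u) h')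

theorem block_idem_ne {u v w : V} (h : ¬ (u = w ∧ v = w)) :
    block K u v (idem K w : Matrix _ _ PolyS) = 0 := by
  ext1 t s
  change (Matrix.diagonal fun s => if vtx K s = w then (1 : PolyS) else 0)
    (⟨v, t⟩ : Σ v, (K v).ι) ⟨u, s⟩ = 0
  refine (Matrix.diagonal_apply _ _ _).trans ?_
  split_ifs with h1 h2
  · have h3 : v = u := congrArg Sigma.fst h1
    have h4 : v = w := h2
    exact absurd ⟨h3 ▸ h4, h4⟩ h
  · rfl
  · rfl

theorem mem_blockHom_iff {u v : V} {n : ℤ} {f : Matrix (sum K).ι (sum K).ι PolyS} :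
    f ∈ blockHom K u v n ↔ f ∈ hom (sum K) (sum K) n ∧
      ∀ u' v', ¬ (u' = u ∧ v' = v) → block K u' v' f = 0 := by
  refine and_congr_right fun _ => ⟨fun h u' v' hne => ?_, fun h => ?_⟩
  · ext1 t s
    by_contra h0
    have := h ⟨v', t⟩ ⟨u', s⟩ h0
    exact hne ⟨this.2, this.1⟩
  · rintro ⟨v', t⟩ ⟨u', s⟩ h0
    by_contra hne
    exact h0 (congrFun (congrFun (h u' v' fun h' => hne ⟨h'.2, h'.1⟩) t) s)

/-- The endomorphism of the direct sum with a single non-zero component. -/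
def single (u v : V) (g : Matrix (K v).ι (K u).ι PolyS) : Matrix (sum K).ι (sum K).ι PolyS :=
  glue K (Pi.single u (Pi.single v g))

@[simp] theorem block_single_self (u v : V) (g : Matrix (K v).ι (K u).ι PolyS) :
    block K u v (single u v g) = g := by
  rw [single, block_glue, Pi.single_eq_same, Pi.single_eq_same]

theorem block_single_ne {u v u' v' : V} (h : ¬ (u' = u ∧ v' = v))
    (g : Matrix (K v).ι (K u).ι PolyS) : block K u' v' (single u v g) = 0 := by
  rw [single, block_glue]
  by_cases hu : u' = u
  · subst hu
    rw [Pi.single_eq_same, Pi.single_eq_of_ne fun hv => h ⟨rfl, hv⟩]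
  · rw [Pi.single_eq_of_ne hu]; rfl

theorem single_mem_blockHom {u v : V} {n : ℤ} {g : Matrix (K v).ι (K u).ι PolyS}
    (hg : g ∈ hom (K u) (K v) n) : single u v g ∈ blockHom K u v n := by
  refine mem_blockHom_iff.2 ⟨mem_hom_sum_iff.2 fun u' v' => ?_,
    fun u' v' h => block_single_ne h g⟩
  by_cases h : u' = u ∧ v' = v
  · obtain ⟨rfl, rfl⟩ := h
    rwa [block_single_self]
  · rw [block_single_ne h]; exact Submodule.zero_mem _

theorem single_block {u v : V} {f : Matrix (sum K).ι (sum K).ι PolyS}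
    (hf : ∀ u' v', ¬ (u' = u ∧ v' = v) → block K u' v' f = 0) : single u v (block K u v f) = f := by
  refine block_ext fun u' v' => ?_
  by_cases h : u' = u ∧ v' = v
  · obtain ⟨rfl, rfl⟩ := h
    rw [block_single_self]
  · rw [block_single_ne h, hf u' v' h]

theorem d_mul_single (u v : V) (g : Matrix (K v).ι (K u).ι PolyS) :
    (sum K).d * single u v g = single u v ((K v).d * g) := by
  refine block_ext fun u' v' => ?_
  rw [block_d_mul]
  by_cases h : u' = u ∧ v' = v
  · obtain ⟨rfl, rfl⟩ := h
    rw [block_single_self, block_single_self]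
  · rw [block_single_ne h, block_single_ne h, Matrix.mul_zero]

theorem single_mul_d (u v : V) (g : Matrix (K v).ι (K u).ι PolyS) :
    single u v g * (sum K).d = single u v (g * (K u).d) := by
  refine block_ext fun u' v' => ?_
  rw [block_mul_d]
  by_cases h : u' = u ∧ v' = v
  · obtain ⟨rfl, rfl⟩ := h
    rw [block_single_self, block_single_self]
  · rw [block_single_ne h, block_single_ne h, Matrix.zero_mul]

theorem single_add_smul (u v : V) (a b : Matrix (K v).ι (K u).ι PolyS) (ε : ℂ) :
    single u v (a + ε • b) = single u v a + ε • single u v b := by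
  refine block_ext fun u' v' => ?_
  rw [map_add, map_smul]
  by_cases h : u' = u ∧ v' = v
  · obtain ⟨rfl, rfl⟩ := h
    simp only [block_single_self]
  · rw [block_single_ne h, block_single_ne h, block_single_ne h, smul_zero, add_zero]

/-- The operation $\mu^1$ carries opposite signs in degrees $n$ and $n-1$, so one scalar `ε` with
square $1$ describes both cocycles and homotopies. -/
theorem exists_sign (n : ℤ) : ∃ ε : ℂ, ε * ε = 1 ∧ ∀ (K : MatFac δ c W) (f : Matrix K.ι K.ι PolyS),
    (f ∈ hom K K n → K.dgμ₁ f = ε • (K.d * f) - f * K.d) ∧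
    (f ∈ hom K K (n - 1) → K.dgμ₁ f = (-ε) • (K.d * f) - f * K.d) := by
  have key : ∀ (m : ℤ) (K : MatFac δ c W) (f : Matrix K.ι K.ι PolyS), f ∈ hom K K m →
      K.dgμ₁ f = m.negOnePow • (K.d * f) - f * K.d := by
    intro m K f hf
    change K.d * (K.sgn * f * K.sgn) - _ = _
    rw [K.sgn_mul_mul_sgn hf]
    rcases Int.units_eq_one_or m.negOnePow with h | h <;> simp [h, Units.neg_smul]
  rcases Int.even_or_odd n with h | h
  · refine ⟨1, one_mul 1, fun K f => ⟨fun hf => ?_, fun hf => ?_⟩⟩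
    · rw [key n K f hf, Int.negOnePow_even n h, one_smul, one_smul]
    · rw [key _ K f hf, Int.negOnePow_odd _ (h.sub_odd odd_one), Units.neg_smul, one_smul, neg_smul,
        one_smul]
  · refine ⟨-1, by norm_num, fun K f => ⟨fun hf => ?_, fun hf => ?_⟩⟩
    · rw [key n K f hf, Int.negOnePow_odd n h, Units.neg_smul, one_smul, neg_smul, one_smul]
    · rw [key _ K f hf, Int.negOnePow_even _ (h.sub_odd odd_one), one_smul, neg_neg, one_smul]

/-- The dg-category has no cohomology in a degree in which closed morphisms are null-homotopic. -/
theorem subsingleton_H_dgCat (hc : ∀ m : ℤ, m • c = 0 → m = 0) (u v : V) (n : ℤ)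
    (h : ∀ (ε : ℂ) (f : Matrix (K v).ι (K u).ι PolyS), ε * ε = 1 → f ∈ hom (K u) (K v) n →
      (K v).d * f = ε • (f * (K u).d) →
        ∃ h ∈ hom (K u) (K v) (n - 1), (K v).d * h + ε • (h * (K u).d) = f) :
    Subsingleton ((dgCat K hc).H u v n) := by
  rw [Submodule.Quotient.subsingleton_iff, Submodule.submoduleOf_eq_top]
  suffices key : ∀ f ∈ blockHom K u v n, (sum K).dgμ₁ f = 0 →
      ∃ k ∈ blockHom K u v (n - 1), (sum K).dgμ₁ k = f from fun f hf => key f hf.1 hf.2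
  intro f hf hf'
  obtain ⟨ε, hε, hμ⟩ := exists_sign (δ := δ) (c := c) (W := W) n
  obtain ⟨hfh, hf0⟩ := mem_blockHom_iff.1 hf
  rw [(hμ _ _).1 hfh, sub_eq_zero] at hf'
  obtain ⟨k, hk, hk'⟩ := h ε (block K u v f) hε (mem_hom_sum_iff.1 hfh u v) (by
    rw [← block_d_mul, ← block_mul_d, ← hf', map_smul, smul_smul, hε, one_smul])
  have hk1 := single_mem_blockHom hk
  -- In degree $n-1$ one has $\mu^1(k)=-\varepsilon\,dk-kd$. Scaling by $-\varepsilon$ turns this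
  -- into $dk+\varepsilon\,kd$, the form of the homotopy equation.
  refine ⟨(-ε) • single u v k, Submodule.smul_mem _ _ hk1, ?_⟩
  rw [map_smul, (hμ _ _).2 hk1.1, ← single_block hf0, ← hk', single_add_smul, ← d_mul_single,
    ← single_mul_d, smul_sub, smul_smul, neg_mul_neg, hε, one_smul, neg_smul, sub_neg_eq_add]

end Block

end MatFac

namespace BPData

theorem concentratedInDegreeZero_B (D : BPData) : D.B.ConcentratedInDegreeZero := fun u v n hn =>
  MatFac.subsingleton_H_dgCat _ u v n fun _ _ hε hf hc =>
    exists_homotopy_obj u v hε hf hc fun h => absurd h hn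

end BPData
end

/-! ### Invariants on the total endomorphism algebra -/

noncomputable section

open MvPolynomial Matrix MatFac

namespace BPData

variable (D : BPData)

/-- The endomorphism algebra of the sum of all objects in the cohomology category. -/
def EndAlg : Type := (MatFac.sum D.obj).H0End

instance : Ring D.EndAlg := inferInstanceAs (Ring (MatFac.sum D.obj).H0End)

instance : Algebra ℂ D.EndAlg := inferInstanceAs (Algebra ℂ (MatFac.sum D.obj).H0End)

/-- The class of a closed endomorphism. -/
def toEnd : (MatFac.sum D.obj).endCocycles →ₐ[ℂ] D.EndAlg :=
  Ideal.Quotient.mkₐ ℂ (MatFac.sum D.obj).endCoboundaries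

variable {D}

theorem toEnd_surjective : Function.Surjective D.toEnd := Ideal.Quotient.mk_surjective

theorem toEnd_eq_zero_iff (f : (MatFac.sum D.obj).endCocycles) :
    D.toEnd f = 0 ↔ f ∈ (MatFac.sum D.obj).endCoboundaries := Ideal.Quotient.eq_zero_iff_mem

/-- The invariants of the components of a closed endomorphism. -/
def invC (u v : D.Vertex) : (MatFac.sum D.obj).endCocycles →ₗ[ℂ] PolyS :=
  inv u v ∘ₗ block D.obj u v ∘ₗ (MatFac.sum D.obj).endCocycles.val.toLinearMap

theorem invC_apply (u v : D.Vertex) (f : (MatFac.sum D.obj).endCocycles) :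
    invC u v f = inv u v (block D.obj u v f) := rfl

theorem block_mem_hom (f : (MatFac.sum D.obj).endCocycles) (u v : D.Vertex) :
    block D.obj u v f ∈ hom (D.obj u) (D.obj v) 0 := mem_hom_sum_iff.1 f.2.1 u v

theorem block_closed (f : (MatFac.sum D.obj).endCocycles) (u v : D.Vertex) :
    (D.obj v).d * block D.obj u v f = block D.obj u v f * (D.obj u).d := by
  rw [← block_d_mul, ← block_mul_d, f.2.2]

/-- The differential of the direct sum acts componentwise, so homotopies of the components glue, and
each component is governed by `inv_boundary` and `exists_homotopy_obj`. -/
theorem mem_endCoboundaries_iff (f : (MatFac.sum D.obj).endCocycles) :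
    f ∈ (MatFac.sum D.obj).endCoboundaries ↔ ∀ u v, invC u v f = 0 := by
  constructor
  · rintro ⟨h, hh, e⟩ u v
    rw [invC_apply, ← e, map_add, block_d_mul, block_mul_d]
    exact inv_boundary u v (mem_hom_sum_iff.1 hh u v)
  · intro h
    choose k hk hk' using fun u v => exists_homotopy_obj u v (n := 0) (ε := 1) (one_mul 1)
      (block_mem_hom f u v) (by rw [one_smul, block_closed]) fun _ => h u v
    refine ⟨glue D.obj k, mem_hom_sum_iff.2 fun u v => hk u v, block_ext fun u v => ?_⟩
    rw [map_add, block_d_mul, block_mul_d, block_glue, ← hk' u v, one_smul]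

theorem invC_eq_of_toEnd_eq {f g : (MatFac.sum D.obj).endCocycles} (h : D.toEnd f = D.toEnd g)
    (u v : D.Vertex) : invC u v f = invC u v g := by
  rw [← sub_eq_zero, ← map_sub]
  refine (mem_endCoboundaries_iff _).1 ((toEnd_eq_zero_iff _).1 ?_) u v
  rw [map_sub, h, sub_self]

/-- The invariants of the components of an endomorphism in the cohomology category. -/
def invE (u v : D.Vertex) : D.EndAlg →ₗ[ℂ] PolyS where
  toFun e := invC u v (Function.surjInv toEnd_surjective e)
  map_add' e e' := by
    rw [← map_add]
    refine invC_eq_of_toEnd_eq ?_ u v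
    rw [map_add]
    simp only [Function.surjInv_eq toEnd_surjective]
  map_smul' z e := by
    rw [RingHom.id_apply, ← map_smul]
    refine invC_eq_of_toEnd_eq ?_ u v
    rw [map_smul]
    simp only [Function.surjInv_eq toEnd_surjective]

theorem invE_toEnd (u v : D.Vertex) (f : (MatFac.sum D.obj).endCocycles) :
    invE u v (D.toEnd f) = inv u v (block D.obj u v f) :=
  invC_eq_of_toEnd_eq (Function.surjInv_eq toEnd_surjective _) u v

/-- Reduces every identity in the endomorphism algebra to identities between polynomials. -/
theorem ext_invE {e e' : D.EndAlg} (h : ∀ u v : D.Vertex, invE u v e = invE u v e') : e = e' := by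
  obtain ⟨f, hf⟩ := toEnd_surjective (e - e')
  have h1 : f ∈ (MatFac.sum D.obj).endCoboundaries := (mem_endCoboundaries_iff f).2 fun u v => by
    rw [invC_apply, ← invE_toEnd, hf, map_sub, h, sub_self]
  rw [← sub_eq_zero, ← hf]
  exact (toEnd_eq_zero_iff f).2 h1

/-- The class of the identity of an object. -/
def idemE (v : D.Vertex) : D.EndAlg := D.toEnd (idem D.obj v)

theorem invE_idemE_self (v : D.Vertex) : invE v v (idemE v) = 1 := by
  rw [idemE, invE_toEnd, block_idem_self, inv_one]

theorem invE_idemE_ne {u v w : D.Vertex} (h : ¬ (u = w ∧ v = w)) : invE u v (idemE w) = 0 := by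
  rw [idemE, invE_toEnd, block_idem_ne h, map_zero]

theorem invE_idemE_mul_self (u v : D.Vertex) (e : D.EndAlg) :
    invE u v (idemE v * e) = invE u v e := by
  obtain ⟨f, rfl⟩ := toEnd_surjective e
  rw [idemE, ← map_mul, invE_toEnd, invE_toEnd, Subalgebra.coe_mul, block_mul,
    Finset.sum_eq_single v, block_idem_self, Matrix.one_mul]
  · intro w _ hw
    rw [block_idem_ne fun h => hw h.1, Matrix.zero_mul]
  · exact fun h => absurd (Finset.mem_univ _) h

theorem invE_idemE_mul_ne {v w : D.Vertex} (h : v ≠ w) (u : D.Vertex) (e : D.EndAlg) :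
    invE u v (idemE w * e) = 0 := by
  obtain ⟨f, rfl⟩ := toEnd_surjective e
  rw [idemE, ← map_mul, invE_toEnd, Subalgebra.coe_mul, block_mul, Finset.sum_eq_zero, map_zero]
  intro t _
  rw [block_idem_ne fun h' => h h'.2, Matrix.zero_mul]

theorem invE_mul_idemE_self (u v : D.Vertex) (e : D.EndAlg) :
    invE u v (e * idemE u) = invE u v e := by
  obtain ⟨f, rfl⟩ := toEnd_surjective e
  rw [idemE, ← map_mul, invE_toEnd, invE_toEnd, Subalgebra.coe_mul, block_mul,
    Finset.sum_eq_single u, block_idem_self, Matrix.mul_one]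
  · intro w _ hw
    rw [block_idem_ne fun h => hw h.2, Matrix.mul_zero]
  · exact fun h => absurd (Finset.mem_univ _) h

theorem invE_mul_idemE_ne {u w : D.Vertex} (h : u ≠ w) (v : D.Vertex) (e : D.EndAlg) :
    invE u v (e * idemE w) = 0 := by
  obtain ⟨f, rfl⟩ := toEnd_surjective e
  rw [idemE, ← map_mul, invE_toEnd, Subalgebra.coe_mul, block_mul, Finset.sum_eq_zero, map_zero]
  intro t _
  rw [block_idem_ne fun h' => h h'.1, Matrix.mul_zero]

theorem homogeneous_invE (u v : D.V₀) (e : D.EndAlg) :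
    IsWeightedHomogeneous D.deg (invE (Sum.inl u) (Sum.inl v) e) (D.pos v - D.pos u) := by
  obtain ⟨f, rfl⟩ := toEnd_surjective e
  rw [invE_toEnd]
  exact homogeneous_inv (block_mem_hom f (Sum.inl u) (Sum.inl v))

theorem exists_invE_eq_C (u : D.Vertex) (r : Fin D.ℓ) (e : D.EndAlg) :
    ∃ z : ℂ, invE u (Sum.inr r) e = C z := by
  obtain ⟨f, rfl⟩ := toEnd_surjective e
  rw [invE_toEnd]
  rcases u with u | s
  · exact ⟨_, rfl⟩
  · rw [inv]
    split_ifs with h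
    · exact ⟨_, rfl⟩
    · exact ⟨0, (map_zero _).symm⟩

theorem invE_inr_inr_ne {s r : Fin D.ℓ} (h : s ≠ r) (e : D.EndAlg) :
    invE (Sum.inr s) (Sum.inr r) e = 0 := by
  obtain ⟨f, rfl⟩ := toEnd_surjective e
  rw [invE_toEnd, inv, if_neg h]
  rfl

/-- The invariant of the morphism that an arrow stands for. -/
def label : D.Arrow → PolyS
  | .x _ _ => X 0
  | .y _ _ => X 1
  | .c _ _ => 1

/-- A diagonal arrow also raises the degree by $\vec x$, because $(p,j)$ and $((\ell-1)P,\,j+Q)$ are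
the same class. -/
theorem pos_xNext {v : ℕ × ℕ} (hv : v ∈ D.V₀) : D.pos (D.xNext v) = D.pos v + D.deg 0 := by
  have h := D.nsmul_deg_zero 1
  rw [one_smul] at h
  rw [h, pos, pos, cls_add, cls_eq_iff, xNext]
  obtain ⟨h1, h2, h3, h4, h5⟩ := D.mem_V₀_iff.1 hv
  have hp := D.p_eq
  have hp' := D.intCast_p
  have hR := D.intCast_sub_one_mul
  have hpos := D.p_pos
  split_ifs with hvp
  · refine ⟨1, ?_, ?_⟩
    · push_cast at hR ⊢
      rw [hR]
      have : (v.1 : ℤ) = D.p - 1 := by omega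
      rw [this, hp']; ring
    · push_cast; ring
  · exact ⟨0, by push_cast; ring, by push_cast; ring⟩

theorem pos_yNext (v : ℕ × ℕ) : D.pos (yNext v) = D.pos v + D.deg 1 := by
  have h := D.nsmul_deg_one 1
  rw [one_smul] at h
  rw [h, pos, pos, cls_add, cls_eq_iff, yNext]
  exact ⟨0, by push_cast; ring, by push_cast; ring⟩

theorem exists_arrow_hom (a : D.Arrow) : ∃ g ∈ hom (D.obj (D.src a)) (D.obj (D.tgt a)) 0,
    (D.obj (D.tgt a)).d * g = g * (D.obj (D.src a)).d ∧ inv (D.src a) (D.tgt a) g = label a := by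
  rcases a with ⟨v, h⟩ | ⟨v, h⟩ | ⟨r, h⟩
  · refine exists_closed_K₀ v ⟨_, h⟩ ?_
    rw [pos_xNext v.2, add_sub_cancel_left]
    exact isWeightedHomogeneous_X ℂ D.deg 0
  · refine exists_closed_K₀ v ⟨_, h⟩ ?_
    rw [pos_yNext, add_sub_cancel_left]
    exact isWeightedHomogeneous_X ℂ D.deg 1
  · exact exists_closed_Kw _ r

/-- A closed morphism that represents an arrow. -/
def arrowHom (a : D.Arrow) : Matrix (D.obj (D.tgt a)).ι (D.obj (D.src a)).ι PolyS :=
  (exists_arrow_hom a).choose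

theorem arrowHom_mem (a : D.Arrow) : arrowHom a ∈ hom (D.obj (D.src a)) (D.obj (D.tgt a)) 0 :=
  (exists_arrow_hom a).choose_spec.1

theorem arrowHom_closed (a : D.Arrow) :
    (D.obj (D.tgt a)).d * arrowHom a = arrowHom a * (D.obj (D.src a)).d :=
  (exists_arrow_hom a).choose_spec.2.1

theorem inv_arrowHom (a : D.Arrow) : inv (D.src a) (D.tgt a) (arrowHom a) = label a :=
  (exists_arrow_hom a).choose_spec.2.2

/-- The endomorphism of the sum of all objects that an arrow stands for. -/
def arrowC (a : D.Arrow) : (MatFac.sum D.obj).endCocycles :=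
  ⟨single (D.src a) (D.tgt a) (arrowHom a), (single_mem_blockHom (arrowHom_mem a)).1, by
    rw [d_mul_single, single_mul_d, arrowHom_closed]⟩

theorem block_arrowC_mul (a : D.Arrow) (f : Matrix (MatFac.sum D.obj).ι (MatFac.sum D.obj).ι PolyS)
    (u : D.Vertex) : block D.obj u (D.tgt a) ((arrowC a : Matrix _ _ PolyS) * f) =
      arrowHom a * block D.obj u (D.src a) f := by
  rw [block_mul, Finset.sum_eq_single (D.src a)]
  · rw [arrowC, block_single_self]
  · intro v _ hv
    rw [arrowC, block_single_ne fun h => hv h.1, Matrix.zero_mul]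
  · exact fun h => absurd (Finset.mem_univ _) h

theorem block_arrowC_mul_ne {a : D.Arrow} {w : D.Vertex} (hw : w ≠ D.tgt a)
    (f : Matrix (MatFac.sum D.obj).ι (MatFac.sum D.obj).ι PolyS) (u : D.Vertex) :
    block D.obj u w ((arrowC a : Matrix _ _ PolyS) * f) = 0 := by
  rw [block_mul]
  refine Finset.sum_eq_zero fun v _ => ?_
  rw [arrowC, block_single_ne fun h => hw h.2, Matrix.zero_mul]

theorem invE_arrow_mul_ne {a : D.Arrow} {w : D.Vertex} (hw : w ≠ D.tgt a) (u : D.Vertex)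
    (e : D.EndAlg) : invE u w (D.toEnd (arrowC a) * e) = 0 := by
  obtain ⟨f, rfl⟩ := toEnd_surjective e
  rw [← map_mul, invE_toEnd, Subalgebra.coe_mul, block_arrowC_mul_ne hw, map_zero]

theorem invE_arrow_mul (a : D.Arrow) (u : D.Vertex) (f : (MatFac.sum D.obj).endCocycles) :
    invE u (D.tgt a) (D.toEnd (arrowC a) * D.toEnd f) =
      inv u (D.tgt a) (arrowHom a * block D.obj u (D.src a) f) := by
  rw [← map_mul, invE_toEnd, Subalgebra.coe_mul, block_arrowC_mul]

theorem invE_x_mul (v : D.V₀) (h : D.xNext v ∈ D.V₀) (u : D.V₀) (e : D.EndAlg) :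
    invE (Sum.inl u) (Sum.inl ⟨_, h⟩) (D.toEnd (arrowC (.x v h)) * e) =
      X 0 * invE (Sum.inl u) (Sum.inl v) e := by
  obtain ⟨f, rfl⟩ := toEnd_surjective e
  rw [invE_toEnd]
  refine (invE_arrow_mul (.x v h) (Sum.inl u) f).trans ?_
  refine (inv_mul_inl u v ⟨_, h⟩ (block_mem_hom f (Sum.inl u) (Sum.inl v)) (arrowHom_mem (.x v h))).trans ?_
  congr 1
  exact inv_arrowHom (.x v h)

theorem invE_y_mul (v : D.V₀) (h : yNext v ∈ D.V₀) (u : D.V₀) (e : D.EndAlg) :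
    invE (Sum.inl u) (Sum.inl ⟨_, h⟩) (D.toEnd (arrowC (.y v h)) * e) =
      X 1 * invE (Sum.inl u) (Sum.inl v) e := by
  obtain ⟨f, rfl⟩ := toEnd_surjective e
  rw [invE_toEnd]
  refine (invE_arrow_mul (.y v h) (Sum.inl u) f).trans ?_
  refine (inv_mul_inl u v ⟨_, h⟩ (block_mem_hom f (Sum.inl u) (Sum.inl v)) (arrowHom_mem (.y v h))).trans ?_
  congr 1
  exact inv_arrowHom (.y v h)

theorem invE_c_mul (r : Fin D.ℓ) (h : (D.p - 1, D.q - 1) ∈ D.V₀) (u : D.V₀) (e : D.EndAlg) :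
    invE (Sum.inl u) (Sum.inr r) (D.toEnd (arrowC (.c r h)) * e) =
      C (ev r (invE (Sum.inl u) (Sum.inl ⟨_, h⟩) e)) := by
  obtain ⟨f, rfl⟩ := toEnd_surjective e
  rw [invE_toEnd]
  refine (invE_arrow_mul (.c r h) (Sum.inl u) f).trans ?_
  refine (inv_mul_inr u ⟨_, h⟩ r (block_mem_hom f (Sum.inl u) (Sum.inl _))
    (arrowHom_mem (.c r h)) (block_closed f (Sum.inl u) (Sum.inl _)) (arrowHom_closed (.c r h))).trans ?_
  exact (congrArg (· * C (ev r (inv (Sum.inl u) (Sum.inl ⟨_, h⟩)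
    (block D.obj (Sum.inl u) (Sum.inl ⟨_, h⟩) f)))) (inv_arrowHom (.c r h))).trans (one_mul _)

end BPData
end

/-! ### Spanning paths in the quiver algebra -/

noncomputable section

open MvPolynomial

namespace PathAlgebra

variable {V E : Type} [Fintype V] (src tgt : E → V)

theorem vertex_mul_self (v : V) : vertex src tgt v * vertex src tgt v = vertex src tgt v := by
  rw [vertex, ← map_mul]
  exact RingQuot.mkAlgHom_rel ℂ (PathRel.idem v)

theorem vertex_mul_ne {u v : V} (h : u ≠ v) : vertex src tgt u * vertex src tgt v = 0 := by
  rw [vertex, vertex, ← map_mul]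
  exact (RingQuot.mkAlgHom_rel ℂ (PathRel.orth u v h)).trans (map_zero _)

theorem sum_vertex : ∑ v, vertex src tgt v = 1 := by
  simp only [vertex]
  rw [← map_sum]
  exact (RingQuot.mkAlgHom_rel ℂ PathRel.one).trans (map_one _)

theorem vertex_mul_arrow (a : E) :
    vertex src tgt (tgt a) * arrow src tgt a = arrow src tgt a := by
  rw [vertex, arrow, ← map_mul]
  exact RingQuot.mkAlgHom_rel ℂ (PathRel.tgt a)

theorem arrow_mul_vertex (a : E) :
    arrow src tgt a * vertex src tgt (src a) = arrow src tgt a := by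
  rw [vertex, arrow, ← map_mul]
  exact RingQuot.mkAlgHom_rel ℂ (PathRel.src a)

end PathAlgebra

namespace BPData

variable (D : BPData)

/-- The ends of the arrows labelled `x` (for `i = 0`) and `y` (for `i = 1`). -/
def next : Fin 2 → ℕ × ℕ → ℕ × ℕ
  | 0 => D.xNext
  | 1 => yNext

variable {D}

/-- The arrows labelled `x` (for `i = 0`) and `y` (for `i = 1`). -/
def step : (i : Fin 2) → (v : D.V₀) → D.next i v ∈ D.V₀ → D.Arrow
  | 0, v, h => .x v h
  | 1, v, h => .y v h

theorem src_step (i : Fin 2) (v : D.V₀) (h : D.next i v ∈ D.V₀) :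
    D.src (step i v h) = Sum.inl v := by
  fin_cases i <;> rfl

theorem tgt_step (i : Fin 2) (v : D.V₀) (h : D.next i v ∈ D.V₀) :
    D.tgt (step i v h) = Sum.inl ⟨_, h⟩ := by
  fin_cases i <;> rfl

theorem pos_next (i : Fin 2) {v : ℕ × ℕ} (hv : v ∈ D.V₀) :
    D.pos (D.next i v) = D.pos v + D.deg i := by
  fin_cases i
  · exact pos_xNext hv
  · exact pos_yNext v

theorem deg_zero_eq : D.deg 0 = D.cls 1 0 := rfl

theorem deg_one_eq : D.deg 1 = D.cls 0 1 := rfl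

/-- The degree before $w$ has the window representative $(p-1,B-Q)$ or $(A-1,B)$. It fails to be a
vertex only when it falls in the first column at height at most $Q$, and it is then a boundary
degree; in the diagonal case this needs $P=1$. -/
theorem exists_pred_zero {w : ℕ × ℕ} (hw : w ∈ D.V₀) :
    (∃ v ∈ D.V₀, D.xNext v = w) ∨ D.Boundary (D.pos w - D.deg 0) := by
  obtain ⟨h1, h2, h3, h4, h5⟩ := D.mem_V₀_iff.1 hw
  have hP : (1 : ℤ) ≤ D.P := by exact_mod_cast D.P_pos
  have hR := D.intCast_sub_one_mul
  have hp' := D.intCast_p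
  have hℓP : (D.ℓ : ℤ) * D.P = (D.ℓ - 1) * D.P + D.P := by ring
  have hpos := D.p_pos
  have h0 : (0 : ℤ) ≤ ((D.ℓ : ℤ) - 1) * D.P := by rw [← hR]; positivity
  obtain ⟨A, B⟩ := w
  dsimp only at h1 h2 h3 h4 h5
  rw [pos, deg_zero_eq, cls_sub]
  rcases h1.eq_or_lt with hA | hA
  · have h6 := h5 hA.symm
    by_cases h7 : (D.P : ℤ) = 1 ∧ B ≤ D.Q + D.Q
    · right
      refine ⟨(D.ℓ - 1) * D.P, B - D.Q, D.cls_eq_iff.2 ⟨1, ?_, ?_⟩, Or.inl ⟨rfl, ?_, ?_⟩⟩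
      · push_cast
        rw [← hA]
        linarith [h7.1]
      · push_cast; ring
      · omega
      · omega
    · left
      refine ⟨(D.p - 1, B - D.Q), D.mem_V₀_iff.2 ⟨?_, ?_, ?_, ?_, ?_⟩, ?_⟩
      · push_cast [hpos]; omega
      · push_cast [hpos]; omega
      · dsimp only; omega
      · dsimp only; omega
      · dsimp only
        intro h
        push_cast [hpos] at h
        omega
      · rw [xNext, if_pos rfl]
        refine Prod.ext ?_ ?_
        · exact_mod_cast hR.trans hA
        · dsimp only; omega
  · by_cases h7 : (A : ℤ) - 1 = (D.ℓ - 1) * D.P ∧ B ≤ D.Q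
    · right
      refine ⟨A - 1, B, by rw [sub_zero], Or.inl ⟨h7.1, by omega, by exact_mod_cast h7.2⟩⟩
    · left
      have hA1 : 1 ≤ A := by omega
      refine ⟨(A - 1, B), D.mem_V₀_iff.2 ⟨?_, ?_, ?_, ?_, ?_⟩, ?_⟩
      · push_cast [hA1]; omega
      · push_cast [hA1]; omega
      · exact h3
      · exact h4
      · dsimp only
        intro h
        push_cast [hA1] at h
        omega
      · rw [xNext, if_neg (by dsimp only; omega)]
        refine Prod.ext ?_ rfl
        dsimp only; omega

theorem exists_pred_one {w : ℕ × ℕ} (hw : w ∈ D.V₀) :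
    (∃ v ∈ D.V₀, yNext v = w) ∨ D.Boundary (D.pos w - D.deg 1) := by
  obtain ⟨h1, h2, h3, h4, h5⟩ := D.mem_V₀_iff.1 hw
  obtain ⟨A, B⟩ := w
  dsimp only at h1 h2 h3 h4 h5
  rw [pos, deg_one_eq, cls_sub, sub_zero]
  by_cases h6 : 2 ≤ B ∧ ((A : ℤ) = (D.ℓ - 1) * D.P → D.Q + 2 ≤ B)
  · left
    refine ⟨(A, B - 1), D.mem_V₀_iff.2 ⟨h1, h2, ?_, ?_, ?_⟩, ?_⟩
    · dsimp only; omega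
    · dsimp only; omega
    · intro h
      have := h6.2 h
      dsimp only; omega
    · rw [yNext]
      refine Prod.ext rfl ?_
      dsimp only; omega
  · right
    rcases h1.eq_or_lt with hA | hA
    · exact ⟨A, B - 1, rfl, Or.inl ⟨hA.symm, by omega, by have := h5 hA.symm; omega⟩⟩
    · exact ⟨A, B - 1, rfl, Or.inr ⟨hA, h2, by omega⟩⟩

/-- A vertex that is not the end of an arrow of a given kind lies just above the boundary. -/
theorem exists_pred (i : Fin 2) (w : D.V₀) :
    (∃ v : D.V₀, D.next i v = w) ∨ D.Boundary (D.pos w - D.deg i) := by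
  have key : (∃ v ∈ D.V₀, D.next i v = w) ∨ D.Boundary (D.pos w - D.deg i) := by
    fin_cases i
    · exact exists_pred_zero w.2
    · exact exists_pred_one w.2
  exact key.imp_left fun ⟨v, hv, h⟩ => ⟨⟨v, hv⟩, h⟩

/-- The corner lies in the first column only if $P=1$. The given vertex then lies there too, and its
height shows $q-1>Q$. -/
theorem corner_mem (u : D.V₀) : (D.p - 1, D.q - 1) ∈ D.V₀ := by
  obtain ⟨h1, h2, h3, h4, h5⟩ := D.mem_V₀_iff.1 u.2
  have hP : (1 : ℤ) ≤ D.P := by exact_mod_cast D.P_pos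
  have hp' := D.intCast_p
  have hℓP : (D.ℓ : ℤ) * D.P = (D.ℓ - 1) * D.P + D.P := by ring
  have hpos := D.p_pos
  refine D.mem_V₀_iff.2 ⟨?_, ?_, ?_, ?_, ?_⟩
  · push_cast [hpos]; omega
  · push_cast [hpos]; omega
  · dsimp only; omega
  · dsimp only; omega
  · dsimp only
    intro h
    push_cast [hpos] at h
    have := h5 (by omega)
    omega

theorem vertex_mul_self (v : D.Vertex) : D.vertex v * D.vertex v = D.vertex v := by
  rw [vertex, ← map_mul, PathAlgebra.vertex_mul_self]

theorem vertex_mul_ne {u v : D.Vertex} (h : u ≠ v) : D.vertex u * D.vertex v = 0 := by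
  rw [vertex, vertex, ← map_mul, PathAlgebra.vertex_mul_ne _ _ h, map_zero]

theorem sum_vertex : ∑ v, D.vertex v = 1 := by
  simp only [vertex]
  rw [← map_sum, PathAlgebra.sum_vertex, map_one]

variable (D) in
/-- The class of an arrow in the algebra of the quiver with relations. -/
def arrow (a : D.Arrow) : D.QuiverAlgebra :=
  RingQuot.mkAlgHom ℂ D.QuiverRel (PathAlgebra.arrow D.src D.tgt a)

theorem vertex_tgt_mul (a : D.Arrow) : D.vertex (D.tgt a) * D.arrow a = D.arrow a := by
  rw [vertex, arrow, ← map_mul, PathAlgebra.vertex_mul_arrow]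

theorem arrow_mul_vertex_src (a : D.Arrow) : D.arrow a * D.vertex (D.src a) = D.arrow a := by
  rw [vertex, arrow, ← map_mul, PathAlgebra.arrow_mul_vertex]

theorem vertex_mul_arrow_ne {v : D.Vertex} {a : D.Arrow} (h : v ≠ D.tgt a) :
    D.vertex v * D.arrow a = 0 := by
  rw [← vertex_tgt_mul, ← mul_assoc, vertex_mul_ne h, zero_mul]

theorem arrow_mul_vertex_ne {v : D.Vertex} {a : D.Arrow} (h : D.src a ≠ v) :
    D.arrow a * D.vertex v = 0 := by
  rw [← arrow_mul_vertex_src, mul_assoc, vertex_mul_ne h, mul_zero]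

variable (D) in
/-- The sum of the arrows labelled `x` (for `i = 0`) or `y` (for `i = 1`). -/
def gen (i : Fin 2) : D.QuiverAlgebra :=
  ∑ v : D.V₀, if h : D.next i v ∈ D.V₀ then D.arrow (step i v h) else 0

theorem gen_zero : D.gen 0 = RingQuot.mkAlgHom ℂ D.QuiverRel D.xSum := by
  rw [gen, xSum, map_sum]
  refine Finset.sum_congr rfl fun v _ => ?_
  by_cases h : D.xNext v ∈ D.V₀
  · rw [dif_pos h]
    exact dif_pos (c := D.next 0 v ∈ D.V₀) h
  · rw [dif_neg h, map_zero]
    exact dif_neg (c := D.next 0 v ∈ D.V₀) h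

theorem gen_one : D.gen 1 = RingQuot.mkAlgHom ℂ D.QuiverRel D.ySum := by
  rw [gen, ySum, map_sum]
  refine Finset.sum_congr rfl fun v _ => ?_
  by_cases h : yNext v ∈ D.V₀
  · rw [dif_pos h]
    exact dif_pos (c := D.next 1 v ∈ D.V₀) h
  · rw [dif_neg h, map_zero]
    exact dif_neg (c := D.next 1 v ∈ D.V₀) h

theorem gen_comm : Commute (D.gen 0) (D.gen 1) := by
  rw [Commute, SemiconjBy, gen_zero, gen_one, ← map_mul, ← map_mul]
  exact RingQuot.mkAlgHom_rel ℂ QuiverRel.comm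

theorem arrow_c_mul (r : Fin D.ℓ) (h : (D.p - 1, D.q - 1) ∈ D.V₀) :
    D.arrow (.c r h) * D.gen 0 ^ D.P = D.root r • (D.arrow (.c r h) * D.gen 1 ^ D.Q) := by
  have h1 := RingQuot.mkAlgHom_rel ℂ (QuiverRel.c (D := D) r h)
  rw [map_zero, map_mul, map_sub, map_smul, map_pow, map_pow, ← gen_zero, ← gen_one] at h1
  rw [← mul_smul_comm, ← sub_eq_zero]
  exact (mul_sub (D.arrow (.c r h)) (D.gen 0 ^ D.P) (D.root r • D.gen 1 ^ D.Q)).symm.trans h1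

theorem gen_mul_vertex_inl (i : Fin 2) (v : D.V₀) : D.gen i * D.vertex (Sum.inl v) =
    if h : D.next i v ∈ D.V₀ then D.arrow (step i v h) else 0 := by
  rw [gen, Finset.sum_mul, Finset.sum_eq_single v]
  · split_ifs with h
    · rw [← src_step i v h, arrow_mul_vertex_src]
    · exact zero_mul _
  · intro w _ hw
    split_ifs with h
    · refine arrow_mul_vertex_ne fun h' => hw ?_
      rw [src_step] at h'
      exact Sum.inl_injective h'
    · exact zero_mul _
  · exact fun h => absurd (Finset.mem_univ _) h

/-- `z` is zero or ends at the vertex with degree `a`. -/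
def EndsAt (z : D.QuiverAlgebra) (a : D.L) : Prop :=
  z = 0 ∨ ∃ w : D.V₀, D.pos w = a ∧ D.vertex (Sum.inl w) * z = z

theorem EndsAt.gen_mul {z : D.QuiverAlgebra} {a : D.L} (h : EndsAt z a) (i : Fin 2) :
    EndsAt (D.gen i * z) (a + D.deg i) := by
  rcases h with rfl | ⟨w, rfl, hw⟩
  · exact Or.inl (mul_zero _)
  · rw [← hw, ← mul_assoc, gen_mul_vertex_inl]
    split_ifs with h
    · refine Or.inr ⟨⟨_, h⟩, pos_next i w.2, ?_⟩
      rw [← tgt_step, ← mul_assoc, vertex_tgt_mul]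
    · exact Or.inl (zero_mul _)

theorem EndsAt.vertex_mul {z : D.QuiverAlgebra} {a : D.L} (h : EndsAt z a) (v : D.V₀)
    (hv : D.pos v = a) : D.vertex (Sum.inl v) * z = z := by
  rcases h with rfl | ⟨w, hw, h⟩
  · exact mul_zero _
  · obtain rfl : w = v := Subtype.ext (D.pos_inj w.2 v.2 (hw.trans hv.symm))
    exact h

theorem EndsAt.vertex_mul_ne {z : D.QuiverAlgebra} {a : D.L} (h : EndsAt z a) (v : D.V₀)
    (hv : D.pos v ≠ a) : D.vertex (Sum.inl v) * z = 0 := by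
  rcases h with rfl | ⟨w, hw, h⟩
  · exact mul_zero _
  · rw [← h, ← mul_assoc, BPData.vertex_mul_ne, zero_mul]
    intro h'
    exact hv (Sum.inl_injective h' ▸ hw)

theorem EndsAt.vertex_inr_mul {z : D.QuiverAlgebra} {a : D.L} (h : EndsAt z a) (r : Fin D.ℓ) :
    D.vertex (Sum.inr r) * z = 0 := by
  rcases h with rfl | ⟨w, hw, h⟩
  · exact mul_zero _
  · rw [← h, ← mul_assoc, BPData.vertex_mul_ne Sum.inr_ne_inl, zero_mul]

/-- The path `x^a y^b` that starts at `u`. -/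
def mon (a b : ℕ) (u : D.V₀) : D.QuiverAlgebra :=
  D.gen 0 ^ a * D.gen 1 ^ b * D.vertex (Sum.inl u)

theorem gen_zero_mul_mon (a b : ℕ) (u : D.V₀) : D.gen 0 * mon a b u = mon (a + 1) b u := by
  rw [mon, mon, pow_succ', mul_assoc, mul_assoc, mul_assoc]

theorem gen_one_mul_mon (a b : ℕ) (u : D.V₀) : D.gen 1 * mon a b u = mon a (b + 1) u := by
  rw [mon, mon, pow_succ', ← mul_assoc, ← mul_assoc, ← mul_assoc, (gen_comm.pow_left a).eq]

theorem mon_zero (u : D.V₀) : mon 0 0 u = D.vertex (Sum.inl u) := by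
  rw [mon, pow_zero, pow_zero, one_mul, one_mul]

theorem endsAt_mon (a b : ℕ) (u : D.V₀) : EndsAt (mon a b u) (D.pos u + D.cls a b) := by
  induction a with
  | zero =>
    induction b with
    | zero =>
      refine Or.inr ⟨u, ?_, ?_⟩
      · rw [Nat.cast_zero, cls_zero, add_zero]
      · rw [mon_zero, vertex_mul_self]
    | succ b ih =>
      rw [← gen_one_mul_mon]
      convert ih.gen_mul 1 using 1
      rw [deg_one_eq, add_assoc, cls_add]
      push_cast; rfl
  | succ a ih =>
    rw [← gen_zero_mul_mon]
    convert ih.gen_mul 0 using 1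
    rw [deg_zero_eq, add_assoc, cls_add]
    push_cast; rfl

/-- A subspace that is stable under left multiplication by vertices and arrows is a left ideal. -/
theorem mul_mem_of_stable (T : Submodule ℂ D.QuiverAlgebra)
    (hv : ∀ v, ∀ z ∈ T, D.vertex v * z ∈ T) (ha : ∀ a, ∀ z ∈ T, D.arrow a * z ∈ T)
    (t : D.QuiverAlgebra) : ∀ z ∈ T, t * z ∈ T := by
  obtain ⟨t, rfl⟩ := RingQuot.mkAlgHom_surjective ℂ D.QuiverRel t
  obtain ⟨t, rfl⟩ := RingQuot.mkAlgHom_surjective ℂ (PathRel D.src D.tgt) t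
  induction t using FreeAlgebra.induction with
  | grade0 c =>
    intro z hz
    rw [AlgHom.commutes, AlgHom.commutes, ← Algebra.smul_def]
    exact T.smul_mem c hz
  | grade1 s =>
    intro z hz
    rcases s with v | a
    · exact hv v z hz
    · exact ha a z hz
  | mul f g hf hg =>
    intro z hz
    rw [map_mul, map_mul, mul_assoc]
    exact hf _ (hg _ hz)
  | add f g hf hg =>
    intro z hz
    rw [map_add, map_add, add_mul]
    exact T.add_mem (hf _ hz) (hg _ hz)

/-- The left ideal of all paths that start at `u`. -/
def pathsFrom (u : D.V₀) : Submodule ℂ D.QuiverAlgebra :=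
  Submodule.span ℂ ({z | ∃ a b, z = mon a b u} ∪
    {z | ∃ r h a b, z = D.arrow (.c r h) * mon a b u})

theorem mon_mem_pathsFrom (a b : ℕ) (u : D.V₀) : mon a b u ∈ pathsFrom u :=
  Submodule.subset_span (Or.inl ⟨a, b, rfl⟩)

/-- The span is stable under left multiplication by vertices and arrows: an arrow $x$ or $y$ extends
a monomial path or kills it, and no arrow can follow a $c_r$. -/
theorem mul_vertex_mem_pathsFrom (t : D.QuiverAlgebra) (u : D.V₀) :
    t * D.vertex (Sum.inl u) ∈ pathsFrom u := by
  have hc : ∀ r h a b, D.arrow (.c r h) * mon a b u ∈ pathsFrom u := fun r h a b =>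
    Submodule.subset_span (Or.inr ⟨r, h, a, b, rfl⟩)
  have hvm : ∀ v a b, D.vertex (Sum.inl v) * mon a b u = mon a b u ∨
      D.vertex (Sum.inl v) * mon a b u = 0 := fun v a b => by
    by_cases h : D.pos v = D.pos u + D.cls a b
    · exact Or.inl ((endsAt_mon a b u).vertex_mul v h)
    · exact Or.inr ((endsAt_mon a b u).vertex_mul_ne v h)
  have hstep : ∀ i v h a b, D.arrow (step i v h) * mon a b u ∈ pathsFrom u := by
    intro i v h a b
    rw [show D.arrow (step i v h) = D.gen i * D.vertex (Sum.inl v) by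
      rw [gen_mul_vertex_inl, dif_pos h], mul_assoc]
    rcases hvm v a b with e | e
    · rw [e]
      fin_cases i
      · exact (gen_zero_mul_mon a b u) ▸ mon_mem_pathsFrom _ _ _
      · exact (gen_one_mul_mon a b u) ▸ mon_mem_pathsFrom _ _ _
    · rw [e, mul_zero]; exact Submodule.zero_mem _
  have hspan : ∀ s : D.QuiverAlgebra, (∀ a b, s * mon a b u ∈ pathsFrom u) →
      (∀ r h a b, s * (D.arrow (.c r h) * mon a b u) ∈ pathsFrom u) →
      ∀ z ∈ pathsFrom u, s * z ∈ pathsFrom u := by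
    intro s h1 h2 z hz
    induction hz using Submodule.span_induction with
    | mem z hz =>
      rcases hz with ⟨a, b, rfl⟩ | ⟨r, h, a, b, rfl⟩
      · exact h1 a b
      · exact h2 r h a b
    | zero => rw [mul_zero]; exact Submodule.zero_mem _
    | add x y _ _ hx hy => rw [mul_add]; exact Submodule.add_mem _ hx hy
    | smul c x _ hx => rw [mul_smul_comm]; exact Submodule.smul_mem _ _ hx
  refine mul_mem_of_stable (pathsFrom u) (fun v => hspan _ ?_ ?_) (fun α => hspan _ ?_ ?_) t _
    (mon_zero u ▸ mon_mem_pathsFrom 0 0 u)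
  · intro a b
    rcases v with v | r
    · rcases hvm v a b with e | e
      · rw [e]; exact mon_mem_pathsFrom a b u
      · rw [e]; exact Submodule.zero_mem _
    · rw [(endsAt_mon a b u).vertex_inr_mul]; exact Submodule.zero_mem _
  · intro r h a b
    rw [← mul_assoc]
    by_cases hv : v = D.tgt (.c r h)
    · rw [hv, vertex_tgt_mul]; exact hc r h a b
    · rw [vertex_mul_arrow_ne hv, zero_mul]; exact Submodule.zero_mem _
  · intro a b
    rcases α with ⟨v, h⟩ | ⟨v, h⟩ | ⟨r, h⟩
    · exact hstep 0 v h a b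
    · exact hstep 1 v h a b
    · exact hc r h a b
  · intro r h a b
    rw [← vertex_tgt_mul (.c r h), ← mul_assoc, ← mul_assoc, arrow_mul_vertex_ne, zero_mul,
      zero_mul]
    · exact Submodule.zero_mem _
    · rcases α with ⟨v, _⟩ | ⟨v, _⟩ | ⟨s, _⟩ <;> exact Sum.inl_ne_inr

/-- No arrow starts at the vertex of $K_{w_r}[3]$, so the line spanned by its idempotent is already
a left ideal. -/
theorem exists_mul_vertex_inr (t : D.QuiverAlgebra) (r : Fin D.ℓ) :
    ∃ c : ℂ, t * D.vertex (Sum.inr r) = c • D.vertex (Sum.inr r) := by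
  have h := mul_mem_of_stable (Submodule.span ℂ {D.vertex (Sum.inr r)}) (fun v z hz => by
    obtain ⟨c, rfl⟩ := Submodule.mem_span_singleton.1 hz
    rw [mul_smul_comm]
    by_cases hv : v = Sum.inr r
    · rw [hv, vertex_mul_self]; exact hz
    · rw [vertex_mul_ne hv, smul_zero]; exact Submodule.zero_mem _) (fun α z hz => by
    obtain ⟨c, rfl⟩ := Submodule.mem_span_singleton.1 hz
    rw [mul_smul_comm, arrow_mul_vertex_ne, smul_zero]
    · exact Submodule.zero_mem _
    · rcases α with ⟨v, _⟩ | ⟨v, _⟩ | ⟨s, _⟩ <;> exact Sum.inl_ne_inr) t _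
    (Submodule.mem_span_singleton_self _)
  obtain ⟨c, hc⟩ := Submodule.mem_span_singleton.1 h
  exact ⟨c, hc.symm⟩

end BPData
end

/-! ### The representation of the quiver algebra in cohomology -/

noncomputable section

open MvPolynomial Matrix MatFac

namespace BPData

variable {D : BPData}

/-- The class of the morphism that an arrow stands for. -/
def arrowE (a : D.Arrow) : D.EndAlg := D.toEnd (arrowC a)

theorem invE_arrowE_ne_tgt {a : D.Arrow} {v : D.Vertex} (h : v ≠ D.tgt a) (u : D.Vertex) :
    invE u v (arrowE a) = 0 := by
  rw [← mul_one (arrowE a)]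
  exact invE_arrow_mul_ne h u 1

theorem invE_arrowE_ne_src {a : D.Arrow} {u : D.Vertex} (h : u ≠ D.src a) (v : D.Vertex) :
    invE u v (arrowE a) = 0 := by
  rw [arrowE, invE_toEnd, arrowC, block_single_ne fun h' => h h'.1, map_zero]

theorem idemE_mul_self (v : D.Vertex) : idemE v * idemE v = idemE v := by
  refine ext_invE fun u w => ?_
  by_cases h : w = v
  · subst h; rw [invE_idemE_mul_self]
  · rw [invE_idemE_mul_ne h, invE_idemE_ne fun h' => h h'.2]

theorem idemE_mul_ne {u v : D.Vertex} (h : u ≠ v) : idemE u * idemE v = 0 := by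
  refine ext_invE fun a b => ?_
  rw [map_zero]
  by_cases hb : b = u
  · subst hb
    rw [invE_idemE_mul_self, invE_idemE_ne fun h' => h h'.2]
  · rw [invE_idemE_mul_ne hb]

theorem sum_idemE : ∑ v : D.Vertex, idemE v = 1 := by
  refine ext_invE fun u v => ?_
  rw [← invE_idemE_mul_self u v 1, mul_one, map_sum, Finset.sum_eq_single v]
  · exact fun w _ hw => invE_idemE_ne fun h => hw h.2.symm
  · exact fun h => absurd (Finset.mem_univ _) h

theorem idemE_tgt_mul (a : D.Arrow) : idemE (D.tgt a) * arrowE a = arrowE a := by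
  refine ext_invE fun u v => ?_
  by_cases h : v = D.tgt a
  · rw [h, invE_idemE_mul_self]
  · rw [invE_idemE_mul_ne h, invE_arrowE_ne_tgt h]

theorem arrowE_mul_idemE_src (a : D.Arrow) : arrowE a * idemE (D.src a) = arrowE a := by
  refine ext_invE fun u v => ?_
  by_cases h : u = D.src a
  · rw [h, invE_mul_idemE_self]
  · rw [invE_mul_idemE_ne h, invE_arrowE_ne_src h]

theorem arrowE_mul_idemE_ne {v : D.Vertex} {a : D.Arrow} (h : D.src a ≠ v) :
    arrowE a * idemE v = 0 := by
  rw [← arrowE_mul_idemE_src, mul_assoc, idemE_mul_ne h, mul_zero]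

variable (D) in
/-- The representation of the path algebra in the cohomology category. -/
def pathHom : PathAlgebra D.src D.tgt →ₐ[ℂ] D.EndAlg :=
  RingQuot.liftAlgHom ℂ ⟨FreeAlgebra.lift ℂ (Sum.elim idemE arrowE), by
    intro a b h
    induction h with
    | idem v => simp [idemE_mul_self]
    | orth u v h => simp [idemE_mul_ne h]
    | one =>
      simp only [map_sum, FreeAlgebra.lift_ι_apply, map_one]
      exact sum_idemE
    | tgt a => simp [idemE_tgt_mul]
    | src a => simp [arrowE_mul_idemE_src]⟩

theorem pathHom_vertex (v : D.Vertex) :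
    D.pathHom (PathAlgebra.vertex D.src D.tgt v) = idemE v := by
  rw [pathHom, PathAlgebra.vertex, RingQuot.liftAlgHom_mkAlgHom_apply]
  simp

theorem pathHom_arrow (a : D.Arrow) :
    D.pathHom (PathAlgebra.arrow D.src D.tgt a) = arrowE a := by
  rw [pathHom, PathAlgebra.arrow, RingQuot.liftAlgHom_mkAlgHom_apply]
  simp

variable (D) in
/-- The sum of the morphisms that the arrows labelled `x` (or `y`) stand for. -/
def genE (i : Fin 2) : D.EndAlg :=
  ∑ v : D.V₀, if h : D.next i v ∈ D.V₀ then arrowE (step i v h) else 0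

theorem pathHom_xSum : D.pathHom D.xSum = D.genE 0 := by
  rw [genE, xSum, map_sum]
  refine Finset.sum_congr rfl fun v _ => ?_
  by_cases h : D.xNext v ∈ D.V₀
  · rw [dif_pos h, pathHom_arrow]
    symm; exact dif_pos (c := D.next 0 v ∈ D.V₀) h
  · rw [dif_neg h, map_zero]
    symm; exact dif_neg (c := D.next 0 v ∈ D.V₀) h

theorem pathHom_ySum : D.pathHom D.ySum = D.genE 1 := by
  rw [genE, ySum, map_sum]
  refine Finset.sum_congr rfl fun v _ => ?_
  by_cases h : yNext v ∈ D.V₀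
  · rw [dif_pos h, pathHom_arrow]
    symm; exact dif_pos (c := D.next 1 v ∈ D.V₀) h
  · rw [dif_neg h, map_zero]
    symm; exact dif_neg (c := D.next 1 v ∈ D.V₀) h

theorem genE_mul_idemE_inr (i : Fin 2) (s : Fin D.ℓ) : D.genE i * idemE (Sum.inr s) = 0 := by
  rw [genE, Finset.sum_mul]
  refine Finset.sum_eq_zero fun v _ => ?_
  split_ifs with h
  · refine arrowE_mul_idemE_ne ?_
    rw [src_step]
    exact Sum.inl_ne_inr
  · exact zero_mul _

theorem invE_genE_mul_inr (i : Fin 2) (u : D.Vertex) (r : Fin D.ℓ) (e : D.EndAlg) :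
    invE u (Sum.inr r) (D.genE i * e) = 0 := by
  rw [genE, Finset.sum_mul, map_sum]
  refine Finset.sum_eq_zero fun v _ => ?_
  split_ifs with h
  · refine invE_arrow_mul_ne ?_ u e
    rw [tgt_step]
    exact Sum.inr_ne_inl
  · rw [zero_mul, map_zero]

theorem invE_step_mul (i : Fin 2) (v : D.V₀) (h : D.next i v ∈ D.V₀) (u : D.V₀) (e : D.EndAlg) :
    invE (Sum.inl u) (Sum.inl ⟨_, h⟩) (arrowE (step i v h) * e) =
      X i * invE (Sum.inl u) (Sum.inl v) e := by
  fin_cases i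
  · exact invE_x_mul v h u e
  · exact invE_y_mul v h u e

/-- Left multiplication by `x` or `y`, in terms of invariants. -/
theorem invE_genE_mul (i : Fin 2) (u : D.V₀) {d : D.L} (hd : ∃ n m : ℕ, d = D.cls n m) {F : PolyS}
    {e : D.EndAlg} (he : ∀ v : D.V₀, invE (Sum.inl u) (Sum.inl v) e =
      if D.pos v = D.pos u + d then F else 0) (w : D.V₀) :
    invE (Sum.inl u) (Sum.inl w) (D.genE i * e) =
      if D.pos w = D.pos u + (d + D.deg i) then X i * F else 0 := by
  rw [genE, Finset.sum_mul, map_sum]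
  have hne : ∀ v : D.V₀, D.next i v ≠ w → invE (Sum.inl u) (Sum.inl w)
      ((if h : D.next i v ∈ D.V₀ then arrowE (step i v h) else 0) * e) = 0 := by
    intro v hv
    split_ifs with h
    · refine invE_arrow_mul_ne ?_ _ e
      rw [tgt_step]
      intro h'
      exact hv (congrArg Subtype.val (Sum.inl_injective h')).symm
    · rw [zero_mul, map_zero]
  -- If `w` has a predecessor, only the arrow from it contributes. If not, the degree before `w` is
  -- a boundary degree, which cannot be reached from `u` by an effective class, so both sides are
  -- zero.
  rcases exists_pred i w with ⟨v, hv⟩ | hb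
  · have hpos := pos_next i v.2
    obtain ⟨w, hw⟩ := w
    dsimp only at hv
    subst hv
    rw [Finset.sum_eq_single v]
    · rw [dif_pos hw, invE_step_mul, he, mul_ite, mul_zero]
      refine if_congr ?_ rfl rfl
      rw [hpos, ← add_assoc, add_left_inj]
    · intro v' _ hv'
      refine hne v' fun h => hv' (Subtype.ext (D.pos_inj v'.2 v.2 ?_))
      have h1 := pos_next i v'.2
      rw [h, hpos, add_left_inj] at h1
      exact h1.symm
    · exact fun h => absurd (Finset.mem_univ _) h
  · rw [Finset.sum_eq_zero, if_neg]
    · intro h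
      obtain ⟨n, m, rfl⟩ := hd
      refine hb.sub_ne_pos n m u.2 ?_
      rw [h]; abel
    · intro v _
      refine hne v fun h => hb.add_ne_pos 0 v.2 ?_
      rw [← h, pos_next i v.2, zero_smul, add_zero, add_sub_cancel_right]

theorem invE_idemE_inl (u v : D.V₀) : invE (Sum.inl u) (Sum.inl v) (idemE (Sum.inl u)) =
    if D.pos v = D.pos u + 0 then 1 else 0 := by
  rw [add_zero]
  by_cases h : D.pos v = D.pos u
  · obtain rfl : v = u := Subtype.ext (D.pos_inj v.2 u.2 h)
    rw [if_pos h, invE_idemE_self]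
  · rw [if_neg h, invE_idemE_ne]
    rintro ⟨-, h'⟩
    exact h (Sum.inl_injective h' ▸ rfl)

/-- The class of the path `x^a y^b` that starts at `u`. -/
def monE (a b : ℕ) (u : D.V₀) : D.EndAlg := D.genE 0 ^ a * D.genE 1 ^ b * idemE (Sum.inl u)

theorem genE_zero_mul_monE (a b : ℕ) (u : D.V₀) : D.genE 0 * monE a b u = monE (a + 1) b u := by
  rw [monE, monE, pow_succ', mul_assoc, mul_assoc, mul_assoc]

theorem genE_one_mul_monE (b : ℕ) (u : D.V₀) : D.genE 1 * monE 0 b u = monE 0 (b + 1) u := by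
  rw [monE, monE, pow_zero, one_mul, one_mul, pow_succ', mul_assoc]

/-- A path between two vertices is never lost on the way, whatever the order of its steps: leaving
the set of vertices would mean passing through a boundary degree. So the invariant is the full
monomial. -/
theorem invE_monE (a b : ℕ) (u w : D.V₀) : invE (Sum.inl u) (Sum.inl w) (monE a b u) =
    if D.pos w = D.pos u + D.cls a b then X 0 ^ a * X 1 ^ b else 0 := by
  induction a generalizing w with
  | zero =>
    induction b generalizing w with
    | zero =>
      rw [monE, pow_zero, pow_zero, one_mul, one_mul, invE_idemE_inl, pow_zero, pow_zero, one_mul]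
      rfl
    | succ b ih =>
      rw [← genE_one_mul_monE, invE_genE_mul 1 u ⟨0, b, rfl⟩ ih, deg_one_eq, cls_add, pow_succ' (X 1),
        pow_zero, one_mul, one_mul, add_zero]
      push_cast
      rfl
  | succ a ih =>
    rw [← genE_zero_mul_monE, invE_genE_mul 0 u ⟨a, b, rfl⟩ ih, deg_zero_eq, cls_add, pow_succ',
      mul_assoc, add_zero]
    push_cast
    rfl

theorem genE_comm : D.genE 0 * D.genE 1 = D.genE 1 * D.genE 0 := by
  refine ext_invE fun u v => ?_
  rw [← invE_mul_idemE_self u v (D.genE 0 * D.genE 1),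
    ← invE_mul_idemE_self u v (D.genE 1 * D.genE 0), mul_assoc, mul_assoc]
  rcases u with u | s
  · rcases v with w | r
    · have h0 : ∃ n m : ℕ, (0 : D.L) = D.cls n m := ⟨0, 0, rfl⟩
      have h1 := invE_genE_mul 1 u h0 (invE_idemE_inl u)
      have h2 := invE_genE_mul 0 u h0 (invE_idemE_inl u)
      rw [invE_genE_mul 0 u ⟨0, 1, (zero_add _).trans deg_one_eq⟩ h1,
        invE_genE_mul 1 u ⟨1, 0, (zero_add _).trans deg_zero_eq⟩ h2, add_right_comm, mul_left_comm]
    · rw [invE_genE_mul_inr, invE_genE_mul_inr]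
  · rw [genE_mul_idemE_inr, genE_mul_idemE_inr, mul_zero, mul_zero]

theorem cls_P_zero : D.cls D.P 0 = D.cls 0 D.Q := by
  rw [← nsmul_deg_zero, ← nsmul_deg_one, P_smul]

/-- The paths $x^P$ and $y^Q$ end in the same degree, and composing with $c_r$ evaluates their
invariants at the point, where $x^P$ equals `root r` times $y^Q$. -/
theorem arrowE_c_mul (r : Fin D.ℓ) (h : (D.p - 1, D.q - 1) ∈ D.V₀) :
    arrowE (.c r h) * (D.genE 0 ^ D.P - D.root r • D.genE 1 ^ D.Q) = 0 := by
  refine ext_invE fun u v => ?_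
  rw [map_zero]
  by_cases hv : v = D.tgt (.c r h)
  · subst hv
    rcases u with u | s
    · refine (invE_c_mul r h u _).trans ?_
      rw [← invE_mul_idemE_self, sub_mul, smul_mul_assoc, map_sub, map_smul]
      have e1 : D.genE 0 ^ D.P * idemE (Sum.inl u) = monE D.P 0 u := by
        rw [monE, pow_zero, mul_one]
      have e2 : D.genE 1 ^ D.Q * idemE (Sum.inl u) = monE 0 D.Q u := by
        rw [monE, pow_zero, one_mul]
      rw [e1, e2, invE_monE, invE_monE, Nat.cast_zero, cls_P_zero]
      split_ifs
      · rw [map_sub, map_smul, map_mul, map_mul, map_pow, map_pow, map_pow, map_pow, ev_X_zero,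
          ev_X_one, rootP_pow, one_pow, one_pow, pow_zero, mul_one, mul_one, smul_eq_mul, mul_one,
          sub_self, map_zero]
      · rw [smul_zero, sub_zero, map_zero, map_zero]
    -- As $P$ and $Q$ are positive, each power has a factor to absorb the idempotent of
    -- $K_{w_s}[3]$, on which $x$ and $y$ vanish.
    · rw [← invE_mul_idemE_self, mul_assoc, sub_mul, smul_mul_assoc,
        ← Nat.succ_pred_eq_of_pos D.P_pos, ← Nat.succ_pred_eq_of_pos D.Q_pos, pow_succ, pow_succ,
        mul_assoc, mul_assoc, genE_mul_idemE_inr, genE_mul_idemE_inr, mul_zero, mul_zero, smul_zero,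
        sub_zero, mul_zero, map_zero]
  · exact invE_arrow_mul_ne hv u _

variable (D) in
/-- The representation of the algebra of the quiver with relations in the cohomology category. -/
def quiverHom : D.QuiverAlgebra →ₐ[ℂ] D.EndAlg :=
  RingQuot.liftAlgHom ℂ ⟨D.pathHom, by
    intro a b h
    induction h with
    | comm => rw [map_mul, map_mul, pathHom_xSum, pathHom_ySum, genE_comm]
    | c r h =>
      rw [map_mul, map_sub, map_smul, map_pow, map_pow, pathHom_xSum, pathHom_ySum, pathHom_arrow,
        arrowE_c_mul, map_zero]⟩

theorem quiverHom_vertex (v : D.Vertex) : D.quiverHom (D.vertex v) = idemE v := by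
  rw [quiverHom, vertex, RingQuot.liftAlgHom_mkAlgHom_apply, pathHom_vertex]

theorem quiverHom_arrow (a : D.Arrow) : D.quiverHom (D.arrow a) = arrowE a := by
  rw [quiverHom, arrow, RingQuot.liftAlgHom_mkAlgHom_apply, pathHom_arrow]

theorem quiverHom_gen (i : Fin 2) : D.quiverHom (D.gen i) = D.genE i := by
  fin_cases i
  · change D.quiverHom (D.gen 0) = D.genE 0
    rw [quiverHom, gen_zero, RingQuot.liftAlgHom_mkAlgHom_apply, pathHom_xSum]
  · change D.quiverHom (D.gen 1) = D.genE 1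
    rw [quiverHom, gen_one, RingQuot.liftAlgHom_mkAlgHom_apply, pathHom_ySum]

theorem quiverHom_mon (a b : ℕ) (u : D.V₀) : D.quiverHom (mon a b u) = monE a b u := by
  rw [mon, monE, map_mul, map_mul, map_pow, map_pow, quiverHom_gen, quiverHom_gen, quiverHom_vertex]

end BPData
end

/-! ### Bijectivity of the representation -/

noncomputable section

open MvPolynomial Matrix MatFac

namespace BPData

variable {D : BPData}

variable (D) in
/-- The linear map from polynomials that sends `x^a y^b` to the sum of all paths `x^a y^b`. -/
def pol : PolyS →ₗ[ℂ] D.QuiverAlgebra :=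
  (basisMonomials (Fin 2) ℂ).constr ℂ fun d => D.gen 0 ^ d 0 * D.gen 1 ^ d 1

theorem pol_monomial (d : Fin 2 →₀ ℕ) (z : ℂ) :
    D.pol (monomial d z) = z • (D.gen 0 ^ d 0 * D.gen 1 ^ d 1) := by
  have h : (monomial d z : PolyS) = z • basisMonomials (Fin 2) ℂ d := by
    rw [coe_basisMonomials, smul_monomial, smul_eq_mul, mul_one]
  rw [h, map_smul, pol, Module.Basis.constr_basis]

theorem pol_monomial_mul (d : Fin 2 →₀ ℕ) (z : ℂ) (u : D.V₀) :
    D.pol (monomial d z) * D.vertex (Sum.inl u) = z • mon (d 0) (d 1) u := by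
  rw [pol_monomial, smul_mul_assoc, mon]

theorem pol_X_pow_mul (a b : ℕ) (u : D.V₀) :
    D.pol (X 0 ^ a * X 1 ^ b) * D.vertex (Sum.inl u) = mon a b u := by
  rw [X_pow_mul_X_pow_eq_monomial, pol_monomial_mul]
  simp

/-- Homogeneity makes every monomial of `F` a path from `u` that ends at `v`, and the invariant of
this path is the monomial itself. This supplies both injectivity and surjectivity on the components
between the $K_0^{i,j}$. -/
theorem invE_pol {F : PolyS} {u v : D.V₀}
    (hF : IsWeightedHomogeneous D.deg F (D.pos v - D.pos u)) :
    invE (Sum.inl u) (Sum.inl v) (D.quiverHom (D.pol F * D.vertex (Sum.inl u))) = F := by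
  conv_lhs => rw [F.as_sum]
  conv_rhs => rw [F.as_sum]
  rw [map_sum, Finset.sum_mul, map_sum, map_sum]
  refine Finset.sum_congr rfl fun d hd => ?_
  have hw := hF (mem_support_iff.1 hd)
  rw [weight_eq] at hw
  rw [pol_monomial_mul, map_smul, map_smul, quiverHom_mon, invE_monE, if_pos (by rw [hw]; abel),
    monomial_eq_C_mul, smul_eq_C_mul]

theorem invE_vertex_mul (u v : D.Vertex) (z : D.QuiverAlgebra) :
    invE u v (D.quiverHom (D.vertex v * z)) = invE u v (D.quiverHom z) := by
  rw [map_mul, quiverHom_vertex, invE_idemE_mul_self]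

theorem invE_mul_vertex (u v : D.Vertex) (z : D.QuiverAlgebra) :
    invE u v (D.quiverHom (z * D.vertex u)) = invE u v (D.quiverHom z) := by
  rw [map_mul, quiverHom_vertex, invE_mul_idemE_self]

/-- The paths between two vertices of the first kind are the homogeneous polynomials. -/
theorem exists_vertex_mul_eq_pol {u : D.V₀} {z : D.QuiverAlgebra} (hz : z ∈ pathsFrom u)
    (v : D.V₀) : ∃ F : PolyS, IsWeightedHomogeneous D.deg F (D.pos v - D.pos u) ∧
      D.vertex (Sum.inl v) * z =
        D.vertex (Sum.inl v) * (D.pol F * D.vertex (Sum.inl u)) := by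
  have h0 : D.vertex (Sum.inl v) * (D.pol 0 * D.vertex (Sum.inl u)) = 0 := by
    rw [map_zero, zero_mul, mul_zero]
  induction hz using Submodule.span_induction with
  | mem z hz =>
    rcases hz with ⟨a, b, rfl⟩ | ⟨r, h, a, b, rfl⟩
    · by_cases h : D.pos v = D.pos u + D.cls a b
      · refine ⟨X 0 ^ a * X 1 ^ b, ?_, by rw [pol_X_pow_mul]⟩
        rw [h, add_sub_cancel_left]
        exact X_pow_mul_X_pow_homogeneous a b
      · exact ⟨0, isWeightedHomogeneous_zero _ _ _,
          by rw [h0, (endsAt_mon a b u).vertex_mul_ne v h]⟩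
    · refine ⟨0, isWeightedHomogeneous_zero _ _ _, ?_⟩
      rw [h0, ← mul_assoc, vertex_mul_arrow_ne (a := .c r h) Sum.inl_ne_inr, zero_mul]
  | zero => exact ⟨0, isWeightedHomogeneous_zero _ _ _, by rw [h0, mul_zero]⟩
  | add x y _ _ hx hy =>
    obtain ⟨F, hF, hx⟩ := hx
    obtain ⟨G, hG, hy⟩ := hy
    exact ⟨F + G, hF.add hG, by rw [mul_add, hx, hy, map_add, add_mul, mul_add]⟩
  | smul c x _ hx =>
    obtain ⟨F, hF, hx⟩ := hx
    exact ⟨c • F, Submodule.smul_mem (weightedHomogeneousSubmodule ℂ D.deg _) c hF,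
      by rw [mul_smul_comm, hx, map_smul, smul_mul_assoc, mul_smul_comm]⟩

/-- A path from `u` to the vertex of `K_{w_r}[3]`. -/
def toCorner (u : D.V₀) (r : Fin D.ℓ) : D.QuiverAlgebra :=
  D.arrow (.c r (corner_mem u)) * mon (D.p - 1 - u.1.1) (D.q - 1 - u.1.2) u

theorem arrow_c_mul_mon (r : Fin D.ℓ) (h : (D.p - 1, D.q - 1) ∈ D.V₀) (u : D.V₀) (a k b : ℕ) :
    D.arrow (.c r h) * mon (a + k * D.P) b u =
      D.root r ^ k • (D.arrow (.c r h) * mon a (b + k * D.Q) u) := by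
  induction k generalizing b with
  | zero => rw [zero_mul, zero_mul, add_zero, add_zero, pow_zero, one_smul]
  | succ k ih =>
    have h1 : ∀ m : ℕ, mon (m + D.P) b u = D.gen 0 ^ D.P * mon m b u := fun m => by
      rw [mon, mon, add_comm, pow_add, mul_assoc, mul_assoc, mul_assoc]
    have h2 : ∀ m : ℕ, D.gen 1 ^ D.Q * mon m b u = mon m (b + D.Q) u := fun m => by
      rw [mon, mon, add_comm, pow_add, ← mul_assoc, ← mul_assoc, ← mul_assoc,
        ((gen_comm.pow_left m).pow_right D.Q).eq]
    rw [Nat.succ_mul, ← add_assoc, h1, ← mul_assoc, arrow_c_mul, smul_mul_assoc, mul_assoc, h2, ih,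
      smul_smul, pow_succ', add_assoc, add_comm D.Q, ← Nat.succ_mul]

/-- The exponent of $x$ in `toCorner` is less than $P$, so any other path to the corner arises from
it by trading $y^{kQ}$ for $x^{kP}$ with $k\ge0$. The relation for $c_r$ undoes this trade at the
price of a scalar. -/
theorem exists_arrow_c_mul_mon (r : Fin D.ℓ) (h : (D.p - 1, D.q - 1) ∈ D.V₀) (u : D.V₀) (a b : ℕ) :
    ∃ c : ℂ, D.arrow (.c r h) * mon a b u = c • toCorner u r := by
  by_cases hpos : D.pos (D.p - 1, D.q - 1) = D.pos u + D.cls a b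
  · obtain ⟨h1, h2, h3, h4, h5⟩ := D.mem_V₀_iff.1 u.2
    rw [pos, pos, cls_add, cls_eq_iff] at hpos
    obtain ⟨k, hk1, hk2⟩ := hpos
    have hp' := D.intCast_p
    have hp := D.p_pos
    have hq := D.q_pos
    have hP : (0 : ℤ) < D.P := by exact_mod_cast D.P_pos
    have hℓP : (D.ℓ : ℤ) * D.P = (D.ℓ - 1) * D.P + D.P := by ring
    push_cast [hp, hq] at hk1 hk2
    have hk : 0 ≤ k := by
      by_contra! hk
      nlinarith
    lift k to ℕ using hk
    refine ⟨D.root r ^ k, ?_⟩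
    have ha : a = D.p - 1 - u.1.1 + k * D.P := by zify [hp]; omega
    have hb : b + k * D.Q = D.q - 1 - u.1.2 := by zify [hq]; omega
    rw [toCorner, ← hb, ha, arrow_c_mul_mon]
  · refine ⟨0, ?_⟩
    rw [zero_smul, ← arrow_mul_vertex_src, mul_assoc]
    change _ * (D.vertex (Sum.inl ⟨_, h⟩) * _) = 0
    rw [(endsAt_mon a b u).vertex_mul_ne ⟨_, h⟩ hpos, mul_zero]

theorem exists_vertex_mul_eq_smul {u : D.V₀} {z : D.QuiverAlgebra} (hz : z ∈ pathsFrom u)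
    (r : Fin D.ℓ) : ∃ c : ℂ, D.vertex (Sum.inr r) * z = c • toCorner u r := by
  induction hz using Submodule.span_induction with
  | mem z hz =>
    rcases hz with ⟨a, b, rfl⟩ | ⟨s, h, a, b, rfl⟩
    · exact ⟨0, by rw [zero_smul, (endsAt_mon a b u).vertex_inr_mul]⟩
    · by_cases hs : s = r
      · subst hs
        obtain ⟨c, hc⟩ := exists_arrow_c_mul_mon s h u a b
        exact ⟨c, by rw [← hc, ← mul_assoc]; exact congrArg (· * _) (vertex_tgt_mul (.c s h))⟩
      · refine ⟨0, ?_⟩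
        rw [zero_smul, ← mul_assoc, vertex_mul_arrow_ne, zero_mul]
        exact fun h' => hs (Sum.inr_injective h').symm
  | zero => exact ⟨0, by rw [zero_smul, mul_zero]⟩
  | add x y _ _ hx hy =>
    obtain ⟨a, hx⟩ := hx
    obtain ⟨b, hy⟩ := hy
    exact ⟨a + b, by rw [mul_add, hx, hy, add_smul]⟩
  | smul c x _ hx =>
    obtain ⟨a, hx⟩ := hx
    exact ⟨c * a, by rw [mul_smul_comm, hx, smul_smul]⟩

theorem invE_toCorner (u : D.V₀) (r : Fin D.ℓ) :
    invE (Sum.inl u) (Sum.inr r) (D.quiverHom (toCorner u r)) =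
      C (rootP r ^ (D.p - 1 - u.1.1)) := by
  obtain ⟨h1, h2, h3, h4, h5⟩ := D.mem_V₀_iff.1 u.2
  have hp' := D.intCast_p
  have hp := D.p_pos
  have hq := D.q_pos
  rw [toCorner, map_mul, quiverHom_arrow, quiverHom_mon]
  refine (invE_c_mul r (corner_mem u) u _).trans ?_
  rw [invE_monE, if_pos]
  · rw [map_mul, map_pow, map_pow, ev_X_zero, ev_X_one, one_pow, mul_one]
  · rw [pos, pos, cls_add]
    congr 1
    · dsimp only; omega
    · dsimp only; omega

/-- Between two vertices an element of the algebra is given by a polynomial or by a scalar, which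
its invariant recovers, in the case of `toCorner` up to a nonzero power of $\rho$. Vanishing
invariants thus force every component to vanish, and the idempotents sum to $1$. -/
theorem quiverHom_injective : Function.Injective D.quiverHom := by
  rw [injective_iff_map_eq_zero]
  intro t ht
  have h0 : ∀ u v, invE u v (D.quiverHom (t * D.vertex u)) = 0 := fun u v => by
    rw [invE_mul_vertex, ht, map_zero]
  have hvu : ∀ u v, D.vertex v * (t * D.vertex u) = 0 := by
    rintro (u | s) v
    · have hz := mul_vertex_mem_pathsFrom t u
      rcases v with v | r
      · obtain ⟨F, hF, h⟩ := exists_vertex_mul_eq_pol hz v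
        have h1 := h0 (Sum.inl u) (Sum.inl v)
        rw [← invE_vertex_mul, h, invE_vertex_mul, invE_pol hF] at h1
        rw [h, h1, map_zero, zero_mul, mul_zero]
      · obtain ⟨c, h⟩ := exists_vertex_mul_eq_smul hz r
        have h1 := h0 (Sum.inl u) (Sum.inr r)
        rw [← invE_vertex_mul, h, map_smul, map_smul, invE_toCorner, smul_eq_zero, C_eq_zero] at h1
        rw [h, h1.resolve_right (pow_ne_zero _ (rootP_ne_zero r)), zero_smul]
    · obtain ⟨c, h⟩ := exists_mul_vertex_inr t s
      have h1 := h0 (Sum.inr s) (Sum.inr s)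
      rw [h, map_smul, map_smul, quiverHom_vertex, invE_idemE_self, smul_eq_zero] at h1
      rw [h, h1.resolve_right one_ne_zero, zero_smul, mul_zero]
  rw [← one_mul t, ← mul_one (1 * t), ← sum_vertex, Finset.mul_sum]
  refine Finset.sum_eq_zero fun u _ => ?_
  rw [Finset.sum_mul, Finset.sum_mul]
  exact Finset.sum_eq_zero fun v _ => by rw [mul_assoc, hvu]

theorem exists_invE_quiverHom_eq (f : D.EndAlg) (u v : D.Vertex) :
    ∃ t, invE u v (D.quiverHom t) = invE u v f := by
  rcases v with v | r
  · rcases u with u | s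
    · exact ⟨_, invE_pol (homogeneous_invE u v f)⟩
    · exact ⟨0, rfl⟩
  · obtain ⟨z, hz⟩ := exists_invE_eq_C u r f
    rcases u with u | s
    · refine ⟨(z * (rootP r ^ (D.p - 1 - u.1.1))⁻¹) • toCorner u r, ?_⟩
      rw [hz, map_smul, map_smul, invE_toCorner, smul_eq_C_mul, ← C_mul,
        inv_mul_cancel_right₀ (pow_ne_zero _ (rootP_ne_zero r))]
    · by_cases h : s = r
      · subst h
        refine ⟨z • D.vertex (Sum.inr s), ?_⟩
        rw [hz, map_smul, map_smul, quiverHom_vertex, invE_idemE_self, smul_eq_C_mul, mul_one]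
      · exact ⟨0, by rw [invE_inr_inr_ne h, invE_inr_inr_ne h]⟩

/-- Preimages are found for each component separately; cutting them down by the idempotents prevents
interference when they are added. -/
theorem quiverHom_surjective : Function.Surjective D.quiverHom := by
  intro f
  choose t ht using exists_invE_quiverHom_eq f
  refine ⟨∑ u, ∑ v, D.vertex v * t u v * D.vertex u, ext_invE fun a b => ?_⟩
  rw [map_sum, map_sum, Finset.sum_eq_single a, map_sum, map_sum, Finset.sum_eq_single b,
    invE_mul_vertex, invE_vertex_mul, ht]
  · intro v _ hv
    rw [invE_mul_vertex, map_mul, quiverHom_vertex, invE_idemE_mul_ne hv.symm]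
  · exact fun h => absurd (Finset.mem_univ _) h
  · intro u _ hu
    rw [← Finset.sum_mul, map_mul, quiverHom_vertex, invE_mul_idemE_ne hu.symm]
  · exact fun h => absurd (Finset.mem_univ _) h

variable (D) in
/-- The algebra of the quiver with relations is the total endomorphism algebra. -/
def quiverEquiv : D.QuiverAlgebra ≃ₐ[ℂ] D.EndAlg :=
  AlgEquiv.ofBijective D.quiverHom ⟨quiverHom_injective, quiverHom_surjective⟩

end BPData
end

theorem mainTheorem7 (D : BPData) :
    (∀ (u v : D.Vertex) (n : ℤ), n ≠ 0 → Subsingleton (D.B.H u v n)) ∧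
    (∃ φ : D.QuiverAlgebra ≃ₐ[ℂ] (MatFac.sum D.obj).H0End,
      ∀ v : D.Vertex, φ (D.vertex v) = Ideal.Quotient.mk _ (MatFac.idem D.obj v)) ∧
    D.B.IntrinsicallyFormal :=
  -- `EndAlg` and `idemE` unfold to the quotient algebra and to the class of `idem`, so the
  -- equivalence and `quiverHom_vertex` apply by definition.
  ⟨D.concentratedInDegreeZero_B, ⟨D.quiverEquiv, BPData.quiverHom_vertex⟩,
    AInfCat.intrinsicallyFormal_of_concentratedInDegreeZero _ D.concentratedInDegreeZero_B⟩
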